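/- Let $\mathcal Q$ be a finite nonempty poset and let $G(\mathcal Q)$ be a simple complex of groups over $\mathcal Q$: groups $P_J$ ($J\in\mathcal Q$) and monomorphisms $\phi_{TJ}\colon P_J\to P_T$ ($J\le T$) with $\phi_{UT}\phi_{TJ}=\phi_{UJ}$ for $J\le T\le U$. Let $G$ be a group and let $\psi\colon G(\mathcal Q)\to G$ be a simple morphism (homomorphisms $\psi_J\colon P_J\to G$ with $\psi_T\phi_{TJ}=\psi_J$) that is injective on local groups; such a $\psi$ exists if and only if $G(\mathcal Q)$ is strictly developable, i.e. the canonical maps $P_J\to\varinjlim P_J$ are injective, and one may take $G=\varinjlim P_J$. Identify $P_J$ with $\psi_J(P_J)\le G$. Let $\mathcal F$ be the smallest family of subgroups of $G$ (closed under conjugation and passing to subgroups) that contains all $P_J$. Let $K=|\mathcal Q|$ be the geometric realisation of $\mathcal Q$, with panels $K_J=|\mathcal Q_{\ge J}|$, and let $X=D(K,G(\mathcal Q),\psi)=G\times K/\!\sim$ be the Basic Construction, where $(g_1,x_1)\sim(g_2,x_2)$ if and only if $x_1=x_2$ and $g_1^{-1}g_2\in P_{J(x_1)}$, with $K_{J(x)}$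 the intersection of all panels containing $x$. For an $\mathcal O_{\mathcal F}G$-module $M$ (a contravariant functor from the orbit category of the $G/H$, $H\in\mathcal F$, to abelian groups), $H^*_{\mathcal F}(X;M)$ is the cohomology of $\mathrm{Hom}_{\mathcal F}(C_*(X^{(-)}),M)$, where $C_*$ denotes cellular chains. For $S\le G$ let $\mathcal B_S$ be the module $\mathcal B_S(G/L)=\mathbb Z[\mathrm{isom}_G(G/L,G/S)]$, where $\mathrm{isom}_G(G/L,G/S)$ is the set of $G$-maps $L\mapsto xS$ with $x^{-1}Lx=S$ (so the module vanishes at $G/L$ unless $L$ and $S$ are conjugate), and where a map $\theta\colon G/H\to G/L$, $H\mapsto yL$, sends $\varphi$ to $\varphi\circ\theta$ if $y^{-1}Hy=L$ and to $0$ otherwise. A block is an equivalence class of the equivalence relation on $\mathcal Q$ generated by $J\sim J'$ if $J\le J'$ and $\phi_{J'J}$ is an isomorphism. For $J\in\mathcal Q$, $g\in G$ put $\Omega_J^g=\{U\in\mathcal Q\mid P_U=g^{-1}P_Jg\}$, and let $\mathcal I_J$ be a complete set of representatives of $\{g\in G\mid \Omega^g_J\neq\emptyset\}/P_J$, where $P_J$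 acts by left multiplication. For a block $C$ put $K_C=|\{V\mid V\ge U\text{ for some }U\in C\}|$ and $K_{>C}=|\{V\mid V\ge U\text{ for some }U\in C\text{ with }P_V\gneq P_U\}|$. Then for every $J\in\mathcal Q$, every such $\mathcal I_J$ and every $n\ge 0$, $$H^n_{\mathcal F}(X;\mathcal B_{P_J})\;\cong\;\bigoplus_{g\in\mathcal I_J}\ \bigoplus_{C\subseteq\Omega^g_J\text{ a block}}H^n(K_C,K_{>C}),$$ with integral relative cohomology on the right. If moreover no $G$-conjugate of any $P_J$ is properly contained in $P_J$ (rigidity) and $X$ is a model for $E_{\mathcal F}G$ (all stabilisers lie in $\mathcal F$, and $X^H$ is contractible for every $H\in\mathcal F$), then $$\mathrm{cd}_{\mathcal F}G=\max\{n\in\mathbb N\mid H^n(K_C,K_{>C})\neq 0\text{ for some block }C\subseteq\mathcal Q\},$$ where $\mathrm{cd}_{\mathcal F}G=\sup\{n\mid \mathrm{Ext}^n_{\mathcal O_{\mathcal F}G}(\underline{\mathbb Z},M)\ne0\text{ for some }\mathcal O_{\mathcal F}G\text{-module }M\}$; in particular the maximum exists. -/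

import Mathlib

open CategoryTheory
open scoped DirectSum

universe v u

noncomputable section

/-! ## Families of subgroups and classifying spaces -/

section Families

variable {G : Type u} [Group G]

/-- The conjugate `g H g⁻¹`. -/
def conjSubgroup (g : G) (H : Subgroup G) : Subgroup G :=
  H.map (MulAut.conj g).toMonoidHom

/-- A family of subgroups: closed under conjugation and under passing to subgroups. -/
structure IsFamily (F : Set (Subgroup G)) : Prop where
  conj_mem : ∀ H ∈ F, ∀ g : G, conjSubgroup g H ∈ F
  mem_of_le : ∀ H ∈ F, ∀ L : Subgroup G, L ≤ H → L ∈ F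

/-- The smallest family of subgroups containing a given collection. -/
def familyGenerated (S : Set (Subgroup G)) : Set (Subgroup G) :=
  {H | ∀ F : Set (Subgroup G), IsFamily F → S ⊆ F → H ∈ F}

/-- A collection of subgroups is rigid if no conjugate of a member is properly contained in
that member. -/
def IsRigid (S : Set (Subgroup G)) : Prop :=
  ∀ H ∈ S, ∀ g : G, ¬ conjSubgroup g H < H

/-- The condition on stabilisers and fixed-point sets that makes a `G`-CW-complex `Y` a model for
`E_F G`: all stabilisers lie in `F`, and `Y^H` is contractible for every `H ∈ F`.  (In a
`G`-CW-complex the stabiliser of a cell fixes it pointwise, so that the stabilisers of cells are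
the stabilisers of points.) -/
structure IsModelE (F : Set (Subgroup G)) (Y : Type*) [TopologicalSpace Y] [MulAction G Y] :
    Prop where
  stabilizer_mem : ∀ y : Y, MulAction.stabilizer G y ∈ F
  contractible_fixedPoints : ∀ H ∈ F, ContractibleSpace (MulAction.fixedPoints H Y)

end Families

/-! ## The orbit category and its modules -/

section OrbitCategory

variable {G : Type u} [Group G]

/-- Objects of the orbit category: the transitive `G`-sets `G/H` for `H ∈ F`. -/
structure OrbitCat (F : Set (Subgroup G)) : Type u where
  subgroup : Subgroup G
  mem : subgroup ∈ F

variable (F : Set (Subgroup G))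

/-- Morphisms `G/H ⟶ G/P` are the `G`-equivariant maps. -/
instance : Category.{u} (OrbitCat F) where
  Hom H P := (G ⧸ H.subgroup) →[G] (G ⧸ P.subgroup)
  id H := MulActionHom.id G
  comp f g := g.comp f

/-- An `O_F G`-module is a contravariant functor from the orbit category to `ℤ`-modules. -/
abbrev OrbitModule := (OrbitCat F)ᵒᵖ ⥤ ModuleCat.{u} ℤ

/-- The constant module with value `ℤ`. -/
def constantModule : OrbitModule F :=
  (Functor.const _).obj (ModuleCat.of ℤ (ULift.{u} ℤ))

/-- Bredon cohomology of the group: `H^n_F(G; M) = Ext^n(ℤ, M)`, computed in the abelian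
category of `O_F G`-modules. -/
def bredonGroupCohomology (M : OrbitModule F) (n : ℕ) : Type (u + 1) :=
  @Abelian.Ext (OrbitModule F) _ _ (HasExt.standard _) (constantModule F) M n

instance (M : OrbitModule F) (n : ℕ) : AddCommGroup (bredonGroupCohomology F M n) :=
  letI : HasExt.{u + 1} (OrbitModule F) := HasExt.standard _
  inferInstanceAs (AddCommGroup (Abelian.Ext (constantModule F) M n))

/-- The Bredon cohomological dimension `cd_F G`. -/
def bredonCohDim : ℕ∞ :=
  sSup {d : ℕ∞ | ∃ n : ℕ, d = n ∧ ∃ M : OrbitModule F, Nontrivial (bredonGroupCohomology F M n)}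

/-- For `s ∈ S^P`, the `G`-map `G/P → S`, `xP ↦ x s`. -/
def orbitMap {S : Type u} [MulAction G S] {P : Subgroup G} (s : MulAction.fixedPoints P S) :
    (G ⧸ P) →[G] S where
  toFun := Quotient.lift (fun x : G => x • (s : S)) (by
    intro a b h
    have h' : a⁻¹ * b ∈ P := QuotientGroup.leftRel_apply.mp h
    have := s.2 ⟨a⁻¹ * b, h'⟩
    rw [Subgroup.mk_smul, mul_smul, inv_smul_eq_iff] at this
    exact this.symm)
  map_smul' g c := by
    induction c using Quotient.inductionOn with
    | h x => exact mul_smul g x (s : S)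

lemma orbitMap_mk {S : Type u} [MulAction G S] {P : Subgroup G} (s : MulAction.fixedPoints P S)
    (x : G) : orbitMap s (x : G ⧸ P) = x • (s : S) := rfl

/-- A `G`-map `G/H → G/P` sending the coset `H` to `xP` induces `S^P → S^H`, `s ↦ x s`. -/
def fixedPointsMap {S : Type u} [MulAction G S] {H P : Subgroup G} (θ : (G ⧸ H) →[G] (G ⧸ P))
    (s : MulAction.fixedPoints P S) : MulAction.fixedPoints H S :=
  ⟨orbitMap s (θ ((1 : G) : G ⧸ H)), fun h => by
    have e : (h : G) • ((1 : G) : G ⧸ H) = ((1 : G) : G ⧸ H) := by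
      rw [MulAction.Quotient.smul_coe, QuotientGroup.eq]
      simp
    change (h : G) • orbitMap s (θ ((1 : G) : G ⧸ H)) = orbitMap s (θ ((1 : G) : G ⧸ H))
    rw [← map_smul, ← map_smul, e]⟩

lemma fixedPointsMap_id {S : Type u} [MulAction G S] {P : Subgroup G}
    (s : MulAction.fixedPoints P S) : fixedPointsMap (MulActionHom.id G) s = s :=
  Subtype.ext (one_smul G (s : S))

lemma fixedPointsMap_comp {S : Type u} [MulAction G S] {H L P : Subgroup G}
    (θ : (G ⧸ H) →[G] (G ⧸ L)) (η : (G ⧸ L) →[G] (G ⧸ P)) (s : MulAction.fixedPoints P S) :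
    fixedPointsMap (η.comp θ) s = fixedPointsMap θ (fixedPointsMap η s) := by
  apply Subtype.ext
  change orbitMap s (η (θ ((1 : G) : G ⧸ H))) = orbitMap _ (θ ((1 : G) : G ⧸ H))
  induction θ ((1 : G) : G ⧸ H) using QuotientGroup.induction_on with
  | H x =>
    rw [orbitMap_mk]
    change _ = x • orbitMap s (η ((1 : G) : G ⧸ L))
    rw [← map_smul, ← map_smul, MulAction.Quotient.smul_coe]
    simp

/-- For a `G`-set `S`, the module `G/H ↦ ℤ[S^H]`. -/
def fixedPointsModule (S : Type u) [MulAction G S] : OrbitModule F where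
  obj H := ModuleCat.of ℤ (MulAction.fixedPoints H.unop.subgroup S →₀ ℤ)
  map θ := ModuleCat.ofHom (Finsupp.lmapDomain ℤ ℤ (fixedPointsMap θ.unop))
  map_id H := by
    ext : 1
    refine Finsupp.lhom_ext' fun s => LinearMap.ext_ring ?_
    change Finsupp.mapDomain _ (Finsupp.single s 1) = Finsupp.single s (1 : ℤ)
    rw [Finsupp.mapDomain_single]
    exact congrArg (Finsupp.single · 1) (fixedPointsMap_id s)
  map_comp θ η := by
    ext : 1
    refine Finsupp.lhom_ext' fun s => LinearMap.ext_ring ?_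
    change Finsupp.mapDomain _ (Finsupp.single s 1) =
      Finsupp.mapDomain _ (Finsupp.mapDomain _ (Finsupp.single s (1 : ℤ)))
    rw [Finsupp.mapDomain_single, Finsupp.mapDomain_single, Finsupp.mapDomain_single]
    exact congrArg (Finsupp.single · 1) (fixedPointsMap_comp η.unop θ.unop s)

/-- A `G`-map restricts to fixed-point sets. -/
def mapFixedPoints {S T : Type u} [MulAction G S] [MulAction G T] (f : S →[G] T) (H : Subgroup G)
    (s : MulAction.fixedPoints H S) : MulAction.fixedPoints H T :=
  ⟨f s, fun h => by
    change (h : G) • f s = f s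
    rw [← map_smul]
    exact congrArg f (s.2 h)⟩

lemma mapFixedPoints_fixedPointsMap {S T : Type u} [MulAction G S] [MulAction G T] (f : S →[G] T)
    {H P : Subgroup G} (θ : (G ⧸ H) →[G] (G ⧸ P)) (s : MulAction.fixedPoints P S) :
    mapFixedPoints f H (fixedPointsMap θ s) = fixedPointsMap θ (mapFixedPoints f P s) := by
  apply Subtype.ext
  change f (orbitMap s (θ ((1 : G) : G ⧸ H))) = orbitMap _ (θ ((1 : G) : G ⧸ H))
  induction θ ((1 : G) : G ⧸ H) using QuotientGroup.induction_on with
  | H x => exact map_smul f x (s : S)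

/-- The map of modules `ℤ[S^H] → ℤ[T^H]` induced by a `G`-map `S → T`. -/
def fixedPointsModuleMap {S T : Type u} [MulAction G S] [MulAction G T] (f : S →[G] T) :
    fixedPointsModule F S ⟶ fixedPointsModule F T where
  app H := ModuleCat.ofHom (Finsupp.lmapDomain ℤ ℤ (mapFixedPoints f H.unop.subgroup))
  naturality H P θ := by
    ext : 1
    refine Finsupp.lhom_ext' fun s => LinearMap.ext_ring ?_
    change Finsupp.mapDomain _ (Finsupp.mapDomain _ (Finsupp.single s 1)) =
      Finsupp.mapDomain _ (Finsupp.mapDomain _ (Finsupp.single s (1 : ℤ)))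
    simp only [Finsupp.mapDomain_single]
    exact congrArg (Finsupp.single · 1) (mapFixedPoints_fixedPointsMap f θ.unop s)

lemma fixedPointsModuleMap_comp {S T U : Type u} [MulAction G S] [MulAction G T] [MulAction G U]
    (f : S →[G] T) (g : T →[G] U) :
    fixedPointsModuleMap F f ≫ fixedPointsModuleMap F g = fixedPointsModuleMap F (g.comp f) := by
  ext H : 3
  refine Finsupp.lhom_ext' fun s => LinearMap.ext_ring ?_
  change Finsupp.mapDomain _ (Finsupp.mapDomain _ (Finsupp.single s (1 : ℤ))) =
    Finsupp.mapDomain _ (Finsupp.single s (1 : ℤ))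
  simp only [Finsupp.mapDomain_single]
  rfl

/-! ### The coefficient modules `B_S` -/

/-- `θ : G/L → G/S` belongs to `isom_G(G/L, G/S)`: it sends the coset `L` to `xS` for some `x` with
`x⁻¹ L x = S`. -/
def IsIsomMap {L S : Subgroup G} (θ : (G ⧸ L) →[G] (G ⧸ S)) : Prop :=
  ∃ x : G, θ ((1 : G) : G ⧸ L) = (x : G ⧸ S) ∧ conjSubgroup x⁻¹ L = S

/-- The set `isom_G(G/L, G/S)`. -/
abbrev IsomMaps (L S : Subgroup G) : Type u := {θ : (G ⧸ L) →[G] (G ⧸ S) // IsIsomMap θ}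

lemma mem_conjSubgroup_inv {x g : G} {L : Subgroup G} :
    g ∈ conjSubgroup x⁻¹ L ↔ x * g * x⁻¹ ∈ L := by
  simp only [conjSubgroup, Subgroup.mem_map]
  constructor
  · rintro ⟨y, hy, rfl⟩
    simpa [mul_assoc] using hy
  · intro h
    exact ⟨_, h, by simp [mul_assoc]⟩

/-- Any representative of the image coset may be used. -/
lemma conjSubgroup_eq_of_isIsomMap {L S : Subgroup G} {θ : (G ⧸ L) →[G] (G ⧸ S)}
    (h : IsIsomMap θ) {y : G} (hy : θ ((1 : G) : G ⧸ L) = (y : G ⧸ S)) :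
    conjSubgroup y⁻¹ L = S := by
  obtain ⟨x, hx, e⟩ := h
  have hs : x⁻¹ * y ∈ S := QuotientGroup.eq.mp (hx.symm.trans hy)
  ext g
  have := mem_conjSubgroup_inv (x := x) (g := x⁻¹ * y * g * (x⁻¹ * y)⁻¹) (L := L)
  rw [e] at this
  rw [mem_conjSubgroup_inv]
  have e2 : x * (x⁻¹ * y * g * (x⁻¹ * y)⁻¹) * x⁻¹ = y * g * y⁻¹ := by group
  rw [e2] at this
  rw [← this]
  constructor
  · intro h
    have := S.mul_mem (S.mul_mem (S.inv_mem hs) h) hs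
    have e3 : (x⁻¹ * y)⁻¹ * (x⁻¹ * y * g * (x⁻¹ * y)⁻¹) * (x⁻¹ * y) = g := by group
    rwa [e3] at this
  · intro h
    exact S.mul_mem (S.mul_mem hs h) (S.inv_mem hs)

lemma conjSubgroup_inv_le {H L : Subgroup G} (θ : (G ⧸ H) →[G] (G ⧸ L)) {y : G}
    (hy : θ ((1 : G) : G ⧸ H) = (y : G ⧸ L)) : conjSubgroup y⁻¹ H ≤ L := by
  intro g hg
  rw [mem_conjSubgroup_inv] at hg
  have e : (y * g * y⁻¹) • ((1 : G) : G ⧸ H) = ((1 : G) : G ⧸ H) := by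
    rw [MulAction.Quotient.smul_coe, QuotientGroup.eq]
    simpa [mul_assoc] using H.inv_mem hg
  have := congrArg θ e
  rw [map_smul, hy, MulAction.Quotient.smul_coe, eq_comm, QuotientGroup.eq] at this
  simpa [mul_assoc] using this

lemma conjSubgroup_mul (x y : G) (H : Subgroup G) :
    conjSubgroup (x * y) H = conjSubgroup x (conjSubgroup y H) := by
  ext g
  simp only [conjSubgroup, Subgroup.mem_map]
  constructor
  · rintro ⟨z, hz, rfl⟩
    exact ⟨_, ⟨z, hz, rfl⟩, by simp [mul_assoc]⟩
  · rintro ⟨_, ⟨z, hz, rfl⟩, rfl⟩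
    exact ⟨z, hz, by simp [mul_assoc]⟩

lemma conjSubgroup_mono (x : G) {H L : Subgroup G} (h : H ≤ L) :
    conjSubgroup x H ≤ conjSubgroup x L := Subgroup.map_mono h

lemma conjSubgroup_one (H : Subgroup G) : conjSubgroup 1 H = H := by
  ext g
  simp [conjSubgroup]

lemma isIsomMap_id (L : Subgroup G) : IsIsomMap (MulActionHom.id G : (G ⧸ L) →[G] (G ⧸ L)) :=
  ⟨1, rfl, by rw [inv_one, conjSubgroup_one]⟩

lemma comp_mk_one {H L S : Subgroup G} {θ : (G ⧸ H) →[G] (G ⧸ L)} {φ : (G ⧸ L) →[G] (G ⧸ S)}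
    {x y : G} (hy : θ ((1 : G) : G ⧸ H) = (y : G ⧸ L)) (hx : φ ((1 : G) : G ⧸ L) = (x : G ⧸ S)) :
    (φ.comp θ) ((1 : G) : G ⧸ H) = ((y * x : G) : G ⧸ S) := by
  change φ (θ _) = _
  have : ((y : G) : G ⧸ L) = y • ((1 : G) : G ⧸ L) := by
    rw [MulAction.Quotient.smul_coe]; simp
  rw [hy, this, map_smul, hx, MulAction.Quotient.smul_coe]
  rfl

lemma IsIsomMap.comp {H L S : Subgroup G} {θ : (G ⧸ H) →[G] (G ⧸ L)} {φ : (G ⧸ L) →[G] (G ⧸ S)}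
    (hφ : IsIsomMap φ) (hθ : IsIsomMap θ) : IsIsomMap (φ.comp θ) := by
  obtain ⟨x, hx, ex⟩ := hφ
  obtain ⟨y, hy, ey⟩ := hθ
  exact ⟨y * x, comp_mk_one hy hx, by rw [mul_inv_rev, conjSubgroup_mul, ey, ex]⟩

lemma IsIsomMap.of_comp {H L S : Subgroup G} {θ : (G ⧸ H) →[G] (G ⧸ L)}
    {φ : (G ⧸ L) →[G] (G ⧸ S)} (h : IsIsomMap (φ.comp θ)) : IsIsomMap φ := by
  obtain ⟨y, hy⟩ := QuotientGroup.mk_surjective (θ ((1 : G) : G ⧸ H))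
  obtain ⟨x, hx⟩ := QuotientGroup.mk_surjective (φ ((1 : G) : G ⧸ L))
  have e := conjSubgroup_eq_of_isIsomMap h (comp_mk_one hy.symm hx.symm)
  refine ⟨x, hx.symm, le_antisymm (conjSubgroup_inv_le φ hx.symm) ?_⟩
  rw [mul_inv_rev, conjSubgroup_mul] at e
  exact e.symm.le.trans (conjSubgroup_mono _ (conjSubgroup_inv_le θ hy.symm))

open Classical in
/-- The structure map of `B_S` along `θ : G/H → G/L`: a basis element `φ` goes to `φ ∘ θ` if
`y⁻¹ H y = L` (where `θ(H) = yL`), and to `0` otherwise. -/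
def isomModuleMap {H L : Subgroup G} (S : Subgroup G) (θ : (G ⧸ H) →[G] (G ⧸ L)) :
    (IsomMaps L S →₀ ℤ) →ₗ[ℤ] (IsomMaps H S →₀ ℤ) :=
  Finsupp.linearCombination ℤ fun φ : IsomMaps L S =>
    if h : IsIsomMap θ then Finsupp.single ⟨φ.1.comp θ, φ.2.comp h⟩ (1 : ℤ) else 0

lemma isomModuleMap_single_of {H L S : Subgroup G} {θ : (G ⧸ H) →[G] (G ⧸ L)} (h : IsIsomMap θ)
    (φ : IsomMaps L S) : isomModuleMap S θ (Finsupp.single φ 1) =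
      Finsupp.single ⟨φ.1.comp θ, φ.2.comp h⟩ 1 := by
  simp [isomModuleMap, h]

lemma isomModuleMap_single_of_not {H L S : Subgroup G} {θ : (G ⧸ H) →[G] (G ⧸ L)}
    (h : ¬ IsIsomMap θ) (φ : IsomMaps L S) : isomModuleMap S θ (Finsupp.single φ 1) = 0 := by
  simp [isomModuleMap, h]

lemma isomModuleMap_comp {H L K : Subgroup G} (S : Subgroup G) (η : (G ⧸ H) →[G] (G ⧸ L))
    (θ : (G ⧸ L) →[G] (G ⧸ K)) (φ : IsomMaps K S) :
    isomModuleMap S (θ.comp η) (Finsupp.single φ 1) =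
      isomModuleMap S η (isomModuleMap S θ (Finsupp.single φ 1)) := by
  by_cases h : IsIsomMap θ
  · rw [isomModuleMap_single_of h]
    by_cases h' : IsIsomMap η
    · rw [isomModuleMap_single_of h', isomModuleMap_single_of (h.comp h')]
      rfl
    · rw [isomModuleMap_single_of_not h', isomModuleMap_single_of_not]
      intro hc
      obtain ⟨y, hy⟩ := QuotientGroup.mk_surjective (η ((1 : G) : G ⧸ H))
      obtain ⟨x, hx⟩ := QuotientGroup.mk_surjective (θ ((1 : G) : G ⧸ L))
      have e := conjSubgroup_eq_of_isIsomMap hc (comp_mk_one hy.symm hx.symm)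
      have e' := conjSubgroup_eq_of_isIsomMap h hx.symm
      refine h' ⟨y, hy.symm, ?_⟩
      rw [mul_inv_rev, conjSubgroup_mul, ← e'] at e
      exact Subgroup.map_injective (MulAut.conj x⁻¹).injective e
  · rw [isomModuleMap_single_of_not h, map_zero, isomModuleMap_single_of_not]
    exact fun hc => h hc.of_comp

/-- The module `B_S`: `G/L ↦ ℤ[isom_G(G/L, G/S)]`, which is zero unless `L` and `S` are
conjugate. -/
def isomModule (S : Subgroup G) : OrbitModule F where
  obj L := ModuleCat.of ℤ (IsomMaps L.unop.subgroup S →₀ ℤ)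
  map θ := ModuleCat.ofHom (isomModuleMap S θ.unop)
  map_id L := by
    ext : 1
    refine Finsupp.lhom_ext' fun φ => LinearMap.ext_ring ?_
    exact isomModuleMap_single_of (isIsomMap_id _) φ
  map_comp θ η := by
    ext : 1
    refine Finsupp.lhom_ext' fun φ => LinearMap.ext_ring ?_
    exact isomModuleMap_comp S η.unop θ.unop φ

end OrbitCategory

/-! ## Simple complexes of groups -/

/-- A simple complex of groups over a poset `Q`. -/
structure SimpleComplexOfGroups (Q : Type u) [PartialOrder Q] where
  localGroup : Q → Type v
  [group : ∀ J, Group (localGroup J)]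
  map : ∀ {J T : Q}, J ≤ T → (localGroup J →* localGroup T)
  map_injective : ∀ {J T : Q} (h : J ≤ T), Function.Injective (map h)
  map_comp : ∀ {J T U : Q} (h : J ≤ T) (h' : T ≤ U), (map h').comp (map h) = map (h.trans h')

attribute [instance] SimpleComplexOfGroups.group

/-- A simple morphism from a simple complex of groups to a group. -/
structure SimpleMorphism {Q : Type u} [PartialOrder Q] (GQ : SimpleComplexOfGroups.{v, u} Q)
    (G : Type u) [Group G] where
  hom : ∀ J : Q, GQ.localGroup J →* G
  hom_comp_map : ∀ {J T : Q} (h : J ≤ T), (hom T).comp (GQ.map h) = hom J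

namespace SimpleComplexOfGroups

variable {Q : Type u} [PartialOrder Q] (GQ : SimpleComplexOfGroups.{v, u} Q)

/-- The equivalence relation generated by `J ∼ T` if `J ≤ T` and `P_J → P_T` is an isomorphism. -/
def blockSetoid : Setoid Q :=
  Relation.EqvGen.setoid fun J T => ∃ h : J ≤ T, Function.Bijective (GQ.map h)

/-- A block is an equivalence class of that relation. -/
def IsBlock (C : Set Q) : Prop := C ∈ GQ.blockSetoid.classes

end SimpleComplexOfGroups

/-! ## The standard panel complex `K = |Q|` and the Basic Construction -/

section StandardComplex

variable (Q : Type u) [PartialOrder Q]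

/-- The geometric realisation of the finite poset `Q`, in barycentric coordinates: a point is a
convex combination of the elements of a chain. -/
def StdComplex [Fintype Q] : Type u :=
  {x : Q → ℝ // x ∈ stdSimplex ℝ Q ∧ IsChain (· ≤ ·) (Function.support x)}

instance [Fintype Q] : TopologicalSpace (StdComplex Q) :=
  instTopologicalSpaceSubtype

/-- The `n`-simplices of `|Q|`: chains with `n + 1` elements, listed in increasing order. -/
abbrev PosetSimplex (n : ℕ) : Type u := Fin (n + 1) ↪o Q

variable {Q}

/-- The panel `K_J`: the realisation of the subposet of the elements `≥ J`. -/
def panel [Fintype Q] (J : Q) : Set (StdComplex Q) := {x | Function.support x.1 ⊆ Set.Ici J}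

/-- `J = J(x)`: the panel `K_J` is the intersection of all panels containing `x`. -/
def IsCarrier [Fintype Q] (x : StdComplex Q) (J : Q) : Prop :=
  panel J = ⋂ (T : Q) (_ : x ∈ panel T), panel T

/-- The vertex of `|Q|` at `J`. -/
def StdComplex.vertex [Fintype Q] (J : Q) : StdComplex Q := by
  classical
  exact ⟨Pi.single J 1, single_mem_stdSimplex ℝ J, by
    refine Set.Subsingleton.isChain ?_
    exact Set.subsingleton_singleton.anti (Pi.support_single_subset)⟩

lemma vertex_mem_panel [Fintype Q] {J T : Q} : StdComplex.vertex T ∈ panel J ↔ J ≤ T := by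
  classical
  have : Function.support (Pi.single T (1 : ℝ) : Q → ℝ) = {T} :=
    Pi.support_single_of_ne one_ne_zero
  change Function.support (Pi.single T (1 : ℝ) : Q → ℝ) ⊆ Set.Ici J ↔ _
  rw [this]
  simp

lemma exists_isLeast_support [Fintype Q] (x : StdComplex Q) :
    ∃ J, IsLeast (Function.support x.1) J := by
  have hne : (Function.support x.1).Nonempty := by
    rw [Function.support_nonempty_iff]
    intro h
    have := x.2.1.2
    simp [h] at this
  obtain ⟨J, hJ⟩ := (Set.toFinite (Function.support x.1)).exists_minimal hne
  refine ⟨J, hJ.prop, fun T hT => ?_⟩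
  rcases x.2.2.total hJ.prop hT with h | h
  · exact h
  · exact hJ.le_of_le hT h

/-- `J(x)` is the least vertex of the simplex that contains `x` in its interior. -/
lemma isCarrier_iff [Fintype Q] (x : StdComplex Q) (J : Q) :
    IsCarrier x J ↔ IsLeast (Function.support x.1) J := by
  have key : ∀ T, IsLeast (Function.support x.1) T → IsCarrier x T := by
    intro T hT
    have hx : x ∈ panel T := hT.2
    refine Set.Subset.antisymm ?_ ?_
    · intro y hy
      simp only [Set.mem_iInter]
      intro S hS q hq
      exact le_trans (hS hT.1) (hy hq)
    · intro y hy
      simp only [Set.mem_iInter] at hy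
      exact hy T hx
  refine ⟨fun h => ?_, key J⟩
  obtain ⟨T, hT⟩ := exists_isLeast_support x
  have e : panel J = panel T := Eq.trans h (key T hT).symm
  have h1 : J ≤ T := vertex_mem_panel.mp (e ▸ vertex_mem_panel.mpr le_rfl)
  have h2 : T ≤ J := vertex_mem_panel.mp (e.symm ▸ vertex_mem_panel.mpr le_rfl)
  rwa [le_antisymm h1 h2]

lemma IsCarrier.unique [Fintype Q] {x : StdComplex Q} {J T : Q} (h : IsCarrier x J)
    (h' : IsCarrier x T) : J = T :=
  ((isCarrier_iff x J).mp h).unique ((isCarrier_iff x T).mp h')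

lemma exists_isCarrier [Fintype Q] (x : StdComplex Q) : ∃ J, IsCarrier x J := by
  obtain ⟨J, hJ⟩ := exists_isLeast_support x
  exact ⟨J, (isCarrier_iff x J).mpr hJ⟩

end StandardComplex

namespace SimpleMorphism

variable {Q : Type u} [PartialOrder Q] {GQ : SimpleComplexOfGroups.{v, u} Q}
  {G : Type u} [Group G] (ψ : SimpleMorphism GQ G)

/-- The local group `P_J`, seen as a subgroup of `G`. -/
def localSubgroup (J : Q) : Subgroup G := (ψ.hom J).range

lemma localSubgroup_mono {J T : Q} (h : J ≤ T) : ψ.localSubgroup J ≤ ψ.localSubgroup T := by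
  rintro _ ⟨p, rfl⟩
  exact ⟨GQ.map h p, by rw [← ψ.hom_comp_map h]; rfl⟩

/-- The family of subgroups of `G` generated by the local groups. -/
def family : Set (Subgroup G) := familyGenerated (Set.range ψ.localSubgroup)

/-- The gluing relation on `G × K`: `(g₁, x₁) ∼ (g₂, x₂)` iff `x₁ = x₂` and
`g₁⁻¹ g₂ ∈ P_{J(x₁)}`. -/
def basicSetoid [Fintype Q] : Setoid (G × StdComplex Q) where
  r a b := a.2 = b.2 ∧ ∃ J, IsCarrier a.2 J ∧ a.1⁻¹ * b.1 ∈ ψ.localSubgroup J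
  iseqv :=
    { refl := fun a => by
        obtain ⟨J, hJ⟩ := exists_isCarrier a.2
        exact ⟨rfl, J, hJ, by simp [one_mem]⟩
      symm := by
        rintro a b ⟨e, J, hJ, h⟩
        refine ⟨e.symm, J, e ▸ hJ, ?_⟩
        simpa using inv_mem h
      trans := by
        rintro a b c ⟨e, J, hJ, h⟩ ⟨e', J', hJ', h'⟩
        have : J' = J := IsCarrier.unique (e ▸ hJ' : IsCarrier a.2 J') hJ
        subst this
        refine ⟨e.trans e', J', hJ, ?_⟩
        simpa [mul_assoc] using mul_mem h h' }

/-- The Basic Construction `D(K, G(Q), ψ) = G × K / ∼`. -/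
def BasicConstruction [Fintype Q] : Type u := Quotient ψ.basicSetoid

/-- The quotient topology, where `G` is discrete. -/
instance [Fintype Q] : TopologicalSpace ψ.BasicConstruction :=
  letI : TopologicalSpace G := ⊥
  inferInstanceAs (TopologicalSpace (Quotient ψ.basicSetoid))

/-- The action `g · [g', x] = [g g', x]`. -/
instance [Fintype Q] : MulAction G ψ.BasicConstruction where
  smul g := Quotient.map (fun a => (g * a.1, a.2)) (by
    rintro a b ⟨e, J, hJ, h⟩
    exact ⟨e, J, hJ, by simpa [mul_assoc] using h⟩)
  one_smul c := by
    induction c using Quotient.inductionOn with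
    | h a => exact congrArg (Quotient.mk _) (Prod.ext (one_mul _) rfl)
  mul_smul g g' c := by
    induction c using Quotient.inductionOn with
    | h a => exact congrArg (Quotient.mk _) (Prod.ext (mul_assoc _ _ _) rfl)

end SimpleMorphism

/-! ## Simplices, faces and alternating sums -/

section Simplices

/-- Alternating double sums over faces of faces cancel. -/
lemma alternating_sum_eq_zero {A : Type*} [AddCommGroup A] {n : ℕ} (a : Fin (n + 3) → Fin (n + 2) → A)
    (h : ∀ i j : Fin (n + 2), i ≤ j → a j.succ i = a i.castSucc j) :
    ∑ j : Fin (n + 3), ∑ i : Fin (n + 2), ((-1 : ℤ) ^ (j : ℕ) * (-1 : ℤ) ^ (i : ℕ)) • a j i = 0 := by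
  rw [← Finset.sum_product', Finset.univ_product_univ]
  let S : Finset (Fin (n + 3) × Fin (n + 2)) := {p | (p.1 : ℕ) ≤ (p.2 : ℕ)}
  rw [← Finset.sum_add_sum_compl S, ← eq_neg_iff_add_eq_zero, ← Finset.sum_neg_distrib]
  let φ : ∀ p : Fin (n + 3) × Fin (n + 2), p ∈ S → Fin (n + 3) × Fin (n + 2) := fun p hp =>
    (p.2.succ, Fin.castLT p.1 (lt_of_le_of_lt (Finset.mem_filter.mp hp).right (Fin.is_lt p.2)))
  apply Finset.sum_bij φ
  · intro p hp
    simp_rw [S, φ, Finset.compl_filter, Finset.mem_filter_univ, Fin.val_succ,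
      Fin.val_castLT] at hp ⊢
    omega
  · rintro ⟨j, i⟩ hp ⟨j', i'⟩ hp' e
    simp only [φ, Prod.mk.injEq, Fin.ext_iff, Fin.val_castLT, Fin.val_succ] at e
    ext
    · exact e.2
    · exact Nat.succ_injective e.1
  · rintro ⟨j', i'⟩ hp'
    simp_rw [S, Finset.compl_filter, Finset.mem_filter_univ, not_le] at hp'
    refine ⟨(Fin.castSucc i', j'.pred ?_), ?_, ?_⟩
    · rintro rfl
      simp only [Fin.val_zero, not_lt_zero] at hp'
    · simpa [S] using Nat.le_sub_one_of_lt hp'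
    · simp only [φ, Fin.castLT_castSucc, Fin.succ_pred]
  · rintro ⟨j, i⟩ hp
    have hp' : (j : ℕ) ≤ (i : ℕ) := (Finset.mem_filter.mp hp).right
    have e := h (Fin.castLT j (lt_of_le_of_lt hp' i.is_lt)) i hp'
    simp only [φ, Fin.val_succ, Fin.val_castLT, pow_succ, e, Fin.castSucc_castLT, ← neg_smul]
    congr 1
    ring

variable {Q : Type u} [PartialOrder Q]

/-- The `i`-th face of a simplex, obtained by omitting the vertex number `i`. -/
def PosetSimplex.face {n : ℕ} (i : Fin (n + 2)) (σ : PosetSimplex Q (n + 1)) : PosetSimplex Q n :=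
  (Fin.succAboveOrderEmb i).trans σ

lemma PosetSimplex.face_face {n : ℕ} {i j : Fin (n + 2)} (h : i ≤ j) (σ : PosetSimplex Q (n + 2)) :
    PosetSimplex.face i (PosetSimplex.face j.succ σ) =
      PosetSimplex.face j (PosetSimplex.face i.castSucc σ) := by
  ext k
  change σ (j.succ.succAbove (i.succAbove k)) = σ (i.castSucc.succAbove (j.succAbove k))
  congr 1
  have := congrArg (fun f => f.toOrderHom k) (SimplexCategory.δ_comp_δ (n := n) h)
  exact this

/-! ### Relative simplicial cohomology of order complexes -/

/-- The group of relative simplicial `n`-cochains of the pair of subcomplexes `(|A|, |B|)` of `|Q|`: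
integral functions on the `n`-simplices of `|A|` that vanish on the simplices of `|B|`. -/
def relCochains (A B : Set Q) (n : ℕ) :
    Submodule ℤ ({σ : PosetSimplex Q n // ∀ k, σ k ∈ A} → ℤ) where
  carrier := {f | ∀ σ, (∀ k, σ.1 k ∈ B) → f σ = 0}
  add_mem' hf hg σ h := by simp [hf σ h, hg σ h]
  zero_mem' σ h := rfl
  smul_mem' c f hf σ h := by simp [hf σ h]

/-- The simplicial coboundary `(δ f)(τ) = ∑ᵢ (-1)^i f(dᵢ τ)`. -/
def relCoboundary (A B : Set Q) (n : ℕ) : relCochains A B n →ₗ[ℤ] relCochains A B (n + 1) where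
  toFun f := ⟨fun τ => ∑ i : Fin (n + 2), (-1 : ℤ) ^ (i : ℕ) *
      f.1 ⟨PosetSimplex.face i τ.1, fun k => τ.2 (i.succAbove k)⟩, fun τ h =>
    Finset.sum_eq_zero fun i _ => by rw [f.2 _ fun k => h (i.succAbove k), mul_zero]⟩
  map_add' f g := by
    ext τ
    simp [mul_add, Finset.sum_add_distrib]
  map_smul' c f := by
    ext τ
    simp [Finset.mul_sum, mul_left_comm]

lemma relCoboundary_comp (A B : Set Q) (n : ℕ) :
    (relCoboundary A B (n + 1)).comp (relCoboundary A B n) = 0 := by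
  ext f τ
  change ∑ j : Fin (n + 3), (-1 : ℤ) ^ (j : ℕ) * ∑ i : Fin (n + 2), (-1 : ℤ) ^ (i : ℕ) *
      f.1 ⟨PosetSimplex.face i (PosetSimplex.face j τ.1), _⟩ = 0
  rw [← alternating_sum_eq_zero (fun (j : Fin (n + 3)) (i : Fin (n + 2)) =>
      f.1 ⟨PosetSimplex.face i (PosetSimplex.face j τ.1), fun k => τ.2 _⟩)]
  · simp only [Finset.mul_sum, smul_eq_mul, mul_assoc]
  · intro i j h
    exact congrArg f.1 (Subtype.ext (PosetSimplex.face_face h τ.1))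

/-- The relative simplicial cochain complex `C^*(|A|, |B|)` with integral coefficients. -/
def relCochainComplex (A B : Set Q) : CochainComplex (ModuleCat.{u} ℤ) ℕ :=
  CochainComplex.of (fun n => ModuleCat.of ℤ (relCochains A B n))
    (fun n => ModuleCat.ofHom (relCoboundary A B n))
    (fun n => by rw [← ModuleCat.ofHom_comp, relCoboundary_comp]; rfl)

/-- The relative integral cohomology `H^n(|A|, |B|)`. -/
def relCohomology (A B : Set Q) (n : ℕ) : ModuleCat.{u} ℤ := (relCochainComplex A B).homology n

end Simplices

/-! ## Bredon cohomology of the Basic Construction -/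

namespace SimpleMorphism

variable {Q : Type u} [PartialOrder Q] {GQ : SimpleComplexOfGroups.{v, u} Q}
  {G : Type u} [Group G] (ψ : SimpleMorphism GQ G)

/-- The `n`-simplices of `X = D(K, G(Q), ψ)`, as a `G`-set.  Points in the interior of a simplex `σ`
of `K` have `J(x) = σ 0`, so the translates `[g, σ]` and `[h, σ]` agree iff `g⁻¹ h ∈ P_{σ 0}`:
the simplices of `X` over `σ` are the cosets of `P_{σ 0}`. -/
abbrev Cell (n : ℕ) : Type u := Σ σ : PosetSimplex Q n, G ⧸ ψ.localSubgroup (σ 0)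

/-- The `i`-th face `[g, σ] ↦ [g, dᵢ σ]`, a `G`-map. -/
def cellFace {n : ℕ} (i : Fin (n + 2)) : ψ.Cell (n + 1) →[G] ψ.Cell n where
  toFun c := ⟨PosetSimplex.face i c.1, Subgroup.quotientMapOfLE
    (ψ.localSubgroup_mono (c.1.monotone (Fin.zero_le (i.succAbove 0)))) c.2⟩
  map_smul' g c := by
    obtain ⟨σ, c⟩ := c
    induction c using QuotientGroup.induction_on with
    | H x => rfl

lemma cell_mk_congr {n : ℕ} {σ τ : PosetSimplex Q n} (h : σ = τ) (g : G) :
    (⟨σ, (g : G ⧸ ψ.localSubgroup (σ 0))⟩ : ψ.Cell n) = ⟨τ, (g : G ⧸ ψ.localSubgroup (τ 0))⟩ := by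
  subst h
  rfl

lemma cellFace_comp {n : ℕ} {i j : Fin (n + 2)} (h : i ≤ j) :
    (ψ.cellFace i).comp (ψ.cellFace j.succ) = (ψ.cellFace j).comp (ψ.cellFace i.castSucc) := by
  ext1 c
  obtain ⟨σ, c⟩ := c
  induction c using QuotientGroup.induction_on with
  | H x => exact ψ.cell_mk_congr (PosetSimplex.face_face h σ) x

/-- The closed simplex of `X` underlying `[g, σ]`: the image of `{g} × |σ|`. -/
def closedCell [Fintype Q] {n : ℕ} (c : ψ.Cell n) : Set ψ.BasicConstruction :=
  {y | ∃ (g : G) (x : StdComplex Q), c.2 = (g : G ⧸ ψ.localSubgroup (c.1 0)) ∧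
    Function.support x.1 ⊆ Set.range c.1 ∧ y = Quotient.mk ψ.basicSetoid (g, x)}

/-- `H` fixes the simplex `c` as an element of the `G`-set of simplices iff it fixes the closed
simplex pointwise, that is, iff `c` is a simplex of `X^H`. -/
lemma mem_fixedPoints_cell_iff [Fintype Q] {n : ℕ} (c : ψ.Cell n) (H : Subgroup G) :
    c ∈ MulAction.fixedPoints H (ψ.Cell n) ↔
      ψ.closedCell c ⊆ MulAction.fixedPoints H ψ.BasicConstruction := by
  constructor
  · rintro hc y ⟨g, x, hg, hx, rfl⟩ h
    obtain ⟨J, hJ⟩ := exists_isCarrier x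
    refine Quotient.sound ⟨rfl, J, hJ, ?_⟩
    obtain ⟨k, hk⟩ := hx ((isCarrier_iff x J).mp hJ).1
    have hle : c.1 0 ≤ J := hk ▸ c.1.monotone (Fin.zero_le k)
    refine ψ.localSubgroup_mono hle ?_
    have h1 : (h : G) • c = c := hc h
    obtain ⟨σ, c⟩ := c
    have h2 : (h : G) • c = c := eq_of_heq (Sigma.mk.inj h1).2
    have hg' : c = (g : G ⧸ ψ.localSubgroup (σ 0)) := hg
    rw [hg', MulAction.Quotient.smul_coe, QuotientGroup.eq] at h2
    exact h2
  · intro hc h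
    obtain ⟨σ, c⟩ := c
    obtain ⟨g, rfl⟩ := QuotientGroup.mk_surjective c
    classical
    have hs : Function.support (StdComplex.vertex (σ 0)).1 = {σ 0} :=
      Pi.support_single_of_ne one_ne_zero
    have hm := hc ⟨g, StdComplex.vertex (σ 0), rfl, by
      rw [hs]; exact Set.singleton_subset_iff.mpr ⟨0, rfl⟩, rfl⟩ h
    obtain ⟨-, J, hJ, hp⟩ := Quotient.exact hm
    have hl := ((isCarrier_iff _ J).mp hJ).1
    have : J = σ 0 := by
      change J ∈ Function.support (StdComplex.vertex (σ 0)).1 at hl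
      rw [hs] at hl
      exact hl
    subst this
    refine congrArg (Sigma.mk σ) ?_
    exact QuotientGroup.eq.mpr hp

variable (F : Set (Subgroup G))

/-- The Bredon chain complex of `X`: `C_n(G/H) = C_n(X^H)` is the free abelian group on the
`n`-simplices of `X` fixed by `H`, with the simplicial boundary `∑ᵢ (-1)^i dᵢ`. -/
def bredonChainComplex : ChainComplex (OrbitModule F) ℕ :=
  ChainComplex.of (fun n => fixedPointsModule F (ψ.Cell n))
    (fun n => ∑ i : Fin (n + 2), (-1 : ℤ) ^ (i : ℕ) • fixedPointsModuleMap F (ψ.cellFace i))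
    (fun n => by
      rw [← alternating_sum_eq_zero (fun (j : Fin (n + 3)) (i : Fin (n + 2)) =>
        fixedPointsModuleMap F (ψ.cellFace j) ≫ fixedPointsModuleMap F (ψ.cellFace i))]
      · simp only [Preadditive.sum_comp, Preadditive.comp_sum, Preadditive.zsmul_comp,
          Preadditive.comp_zsmul, Finset.smul_sum, smul_smul]
        rw [Finset.sum_comm]
        simp only [mul_comm]
      · intro i j h
        rw [fixedPointsModuleMap_comp, fixedPointsModuleMap_comp, ψ.cellFace_comp h])

/-- Bredon cohomology `H^n_F(X; M)`: the cohomology of the cochain complex `Hom_F(C_*(X), M)`. -/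
def bredonCohomology (M : OrbitModule F) (n : ℕ) : ModuleCat.{u} ℤ :=
  ((ψ.bredonChainComplex F).linearYonedaObj ℤ M).homology n

/-! ### The subcomplexes `K_Ω`, `K_{>Ω}` and the index sets -/

/-- Vertices of `K_Ω`. -/
def upperSet (_ψ : SimpleMorphism GQ G) (Ω : Set Q) : Set Q := {V | ∃ U ∈ Ω, U ≤ V}

/-- Vertices of `K_{>Ω}`. -/
def strictUpperSet (Ω : Set Q) : Set Q :=
  {V | ∃ U ∈ Ω, U ≤ V ∧ ψ.localSubgroup U < ψ.localSubgroup V}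

/-- `H^n(K_Ω, K_{>Ω})`. -/
def panelCohomology (Ω : Set Q) (n : ℕ) : ModuleCat.{u} ℤ :=
  relCohomology (ψ.upperSet Ω) (ψ.strictUpperSet Ω) n

/-- `Ω^g_J`: the elements `U` with `P_U = g⁻¹ P_J g`. -/
def conjIndex (J : Q) (g : G) : Set Q :=
  {U | ψ.localSubgroup U = conjSubgroup g⁻¹ (ψ.localSubgroup J)}

/-- `I` is a complete set of representatives of `{g | g⁻¹ P_J g = P_U for some U} / P_J`, where
`P_J` acts by left multiplication. -/
structure IsRepresentatives (J : Q) (I : Set G) : Prop where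
  nonempty_conjIndex : ∀ g ∈ I, (ψ.conjIndex J g).Nonempty
  existsUnique : ∀ g : G, (ψ.conjIndex J g).Nonempty →
    ∃! r : G, r ∈ I ∧ ∃ p ∈ ψ.localSubgroup J, r = p * g

end SimpleMorphism

end

noncomputable section

/-! The simplices of `X` over a simplex `σ` of `K` form one orbit `G/P_{σ 0}`. By a Yoneda argument
an `n`-cochain with values in `M` is therefore a choice of an element of `M(G/P_{σ 0})` for every
`n`-simplex `σ` (`cochainEval`). The coboundary restricts the values on the faces to the group of
the first vertex, and only omitting the first vertex can change that group.

For `M = B_{P_J}`, restriction along a proper inclusion `P_U < P_T` is zero and restriction along an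
equality identifies bases. So cochains split according to the block of the first vertex and the
class in `P_J \ G` named by the basis element. The piece of a block `C ⊆ Ω_J^g` consists of integral
functions on the simplices starting in `C`. Since a simplex of `K_C` lies in `K_{>C}` exactly when
it does not start in `C`, this piece is the relative cochain complex of `(K_C, K_{>C})`. As `Q` is
finite, each cochain has finitely many nonzero components, and the splitting gives a direct sum in
cohomology (`bredonCohomology_isomModule_equiv`).

For the dimension, contractibility of the `X^H` makes the cellular chains a projective resolution of
the constant module (`quasiIso_resolutionMap`), so that Ext is the cohomology of Bredon cochains.
Acyclicity is proved by simplicial approximation (`exists_bdry_eq`): a cycle is finely subdivided,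
moved along a contraction in small time steps, and rounded to nearest vertices. Signed sorting then
turns lists with arbitrary order and repetitions into honest simplices (`exists_toListChain_eq`).

The lower bound comes from the coefficients `B_{P_J}` with `J ∈ C`, whose cohomology has `H^n(K_C,
K_{>C})` as a summand. For the upper bound, the integral cochains of a block are free of finite
rank, so vanishing in two consecutive degrees gives a contraction that survives any change of
coefficients (`exists_blockCoboundary_eq`). An arbitrary cocycle is then killed block by block,
maximal local groups first (`exists_evalCoboundary_eq`). The maximum exists because a block with
maximal local group has nonzero `H^0` and there are no simplices of dimension `|Q|` or more. -/

/-! ## Ordered chains on a set of vertices -/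

/-- The augmented complex of all ordered chains on a vertex set: the free abelian group on lists of
vertices, a list of length `n + 1` being an ordered `n`-simplex. -/
abbrev ListChain (V : Type*) := List V →₀ ℤ

namespace ListChain

variable {V W : Type*}

/-- The basis element of a list. -/
def of (l : List V) : ListChain V := Finsupp.single l 1

/-- The linear map with prescribed values on lists. -/
def lift {M : Type*} [AddCommGroup M] (f : List V → M) : ListChain V →ₗ[ℤ] M :=
  Finsupp.linearCombination ℤ f

@[simp] lemma lift_of {M : Type*} [AddCommGroup M] (f : List V → M) (l : List V) :
    lift f (of l) = f l := by simp [lift, of]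

lemma hom_ext {M : Type*} [AddCommGroup M] {f g : ListChain V →ₗ[ℤ] M}
    (h : ∀ l, f (of l) = g (of l)) : f = g :=
  Finsupp.lhom_ext' fun l => LinearMap.ext_ring (h l)

/-- Chains that involve only lists with a given property. -/
abbrev supp (p : List V → Prop) : Submodule ℤ (ListChain V) := Finsupp.supported ℤ ℤ {l | p l}

lemma of_mem {p : List V → Prop} {l : List V} (h : p l) : of l ∈ supp p :=
  Finsupp.single_mem_supported ℤ _ h

lemma supp_mono {p q : List V → Prop} (h : ∀ l, p l → q l) : supp p ≤ supp q :=
  Finsupp.supported_mono h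

lemma map_mem {M : Type*} [AddCommGroup M] {p : List V → Prop} {f : ListChain V →ₗ[ℤ] M}
    {N : Submodule ℤ M} (h : ∀ l, p l → f (of l) ∈ N) {x : ListChain V} (hx : x ∈ supp p) :
    f x ∈ N := by
  have : supp p ≤ N.comap f := by
    rw [supp, Finsupp.supported_eq_span_single, Submodule.span_le]
    rintro _ ⟨l, hl, rfl⟩
    exact h l hl
  exact this hx

lemma map_congr_of_mem {M : Type*} [AddCommGroup M] {p : List V → Prop}
    {f g : ListChain V →ₗ[ℤ] M} (h : ∀ l, p l → f (of l) = g (of l)) {x : ListChain V}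
    (hx : x ∈ supp p) : f x = g x := by
  have := map_mem (f := f - g) (N := ⊥) (fun l hl => by simp [h l hl]) hx
  simpa [sub_eq_zero] using this

/-- The cone with apex `v`. -/
def cone (v : V) : ListChain V →ₗ[ℤ] ListChain V := lift fun l => of (v :: l)

@[simp] lemma cone_of (v : V) (l : List V) : cone v (of l) = of (v :: l) := lift_of _ _

lemma cone_mem {p q : List V → Prop} {v : V} (h : ∀ l, p l → q (v :: l)) {x : ListChain V}
    (hx : x ∈ supp p) : cone v x ∈ supp q :=
  map_mem (fun l hl => by rw [cone_of]; exact of_mem (h l hl)) hx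

/-- The boundary of a list. -/
def bdryList : List V → ListChain V
  | [] => 0
  | v :: l => of l - cone v (bdryList l)

/-- The boundary operator. -/
def bdry : ListChain V →ₗ[ℤ] ListChain V := lift bdryList

@[simp] lemma bdry_nil : bdry (of ([] : List V)) = 0 := by simp [bdry, bdryList]

@[simp] lemma bdry_cons (v : V) (l : List V) :
    bdry (of (v :: l)) = of l - cone v (bdry (of l)) := by simp [bdry, bdryList]

lemma bdry_cone (v : V) (x : ListChain V) : bdry (cone v x) = x - cone v (bdry x) := by
  have : bdry ∘ₗ cone v = LinearMap.id - cone v ∘ₗ bdry := hom_ext fun l => by simp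
  exact LinearMap.congr_fun this x

lemma bdry_of_mem (l : List V) :
    bdry (of l) ∈ supp fun l' => l'.Sublist l ∧ l'.length + 1 = l.length := by
  induction l with
  | nil => simp
  | cons v l ih =>
    rw [bdry_cons]
    exact sub_mem (of_mem ⟨List.sublist_cons_self v l, rfl⟩)
      (cone_mem (fun l' h => ⟨h.1.cons_cons v, by simp [h.2]⟩) ih)

/-- The chain map induced by a map of vertices. -/
def map (f : V → W) : ListChain V →ₗ[ℤ] ListChain W := lift fun l => of (l.map f)

@[simp] lemma map_of (f : V → W) (l : List V) : map f (of l) = of (l.map f) := lift_of _ _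

lemma map_cone (f : V → W) (v : V) (x : ListChain V) : map f (cone v x) = cone (f v) (map f x) := by
  have : map f ∘ₗ cone v = cone (f v) ∘ₗ map f := hom_ext fun l => by simp
  exact LinearMap.congr_fun this x

lemma bdry_map (f : V → W) (x : ListChain V) : bdry (map f x) = map f (bdry x) := by
  have : bdry ∘ₗ map f = map f ∘ₗ bdry := hom_ext fun l => by
    induction l with
    | nil => simp
    | cons v l ih =>
      simp only [LinearMap.comp_apply, map_of] at ih
      simp [map_cone, ih]
  exact LinearMap.congr_fun this x

lemma map_map {U : Type*} (f : V → W) (g : W → U) (x : ListChain V) :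
    map g (map f x) = map (g ∘ f) x := by
  have : map g ∘ₗ map f = map (g ∘ f) := hom_ext fun l => by simp
  exact LinearMap.congr_fun this x

lemma map_id' {f : V → V} (hf : ∀ v, f v = v) (x : ListChain V) : map f x = x := by
  obtain rfl : f = id := funext hf
  have : map (id : V → V) = LinearMap.id := hom_ext fun l => by simp
  exact LinearMap.congr_fun this x

/-- The prism on a list, between its images under two maps of vertices. -/
def prismList (f g : V → W) : List V → ListChain W
  | [] => 0
  | v :: l => cone (f v) (of (g v :: l.map g) - prismList f g l)

/-- The prism operator, a chain homotopy between the chain maps induced by two maps of vertices. -/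
def prism (f g : V → W) : ListChain V →ₗ[ℤ] ListChain W := lift (prismList f g)

@[simp] lemma prism_nil (f g : V → W) : prism f g (of []) = 0 := by simp [prism, prismList]

@[simp] lemma prism_cons (f g : V → W) (v : V) (l : List V) :
    prism f g (of (v :: l)) = cone (f v) (of (g v :: l.map g) - prism f g (of l)) := by
  simp [prism, prismList]

lemma prism_cone (f g : V → W) (v : V) (x : ListChain V) :
    prism f g (cone v x) = cone (f v) (cone (g v) (map g x) - prism f g x) := by
  have : prism f g ∘ₗ cone v = cone (f v) ∘ₗ (cone (g v) ∘ₗ map g - prism f g) :=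
    hom_ext fun l => by simp
  exact LinearMap.congr_fun this x

/-- Expanding the recursion with `bdry_cone` leaves the homotopy formula for the tail. No
compatibility of `f` and `g` is needed, since every list counts as a simplex here; supports are
controlled separately by `prism_of_mem`. -/
lemma bdry_prism (f g : V → W) (x : ListChain V) :
    bdry (prism f g x) = map g x - map f x - prism f g (bdry x) := by
  have : bdry ∘ₗ prism f g = map g - map f - prism f g ∘ₗ bdry := hom_ext fun l => by
    induction l with
    | nil => simp
    | cons v l ih =>
      simp only [LinearMap.comp_apply, LinearMap.sub_apply, map_of] at ih ⊢
      rw [prism_cons, bdry_cone, map_sub, bdry_cons, ih, bdry_cons v l, map_sub (prism f g),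
        prism_cone, ← bdry_map, map_of]
      simp only [map_sub, cone_of, List.map_cons]
      abel
  exact LinearMap.congr_fun this x

lemma prism_of_mem (f g : V → W) (l : List V) :
    prism f g (of l) ∈ supp fun l' => ∀ w ∈ l', ∃ v ∈ l, w = f v ∨ w = g v := by
  induction l with
  | nil => simp
  | cons v l ih =>
    rw [prism_cons]
    refine cone_mem (p := fun l' => ∀ w ∈ l', ∃ u ∈ v :: l, w = f u ∨ w = g u) ?_
      (sub_mem (of_mem ?_) (supp_mono ?_ ih))
    · intro l' h w hw
      rcases List.mem_cons.mp hw with rfl | hw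
      · exact ⟨v, by simp, Or.inl rfl⟩
      · exact h w hw
    · intro w hw
      rw [← List.map_cons] at hw
      obtain ⟨u, hu, rfl⟩ := List.mem_map.mp hw
      exact ⟨u, hu, Or.inr rfl⟩
    · intro l' h w hw
      obtain ⟨u, hu, e⟩ := h w hw
      exact ⟨u, List.mem_cons_of_mem v hu, e⟩

/-- The component of chains of lists of length `n`. -/
def lengthPart (n : ℕ) : ListChain V →ₗ[ℤ] ListChain V :=
  lift fun l => if l.length = n then of l else 0

lemma lengthPart_mem {p : List V → Prop} {n : ℕ} {x : ListChain V} (hx : x ∈ supp p) :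
    lengthPart n x ∈ supp fun l => p l ∧ l.length = n :=
  map_mem (fun l hl => by
    rw [lengthPart, lift_of]
    split_ifs with h
    · exact of_mem ⟨hl, h⟩
    · exact zero_mem _) hx

lemma lengthPart_of_mem {n : ℕ} {x : ListChain V} (hx : x ∈ supp fun l => l.length = n) :
    lengthPart n x = x :=
  map_congr_of_mem (g := LinearMap.id) (fun l hl => by simp [lengthPart, hl]) hx

lemma bdry_lengthPart (n : ℕ) (x : ListChain V) :
    bdry (lengthPart (n + 1) x) = lengthPart n (bdry x) := by
  have : bdry ∘ₗ lengthPart (n + 1) = lengthPart n ∘ₗ (bdry : ListChain V →ₗ[ℤ] _) :=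
    hom_ext fun l => by
      simp only [LinearMap.comp_apply]
      by_cases h : l.length = n + 1
      · rw [lengthPart_of_mem (of_mem h), lengthPart_of_mem]
        exact supp_mono (fun l' h' => by have := h'.2; omega) (bdry_of_mem l)
      · rw [lengthPart, lift_of, if_neg h, map_zero]
        exact (map_congr_of_mem (g := 0) (fun l' h' => by
          rw [lengthPart, lift_of, if_neg (by have := h'.2; omega), LinearMap.zero_apply])
          (bdry_of_mem l)).symm
  exact LinearMap.congr_fun this x

/-! ### Signed insertion sort -/

section SignedSort

variable [LinearOrder V]

/-- Signed insertion of a vertex into a list. -/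
def insList (v : V) : List V → ListChain V
  | [] => of [v]
  | a :: l => if v < a then of (v :: a :: l) else if v = a then 0 else -cone a (insList v l)

/-- Signed insertion of a vertex. -/
def ins (v : V) : ListChain V →ₗ[ℤ] ListChain V := lift (insList v)

lemma ins_of_lt {v : V} {l : List V} (h : ∀ a ∈ l, v < a) : ins v (of l) = of (v :: l) := by
  cases l with
  | nil => simp [ins, insList]
  | cons a l => simp [ins, insList, h a (by simp)]

lemma ins_cone_self (v : V) (x : ListChain V) : ins v (cone v x) = 0 := by
  have : ins v ∘ₗ cone v = 0 := hom_ext fun l => by simp [ins, insList]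
  exact LinearMap.congr_fun this x

lemma ins_cone_of_lt {v a : V} (h : a < v) (x : ListChain V) :
    ins v (cone a x) = -cone a (ins v x) := by
  have : ins v ∘ₗ cone a = -(cone a ∘ₗ ins v) := hom_ext fun l => by
    simp [ins, insList, h.le.not_gt, h.ne']
  exact LinearMap.congr_fun this x

lemma ins_of_mem (v : V) {l : List V} (hl : l.Pairwise (· < ·)) :
    ins v (of l) ∈ supp fun l' => l'.Pairwise (· < ·) ∧ ∀ w ∈ l', w = v ∨ w ∈ l := by
  induction l with
  | nil => rw [ins_of_lt (by simp)]; exact of_mem (by simp)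
  | cons a l ih =>
    rw [List.pairwise_cons] at hl
    rcases lt_trichotomy v a with h | rfl | h
    · have hv : ∀ b ∈ a :: l, v < b := by
        intro b hb
        rcases List.mem_cons.mp hb with rfl | hb
        · exact h
        · exact h.trans (hl.1 b hb)
      rw [ins_of_lt hv]
      exact of_mem ⟨List.pairwise_cons.mpr ⟨hv, List.pairwise_cons.mpr hl⟩, by simp⟩
    · rw [← cone_of, ins_cone_self]
      exact zero_mem _
    · rw [← cone_of, ins_cone_of_lt h]
      refine neg_mem (cone_mem (fun l' hl' => ⟨List.pairwise_cons.mpr ⟨?_, hl'.1⟩, ?_⟩) (ih hl.2))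
      · intro b hb
        rcases hl'.2 b hb with rfl | hb
        · exact h
        · exact hl.1 b hb
      · intro w hw
        rcases List.mem_cons.mp hw with rfl | hw
        · exact Or.inr (by simp)
        · exact (hl'.2 w hw).imp id (List.mem_cons_of_mem a)

/-- On increasing lists, insertion obeys the boundary formula of the cone with apex `v`: each entry
passed costs a sign, and a repeated entry gives zero on both sides. -/
lemma bdry_ins_of (v : V) {l : List V} (hl : l.Pairwise (· < ·)) :
    bdry (ins v (of l)) = of l - ins v (bdry (of l)) := by
  induction l with
  | nil => rw [ins_of_lt (by simp)]; simp
  | cons a l ih =>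
    have hl' := List.pairwise_cons.mp hl
    rcases lt_trichotomy v a with h | rfl | h
    · have hv : ∀ b ∈ a :: l, v < b := by
        intro b hb
        rcases List.mem_cons.mp hb with rfl | hb
        · exact h
        · exact h.trans (hl'.1 b hb)
      rw [ins_of_lt hv, bdry_cons v]
      congr 1
      refine map_congr_of_mem (fun l' h' => ?_) (bdry_of_mem (a :: l))
      rw [cone_of, ins_of_lt fun b hb => hv b (h'.1.subset hb)]
    · rw [← cone_of, ins_cone_self, bdry_cone, map_sub, ins_cone_self, ins_of_lt hl'.1, cone_of]
      simp
    · rw [← cone_of, ins_cone_of_lt h, map_neg, bdry_cone, bdry_cone, map_sub, ins_cone_of_lt h,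
        ih hl'.2, map_sub]
      abel

/-- Signed insertion sort of a list. -/
def sortList : List V → ListChain V
  | [] => of []
  | v :: l => ins v (sortList l)

/-- Signed insertion sort, a retraction onto the chains of strictly increasing lists. -/
def sort : ListChain V →ₗ[ℤ] ListChain V := lift sortList

lemma sort_nil : sort (of ([] : List V)) = of [] := by simp [sort, sortList]

lemma sort_cons (v : V) (l : List V) : sort (of (v :: l)) = ins v (sort (of l)) := by
  simp [sort, sortList]

lemma sort_cone (v : V) (x : ListChain V) : sort (cone v x) = ins v (sort x) := by
  have : sort ∘ₗ cone v = ins v ∘ₗ sort := hom_ext fun l => by simp [sort_cons]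
  exact LinearMap.congr_fun this x

lemma sort_of_mem (l : List V) :
    sort (of l) ∈ supp fun l' => l'.Pairwise (· < ·) ∧ ∀ w ∈ l', w ∈ l := by
  induction l with
  | nil => rw [sort_nil]; exact of_mem (by simp)
  | cons v l ih =>
    rw [sort_cons]
    refine map_mem (fun l' h' => supp_mono (fun l'' h'' => ⟨h''.1, ?_⟩) (ins_of_mem v h'.1)) ih
    intro w hw
    rcases h''.2 w hw with rfl | hw
    · simp
    · exact List.mem_cons_of_mem v (h'.2 w hw)

/-- Lists are iterated cones, and sorting replaces each cone by an insertion. Both have the same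
boundary formula on increasing chains, hence a chain map. -/
lemma bdry_sort (x : ListChain V) : bdry (sort x) = sort (bdry x) := by
  have : bdry ∘ₗ sort = sort ∘ₗ (bdry : ListChain V →ₗ[ℤ] _) := hom_ext fun l => by
    induction l with
    | nil => simp [sort_nil]
    | cons v l ih =>
      simp only [LinearMap.comp_apply] at ih ⊢
      rw [sort_cons, bdry_cons, map_sub, sort_cone, ← ih]
      exact map_congr_of_mem (f := bdry ∘ₗ ins v) (g := LinearMap.id - ins v ∘ₗ bdry)
        (fun l' h' => bdry_ins_of v h'.1) (sort_of_mem l)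
  exact LinearMap.congr_fun this x

lemma sort_of_pairwise {l : List V} (hl : l.Pairwise (· < ·)) : sort (of l) = of l := by
  induction l with
  | nil => exact sort_nil
  | cons v l ih =>
    rw [List.pairwise_cons] at hl
    rw [sort_cons, ih hl.2, ins_of_lt hl.1]

end SignedSort

/-! ### Fine subdivisions -/

section Subdivision

variable {E : Type*} [AddCommGroup E] [Module ℝ E] (M : ℕ)

/-- The point at time `t` of the straight path from `y` to `v`. -/
def slide (v : E) (t : ℝ) (y : E) : E := (1 - t) • y + t • v

/-- A cone with apex `v` that is filled by short simplices, by sliding the base towards the apex in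
`M` steps. -/
def fineCone (v : E) : ListChain E →ₗ[ℤ] ListChain E :=
  cone v ∘ₗ map (fun _ => v) -
    ∑ j ∈ Finset.range M, prism (slide v ((j : ℝ) / M)) (slide v (((j + 1 : ℕ) : ℝ) / M))

lemma fineCone_apply (v : E) (x : ListChain E) : fineCone M v x = cone v (map (fun _ => v) x) -
    ∑ j ∈ Finset.range M,
      prism (slide v ((j : ℝ) / M)) (slide v (((j + 1 : ℕ) : ℝ) / M)) x := by
  simp [fineCone]

/-- The prisms between consecutive times telescope from `x` to the constant chain at `v`, which the
ordinary cone fills. The hypothesis `M ≠ 0` makes the last time equal to `1`. -/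
lemma bdry_fineCone (hM : M ≠ 0) (v : E) (x : ListChain E) :
    bdry (fineCone M v x) = x - fineCone M v (bdry x) := by
  have h0 : map (slide v (((0 : ℕ) : ℝ) / M)) x = x := map_id' (by simp [slide]) x
  have h1 : map (slide v ((M : ℝ) / M)) x = map (fun _ => v) x := by
    have : (M : ℝ) ≠ 0 := Nat.cast_ne_zero.mpr hM
    congr 2
    funext y
    simp [slide, this]
  rw [fineCone_apply, fineCone_apply, map_sub, bdry_cone, bdry_map, map_sum]
  simp only [bdry_prism, Finset.sum_sub_distrib _ (fun j => prism _ _ (bdry x))]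
  rw [Finset.sum_range_sub (fun j => map (slide v ((j : ℝ) / M)) x), h0, h1]
  abel

/-- The subdivision of a list. -/
def sdList : List E → ListChain E
  | [] => of []
  | v :: l => fineCone M v (sdList l)

/-- The subdivision operator built from `fineCone`. -/
def sd : ListChain E →ₗ[ℤ] ListChain E := lift (sdList M)

lemma sd_nil : sd M (of ([] : List E)) = of [] := by simp [sd, sdList]

lemma sd_cone (v : E) (x : ListChain E) : sd M (cone v x) = fineCone M v (sd M x) := by
  have : sd M ∘ₗ cone v = fineCone M v ∘ₗ sd M := hom_ext fun l => by simp [sd, sdList]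
  exact LinearMap.congr_fun this x

lemma sd_cons (v : E) (l : List E) : sd M (of (v :: l)) = fineCone M v (sd M (of l)) := by
  rw [← cone_of, sd_cone]

lemma bdry_sd (hM : M ≠ 0) (x : ListChain E) : bdry (sd M x) = sd M (bdry x) := by
  have : bdry ∘ₗ sd M = sd M ∘ₗ (bdry : ListChain E →ₗ[ℤ] _) := hom_ext fun l => by
    induction l with
    | nil => simp [sd_nil]
    | cons v l ih =>
      simp only [LinearMap.comp_apply] at ih ⊢
      rw [sd_cons, bdry_fineCone M hM, bdry_cons, map_sub, sd_cone, ih]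
  exact LinearMap.congr_fun this x

/-- The homotopy between a list and its subdivision. -/
def sdHomotopyList : List E → ListChain E
  | [] => 0
  | v :: l => cone v (fineCone M v (sd M (of l)) - cone v (sd M (of l)) - sdHomotopyList l)

/-- The chain homotopy between the subdivision operator and the identity. -/
def sdHomotopy : ListChain E →ₗ[ℤ] ListChain E := lift (sdHomotopyList M)

lemma sdHomotopy_cone (v : E) (x : ListChain E) : sdHomotopy M (cone v x) =
    cone v (fineCone M v (sd M x) - cone v (sd M x) - sdHomotopy M x) := by
  have : sdHomotopy M ∘ₗ cone v =
      cone v ∘ₗ (fineCone M v ∘ₗ sd M - cone v ∘ₗ sd M - sdHomotopy M) :=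
    hom_ext fun l => by simp [sdHomotopy, sdHomotopyList]
  exact LinearMap.congr_fun this x

/-- Two homotopies are composed on a list with head `v`: minus the cone on the homotopy of the tail
replaces the tail by its subdivision, and coning the difference of the fine and the ordinary cone
then replaces one by the other. -/
lemma bdry_sdHomotopy (hM : M ≠ 0) (x : ListChain E) :
    bdry (sdHomotopy M x) = sd M x - x - sdHomotopy M (bdry x) := by
  have : bdry ∘ₗ sdHomotopy M = sd M - LinearMap.id - sdHomotopy M ∘ₗ (bdry : ListChain E →ₗ[ℤ] _) := by
    refine hom_ext fun l => ?_
    · induction l with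
      | nil =>
        have : sdHomotopy M (of ([] : List E)) = 0 := by simp [sdHomotopy, sdHomotopyList]
        simp only [LinearMap.comp_apply, LinearMap.sub_apply, LinearMap.id_apply]
        rw [this, bdry_nil, sd_nil, map_zero, map_zero]
        simp
      | cons v l ih =>
        simp only [LinearMap.comp_apply, LinearMap.sub_apply, LinearMap.id_apply] at ih ⊢
        rw [bdry_cons, map_sub (sdHomotopy M), sdHomotopy_cone, ← cone_of, sdHomotopy_cone, bdry_cone, sd_cone]
        simp only [map_sub, bdry_cone, bdry_fineCone M hM, bdry_sd M hM, ih]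
        abel
  exact LinearMap.congr_fun this x

lemma slide_mem {S : Set E} (hS : Convex ℝ S) {v y : E} (hv : v ∈ S) (hy : y ∈ S) {t : ℝ}
    (h0 : 0 ≤ t) (h1 : t ≤ 1) : slide v t y ∈ S :=
  hS hy hv (sub_nonneg.mpr h1) h0 (by ring)

/-- Lists of points of `S` whose images under `φ` are `ε`-close to each other, for all `φ` in a given
collection of linear functionals. -/
def IsFine (Λ : Set (E →ₗ[ℝ] ℝ)) (S : Set E) (ε : ℝ) (l : List E) : Prop :=
  (∀ y ∈ l, y ∈ S) ∧ ∀ φ ∈ Λ, ∀ y ∈ l, ∀ z ∈ l, |φ y - φ z| ≤ ε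

/-- Sliding both points for time `s` scales their distance by `1 - s`; changing the time from `s` to
`t` at the fixed point `z` costs `|s - t|` times the distance of `z` from the apex. -/
lemma abs_slide_sub_slide_le {φ : E →ₗ[ℝ] ℝ} {v y z : E} {ε C s t : ℝ} (hyz : |φ y - φ z| ≤ ε)
    (hvz : |φ v - φ z| ≤ C) (h0 : 0 ≤ s) (h1 : s ≤ 1) :
    |φ (slide v s y) - φ (slide v t z)| ≤ ε + |s - t| * C := by
  have e : φ (slide v s y) - φ (slide v t z) = (1 - s) * (φ y - φ z) + (s - t) * (φ v - φ z) := by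
    simp only [slide, map_add, map_smul, smul_eq_mul]
    ring
  rw [e]
  refine (abs_add_le _ _).trans (add_le_add ?_ ?_)
  · rw [abs_mul, abs_of_nonneg (sub_nonneg.mpr h1)]
    have := abs_nonneg (φ y - φ z)
    nlinarith
  · rw [abs_mul]
    exact mul_le_mul_of_nonneg_left hvz (abs_nonneg _)

variable {M}

/-- Sliding towards `v` does not increase the mesh, so a prism over one time step adds only `C / M`.
The final cone is harmless: all entries of its lists equal `v`. -/
lemma fineCone_mem {Λ : Set (E →ₗ[ℝ] ℝ)} {S : Set E} (hS : Convex ℝ S) {C : ℝ} (hC0 : 0 ≤ C)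
    (hC : ∀ φ ∈ Λ, ∀ y ∈ S, ∀ z ∈ S, |φ y - φ z| ≤ C) (hM : M ≠ 0) {v : E} (hv : v ∈ S) {ε : ℝ}
    (hε : 0 ≤ ε) {x : ListChain E} (hx : x ∈ supp (IsFine Λ S ε)) :
    fineCone M v x ∈ supp (IsFine Λ S (ε + C / M)) := by
  have hM' : (0 : ℝ) < M := Nat.cast_pos.mpr (Nat.pos_of_ne_zero hM)
  have hδ : 0 ≤ ε + C / M := by positivity
  refine map_mem (fun l hl => ?_) hx
  rw [fineCone_apply]
  refine sub_mem ?_ (Submodule.sum_mem _ fun j hj => ?_)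
  · rw [map_of, cone_of]
    have hl' : ∀ y ∈ v :: l.map (fun _ => v), y = v := by simp
    refine of_mem ⟨fun y hy => hl' y hy ▸ hv, fun φ hφ y hy z hz => ?_⟩
    rw [hl' y hy, hl' z hz, sub_self, abs_zero]
    exact hδ
  · have hj' : ((j + 1 : ℕ) : ℝ) ≤ M := Nat.cast_le.mpr (Finset.mem_range.mp hj)
    have hj2 : ((j : ℕ) : ℝ) ≤ M := Nat.cast_le.mpr (Finset.mem_range.mp hj).le
    have a0 : 0 ≤ (j : ℝ) / M := by positivity
    have a1 : (j : ℝ) / M ≤ 1 := (div_le_one hM').mpr hj2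
    have b0 : 0 ≤ ((j + 1 : ℕ) : ℝ) / M := by positivity
    have b1 : ((j + 1 : ℕ) : ℝ) / M ≤ 1 := (div_le_one hM').mpr hj'
    have hd : |(j : ℝ) / M - ((j + 1 : ℕ) : ℝ) / M| = 1 / M := by
      rw [← sub_div, abs_div, abs_of_pos hM']
      simp
    have key : ∀ t ∈ ({(j : ℝ) / M, ((j + 1 : ℕ) : ℝ) / M} : Set ℝ), 0 ≤ t ∧ t ≤ 1 := by
      rintro t (rfl | rfl)
      exacts [⟨a0, a1⟩, ⟨b0, b1⟩]
    have key2 : ∀ s ∈ ({(j : ℝ) / M, ((j + 1 : ℕ) : ℝ) / M} : Set ℝ),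
        ∀ t ∈ ({(j : ℝ) / M, ((j + 1 : ℕ) : ℝ) / M} : Set ℝ), |s - t| ≤ 1 / M := by
      rintro s (rfl | rfl) t (rfl | rfl)
      · simp
      · exact hd.le
      · rw [abs_sub_comm]; exact hd.le
      · simp
    refine supp_mono (fun l' hl' => ?_) (prism_of_mem _ _ l)
    have hl'' : ∀ w ∈ l', ∃ y ∈ l, ∃ t ∈ ({(j : ℝ) / M, ((j + 1 : ℕ) : ℝ) / M} : Set ℝ),
        w = slide v t y := by
      intro w hw
      obtain ⟨y, hy, e | e⟩ := hl' w hw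
      exacts [⟨y, hy, _, Or.inl rfl, e⟩, ⟨y, hy, _, Or.inr rfl, e⟩]
    refine ⟨fun w hw => ?_, fun φ hφ w hw w' hw' => ?_⟩
    · obtain ⟨y, hy, t, ht, rfl⟩ := hl'' w hw
      exact slide_mem hS hv (hl.1 y hy) (key t ht).1 (key t ht).2
    · obtain ⟨y, hy, t, ht, rfl⟩ := hl'' w hw
      obtain ⟨z, hz, s, hs, rfl⟩ := hl'' w' hw'
      refine (abs_slide_sub_slide_le (hl.2 φ hφ y hy z hz) (hC φ hφ v hv z (hl.1 z hz))
        (key t ht).1 (key t ht).2).trans ?_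
      have := mul_le_mul_of_nonneg_right (key2 t ht s hs) hC0
      rw [one_div_mul_eq_div] at this
      linarith

/-- Each entry of the list contributes `C / M` to the mesh. A single subdivision with `M` large is
thus as fine as desired, without iterating. -/
lemma sd_of_mem {Λ : Set (E →ₗ[ℝ] ℝ)} {S : Set E} (hS : Convex ℝ S) {C : ℝ} (hC0 : 0 ≤ C)
    (hC : ∀ φ ∈ Λ, ∀ y ∈ S, ∀ z ∈ S, |φ y - φ z| ≤ C) (hM : M ≠ 0) {l : List E}
    (hl : ∀ y ∈ l, y ∈ S) : sd M (of l) ∈ supp (IsFine Λ S (l.length * (C / M))) := by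
  induction l with
  | nil => rw [sd_nil]; exact of_mem ⟨by simp, by simp⟩
  | cons v l ih =>
    rw [sd_cons, List.length_cons, Nat.cast_add, Nat.cast_one, add_mul, one_mul]
    exact fineCone_mem hS hC0 hC hM (hl v (by simp)) (by positivity)
      (ih fun y hy => hl y (List.mem_cons_of_mem v hy))

lemma sdHomotopy_of_mem {S : Set E} (hS : Convex ℝ S) (hM : M ≠ 0) {l : List E}
    (hl : ∀ y ∈ l, y ∈ S) : sdHomotopy M (of l) ∈ supp fun l' => ∀ y ∈ l', y ∈ S := by
  have hfine : ∀ l : List E, (∀ y ∈ l, y ∈ S) ↔ IsFine ∅ S 0 l := by simp [IsFine]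
  have hcone : ∀ v ∈ S, ∀ x ∈ supp (fun l' => ∀ y ∈ l', y ∈ S),
      cone v x ∈ supp (fun l' => ∀ y ∈ l', y ∈ S) := fun v hv x hx =>
    cone_mem (fun l' hl' y hy => by
      rcases List.mem_cons.mp hy with rfl | hy
      exacts [hv, hl' y hy]) hx
  induction l with
  | nil => simp [sdHomotopy, sdHomotopyList]
  | cons v l ih =>
    have hv := hl v (by simp)
    have hl' : ∀ y ∈ l, y ∈ S := fun y hy => hl y (List.mem_cons_of_mem v hy)
    -- Only membership in `S` matters for the homotopy, so the mesh lemmas are used with no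
    -- functionals and `C = 0`.
    have hsd := sd_of_mem (Λ := ∅) hS le_rfl (by simp) hM hl'
    rw [← cone_of, sdHomotopy_cone]
    refine hcone v hv _ (sub_mem (sub_mem ?_ (hcone v hv _ ?_)) (ih hl'))
    · exact supp_mono (fun l' h => h.1) (fineCone_mem hS le_rfl (by simp) hM hv (by simp) hsd)
    · exact supp_mono (fun l' h => h.1) hsd

end Subdivision

end ListChain

end

noncomputable section

/-! ## Contractible fixed-point sets have acyclic simplicial chains -/

lemma StdComplex.exists_forall_le {Q : Type u} [PartialOrder Q] [Fintype Q] (x : StdComplex Q) :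
    ∃ J, ∀ T, x.1 T ≤ x.1 J := by
  obtain ⟨J, -⟩ := exists_isLeast_support x
  have : Nonempty Q := ⟨J⟩
  exact Finite.exists_max x.1

/-- A vertex at which the barycentric coordinate is maximal. -/
def StdComplex.top {Q : Type u} [PartialOrder Q] [Fintype Q] (x : StdComplex Q) : Q :=
  x.exists_forall_le.choose

lemma StdComplex.le_top {Q : Type u} [PartialOrder Q] [Fintype Q] (x : StdComplex Q) (T : Q) :
    x.1 T ≤ x.1 x.top := x.exists_forall_le.choose_spec T

lemma StdComplex.top_pos {Q : Type u} [PartialOrder Q] [Fintype Q] (x : StdComplex Q) :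
    0 < x.1 x.top := by
  obtain ⟨J, hJ, -⟩ := exists_isLeast_support x
  exact ((x.2.1.1 J).lt_of_ne' hJ).trans_le (x.le_top J)

namespace SimpleMorphism

open Classical ListChain

variable {Q : Type u} [PartialOrder Q] {GQ : SimpleComplexOfGroups.{v, u} Q}
  {G : Type u} [Group G] (ψ : SimpleMorphism GQ G)

/-- The vertices of `X`. -/
abbrev Vertex : Type u := Σ J : Q, G ⧸ ψ.localSubgroup J

/-- The translate by `g` of the vertex `J` of `K`. -/
def vertexOf (g : G) (J : Q) : ψ.Vertex := ⟨J, (g : G ⧸ ψ.localSubgroup J)⟩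

lemma vertexOf_eq_iff {g g' : G} {J : Q} :
    ψ.vertexOf g J = ψ.vertexOf g' J ↔ g⁻¹ * g' ∈ ψ.localSubgroup J := by
  rw [← QuotientGroup.eq]
  simp [vertexOf]

lemma vertexOf_mem_fixedPoints {H : Subgroup G} {g : G} {J : Q} :
    ψ.vertexOf g J ∈ MulAction.fixedPoints H ψ.Vertex ↔
      ∀ h ∈ H, (h * g)⁻¹ * g ∈ ψ.localSubgroup J := by
  constructor
  · intro hf h hh
    rw [← vertexOf_eq_iff]
    exact hf ⟨h, hh⟩
  · rintro hf ⟨h, hh⟩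
    exact ψ.vertexOf_eq_iff.mpr (hf h hh)

/-- A set of vertices of `X^H` that span a simplex. -/
def IsSimplexSet (H : Subgroup G) (A : Set ψ.Vertex) : Prop :=
  ∃ g, (∀ p ∈ A, p = ψ.vertexOf g p.1) ∧ (∀ p ∈ A, p ∈ MulAction.fixedPoints H ψ.Vertex) ∧
    IsChain (· ≤ ·) (Sigma.fst '' A)

variable {ψ} in
lemma IsSimplexSet.mono {H : Subgroup G} {A B : Set ψ.Vertex} (hB : ψ.IsSimplexSet H B)
    (h : A ⊆ B) : ψ.IsSimplexSet H A := by
  obtain ⟨g, h1, h2, h3⟩ := hB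
  exact ⟨g, fun p hp => h1 p (h hp), fun p hp => h2 p (h hp), h3.mono (Set.image_mono h)⟩

/-- Lists of vertices of `X^H` that span a simplex. -/
def IsSimplexList (H : Subgroup G) (l : List ψ.Vertex) : Prop := ψ.IsSimplexSet H {p | p ∈ l}

/-- Extension of a function on `Q` by zero to all vertices of `X`, along the translate by `g`. -/
def extend (g : G) : (Q → ℝ) →ₗ[ℝ] (ψ.Vertex → ℝ) where
  toFun x p := if p = ψ.vertexOf g p.1 then x p.1 else 0
  map_add' x y := by ext p; simp only [Pi.add_apply]; split_ifs <;> simp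
  map_smul' c x := by ext p; simp only [Pi.smul_apply, RingHom.id_apply]; split_ifs <;> simp

lemma extend_vertexOf (g : G) (x : Q → ℝ) (J : Q) : ψ.extend g x (ψ.vertexOf g J) = x J :=
  if_pos rfl

lemma extend_ne_zero {g : G} {x : Q → ℝ} {p : ψ.Vertex} (h : ψ.extend g x p ≠ 0) :
    p = ψ.vertexOf g p.1 ∧ x p.1 ≠ 0 := by
  by_cases hp : p = ψ.vertexOf g p.1
  · refine ⟨hp, ?_⟩
    rw [hp, extend_vertexOf] at h
    exact h
  · exact absurd (if_neg hp) h

variable [Fintype Q]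

/-- The point `[g, x]` of `X`. -/
def point (g : G) (x : StdComplex Q) : ψ.BasicConstruction := Quotient.mk ψ.basicSetoid (g, x)

lemma point_eq_iff {g g' : G} {x x' : StdComplex Q} : ψ.point g x = ψ.point g' x' ↔
    x = x' ∧ ∀ J, x.1 J ≠ 0 → g⁻¹ * g' ∈ ψ.localSubgroup J := by
  constructor
  · intro h
    obtain ⟨e, J, hJ, hg⟩ := Quotient.exact h
    exact ⟨e, fun T hT => ψ.localSubgroup_mono (((isCarrier_iff _ J).mp hJ).2 hT) hg⟩
  · rintro ⟨e, h⟩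
    obtain ⟨J, hJ⟩ := exists_isCarrier x
    exact Quotient.sound ⟨e, J, hJ, h J ((isCarrier_iff _ J).mp hJ).1⟩

/-- The nonzero coordinates of `[g, x]` sit at the cosets `g P_J` with `J` in the support of `x`,
from which `x` and the class of `g` can be read off. Points of `X` may thus be handled as vectors.
-/
lemma extend_eq_iff {g g' : G} {x x' : StdComplex Q} :
    ψ.extend g x.1 = ψ.extend g' x'.1 ↔ ψ.point g x = ψ.point g' x' := by
  have key : ∀ (g g' : G) (x x' : StdComplex Q), ψ.extend g x.1 = ψ.extend g' x'.1 →
      ∀ J, x.1 J ≠ 0 → ψ.vertexOf g J = ψ.vertexOf g' J ∧ x.1 J = x'.1 J := by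
    intro g g' x x' h J hJ
    have h1 := congrFun h (ψ.vertexOf g J)
    rw [extend_vertexOf] at h1
    have h2 := ψ.extend_ne_zero (h1 ▸ hJ)
    have h3 : ψ.vertexOf g J = ψ.vertexOf g' J := h2.1
    rw [h3, extend_vertexOf] at h1
    exact ⟨h3, h1⟩
  rw [point_eq_iff]
  constructor
  · intro h
    refine ⟨Subtype.ext (funext fun J => ?_), fun J hJ =>
      ψ.vertexOf_eq_iff.mp (key g g' x x' h J hJ).1⟩
    by_cases hJ : x.1 J = 0
    · by_contra hne
      exact hne (key g' g x' x h.symm J fun h' => hne (hJ.trans h'.symm)).2.symm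
    · exact (key g g' x x' h J hJ).2
  · rintro ⟨rfl, h⟩
    have key2 : ∀ (g g' : G), (∀ J, x.1 J ≠ 0 → g⁻¹ * g' ∈ ψ.localSubgroup J) →
        ∀ p, ψ.extend g x.1 p ≠ 0 → ψ.extend g x.1 p = ψ.extend g' x.1 p := by
      intro g g' h p hp
      obtain ⟨e, hx⟩ := ψ.extend_ne_zero hp
      have h1 := ψ.vertexOf_eq_iff.mpr (h p.1 hx)
      rw [e, extend_vertexOf, h1, extend_vertexOf]
    funext p
    by_cases hp : ψ.extend g x.1 p = 0
    · by_contra hne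
      refine hne (key2 g' g (fun J hJ => ?_) p fun h' => hne (hp.trans h'.symm)).symm
      simpa using inv_mem (h J hJ)
    · exact key2 g g' h p hp

lemma point_mem_fixedPoints {H : Subgroup G} {g : G} {x : StdComplex Q} :
    ψ.point g x ∈ MulAction.fixedPoints H ψ.BasicConstruction ↔
      ∀ J, x.1 J ≠ 0 → ψ.vertexOf g J ∈ MulAction.fixedPoints H ψ.Vertex := by
  have e : ∀ h : G, h • ψ.point g x = ψ.point (h * g) x := fun h => rfl
  constructor
  · intro hf J hJ
    rw [vertexOf_mem_fixedPoints]
    intro h hh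
    exact (ψ.point_eq_iff.mp ((e h).symm.trans (hf ⟨h, hh⟩))).2 J hJ
  · rintro hf ⟨h, hh⟩
    refine (e h).trans (ψ.point_eq_iff.mpr ⟨rfl, fun J hJ => ?_⟩)
    exact ψ.vertexOf_mem_fixedPoints.mp (hf J hJ) h hh

/-- The barycentric coordinates of a point of `X`. -/
def coord : ψ.BasicConstruction → ψ.Vertex → ℝ :=
  Quotient.lift (fun a => ψ.extend a.1 a.2.1) fun _ _ h => ψ.extend_eq_iff.mpr (Quotient.sound h)

lemma coord_point (g : G) (x : StdComplex Q) : ψ.coord (ψ.point g x) = ψ.extend g x.1 := rfl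

lemma exists_eq_point (y : ψ.BasicConstruction) : ∃ g x, y = ψ.point g x := by
  induction y using Quotient.inductionOn with
  | h a => exact ⟨a.1, a.2, rfl⟩

lemma isSimplexSet_support {H : Subgroup G} {y : ψ.BasicConstruction}
    (hy : y ∈ MulAction.fixedPoints H ψ.BasicConstruction) :
    ψ.IsSimplexSet H (Function.support (ψ.coord y)) := by
  obtain ⟨g, x, rfl⟩ := ψ.exists_eq_point y
  rw [coord_point]
  refine ⟨g, fun p hp => (ψ.extend_ne_zero hp).1, fun p hp => ?_, x.2.2.mono ?_⟩
  · rw [(ψ.extend_ne_zero hp).1]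
    exact ψ.point_mem_fixedPoints.mp hy _ (ψ.extend_ne_zero hp).2
  · rintro _ ⟨p, hp, rfl⟩
    exact (ψ.extend_ne_zero hp).2

/-- A vertex of `X` at which the barycentric coordinate of a point is maximal. -/
def nearest : ψ.BasicConstruction → ψ.Vertex :=
  Quotient.lift (fun a => ψ.vertexOf a.1 a.2.top) (by
    rintro ⟨g, x⟩ ⟨g', x'⟩ h
    obtain ⟨rfl, h'⟩ := ψ.point_eq_iff.mp (Quotient.sound h)
    exact ψ.vertexOf_eq_iff.mpr (h' _ x.top_pos.ne'))

lemma nearest_point (g : G) (x : StdComplex Q) :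
    ψ.nearest (ψ.point g x) = ψ.vertexOf g x.top := rfl

/-- Near a point `y₀`, the maximal coordinates occur at vertices of the simplex of `y₀`. -/
def starNhd (y₀ : ψ.BasicConstruction) : Set ψ.BasicConstruction :=
  {y | ∃ p, 0 < ψ.coord y p ∧ ∀ q, ψ.coord y₀ q = 0 → ψ.coord y q < ψ.coord y p}

lemma mem_starNhd (y₀ : ψ.BasicConstruction) : y₀ ∈ ψ.starNhd y₀ := by
  obtain ⟨g, x, rfl⟩ := ψ.exists_eq_point y₀
  have h : 0 < ψ.coord (ψ.point g x) (ψ.vertexOf g x.top) := by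
    rw [coord_point, extend_vertexOf]
    exact x.top_pos
  exact ⟨ψ.vertexOf g x.top, h, fun q hq => hq ▸ h⟩

/-- A vertex outside the simplex carrying `y₀` is strictly beaten by `p`, so it cannot carry the
largest coordinate of `y`. This makes rounding simplicial: all points of one star neighbourhood are
rounded to vertices of one simplex. -/
lemma coord_nearest_ne_zero {y₀ y : ψ.BasicConstruction} (hy : y ∈ ψ.starNhd y₀) :
    ψ.coord y₀ (ψ.nearest y) ≠ 0 := by
  obtain ⟨p, -, hp⟩ := hy
  intro h
  have h1 := hp _ h
  obtain ⟨g, x, rfl⟩ := ψ.exists_eq_point y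
  rw [nearest_point, coord_point, extend_vertexOf] at h1
  refine h1.not_ge ?_
  by_cases h2 : ψ.extend g x.1 p = 0
  · rw [h2]
    exact x.top_pos.le
  · rw [(ψ.extend_ne_zero h2).1, extend_vertexOf]
    exact x.le_top _

lemma continuous_point (g : G) : Continuous (ψ.point g) := by
  let _ : TopologicalSpace G := ⊥
  exact continuous_quotient_mk'.comp (Continuous.prodMk_right g)

lemma isOpen_iff_forall_point {V : Set ψ.BasicConstruction} :
    IsOpen V ↔ ∀ g, IsOpen (ψ.point g ⁻¹' V) := by
  refine ⟨fun h g => h.preimage (ψ.continuous_point g), fun h => ?_⟩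
  let _ : TopologicalSpace G := ⊥
  have : DiscreteTopology G := ⟨rfl⟩
  refine isOpen_coinduced.mpr ?_
  have e : (Quotient.mk ψ.basicSetoid ⁻¹' V : Set (G × StdComplex Q)) =
      ⋃ g, {g} ×ˢ (ψ.point g ⁻¹' V) := by
    ext ⟨g, x⟩
    simp only [Set.singleton_prod, Set.mem_iUnion, Set.mem_image, Set.mem_preimage]
    constructor
    · exact fun hx => ⟨g, x, hx, rfl⟩
    · rintro ⟨_, _, hx, e⟩
      obtain ⟨rfl, rfl⟩ := Prod.mk.inj e
      exact hx
  exact e ▸ isOpen_iUnion fun g => (isOpen_discrete _).prod (h g)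

/-- Although `X` need not be locally finite, only the finitely many vertices of a translate of `K`
have nonzero coordinates on it, so finitely many strict inequalities suffice there. -/
lemma isOpen_starNhd (y₀ : ψ.BasicConstruction) : IsOpen (ψ.starNhd y₀) := by
  rw [isOpen_iff_forall_point]
  intro g
  have e : ψ.point g ⁻¹' ψ.starNhd y₀ = ⋃ T : Q,
      {x | 0 < x.1 T} ∩ ⋂ J ∈ {J | ψ.coord y₀ (ψ.vertexOf g J) = 0}, {x | x.1 J < x.1 T} := by
    ext x
    simp only [Set.mem_preimage, starNhd, Set.mem_ofPred_eq, coord_point, Set.mem_iUnion,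
      Set.mem_inter_iff, Set.mem_iInter]
    constructor
    · rintro ⟨p, hpos, hp⟩
      obtain ⟨e, -⟩ := ψ.extend_ne_zero hpos.ne'
      rw [e, extend_vertexOf] at hpos
      refine ⟨p.1, hpos, fun J hJ => ?_⟩
      have := hp _ hJ
      rwa [e, extend_vertexOf, extend_vertexOf] at this
    · rintro ⟨T, h0, hT⟩
      refine ⟨ψ.vertexOf g T, by rwa [extend_vertexOf], fun q hq => ?_⟩
      rw [extend_vertexOf]
      by_cases h : ψ.extend g x.1 q = 0
      · rwa [h]
      · obtain ⟨e, -⟩ := ψ.extend_ne_zero h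
        rw [e] at hq
        rw [e, extend_vertexOf]
        exact hT _ hq
  rw [e]
  have hc : ∀ J : Q, Continuous fun x : StdComplex Q => x.1 J := fun J =>
    (continuous_apply J).comp continuous_subtype_val
  exact isOpen_iUnion fun T => (isOpen_lt continuous_const (hc T)).inter <|
    (Set.toFinite _).isOpen_biInter fun J _ => isOpen_lt (hc J) (hc T)

end SimpleMorphism

end

/-! ### Acyclicity of contractible fixed-point sets by simplicial approximation. -/

noncomputable section

namespace SimpleMorphism

open Classical ListChain

variable {Q : Type u} [PartialOrder Q] {GQ : SimpleComplexOfGroups.{v, u} Q}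
  {G : Type u} [Group G] (ψ : SimpleMorphism GQ G)

/-- The vertices of `X` as functions on the set of vertices. -/
def unitVector (p : ψ.Vertex) : ψ.Vertex → ℝ := Pi.single p 1

lemma extend_single (g : G) (J : Q) :
    ψ.extend g (Pi.single J 1) = ψ.unitVector (ψ.vertexOf g J) := by
  funext p
  by_cases hp : p = ψ.vertexOf g J
  · subst hp
    rw [extend_vertexOf, unitVector, Pi.single_eq_same, Pi.single_eq_same]
  · rw [unitVector, Pi.single_eq_of_ne hp]
    by_contra h
    obtain ⟨e, h⟩ := ψ.extend_ne_zero h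
    have : p.1 = J := by
      by_contra hJ
      exact h (Pi.single_eq_of_ne hJ 1)
    exact hp (this ▸ e)

variable [Fintype Q]

/-- The fixed-point set `X^H`. -/
abbrev FixedSet (H : Subgroup G) : Type u := MulAction.fixedPoints H ψ.BasicConstruction

/-- Barycentric coordinates on the points of `|Q|` whose translate by `g` is fixed by `H`. -/
def fixedPart (H : Subgroup G) (g : G) : Set (Q → ℝ) :=
  {x | x ∈ stdSimplex ℝ Q ∧ IsChain (· ≤ ·) (Function.support x) ∧
    ∀ J, x J ≠ 0 → ψ.vertexOf g J ∈ MulAction.fixedPoints H ψ.Vertex}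

/-- The point of `X^H` with given coordinates. -/
def fixedPoint {H : Subgroup G} {g : G} (x : ψ.fixedPart H g) : ψ.FixedSet H :=
  ⟨ψ.point g ⟨x.1, x.2.1, x.2.2.1⟩, ψ.point_mem_fixedPoints.mpr x.2.2.2⟩

lemma continuous_fixedPoint (H : Subgroup G) (g : G) :
    Continuous (ψ.fixedPoint : ψ.fixedPart H g → _) :=
  ((ψ.continuous_point g).comp
    (continuous_subtype_val.subtype_mk fun x => ⟨x.2.1, x.2.2.1⟩)).subtype_mk _

/-- The conditions are closed: the support is a chain iff of any two incomparable coordinates one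
vanishes, and fixedness says that the coordinates at vertices not fixed by `H` vanish. -/
lemma isCompact_fixedPart (H : Subgroup G) (g : G) : IsCompact (ψ.fixedPart H g) := by
  have e : ψ.fixedPart H g = stdSimplex ℝ Q ∩
      ((⋂ (J : Q) (T : Q) (_ : ¬ J ≤ T ∧ ¬ T ≤ J), {x | x J = 0} ∪ {x | x T = 0}) ∩
      ⋂ (J : Q) (_ : ψ.vertexOf g J ∉ MulAction.fixedPoints H ψ.Vertex), {x | x J = 0}) := by
    ext x
    simp only [fixedPart, Set.mem_ofPred_eq, Set.mem_inter_iff, Set.mem_iInter, Set.mem_union]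
    refine and_congr_right fun _ => and_congr ⟨fun h J T hJT => ?_, fun h J hJ T hT _ => ?_⟩ ?_
    · by_contra! hc
      rcases h.total hc.1 hc.2 with h' | h'
      exacts [hJT.1 h', hJT.2 h']
    · by_contra! hc
      rcases h J T hc with h' | h'
      exacts [hJ h', hT h']
    · exact forall_congr' fun J => ⟨fun h hn => by_contra fun hJ => hn (h hJ),
        fun h hJ => by_contra fun hn => hJ (h hn)⟩
  have hc : ∀ J : Q, IsClosed {x : Q → ℝ | x J = 0} := fun J =>
    isClosed_eq (continuous_apply J) continuous_const
  rw [e]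
  refine (isCompact_stdSimplex ℝ Q).inter_right (IsClosed.inter ?_ ?_)
  · exact isClosed_iInter fun J => isClosed_iInter fun T => isClosed_iInter fun _ =>
      (hc J).union (hc T)
  · exact isClosed_iInter fun J => isClosed_iInter fun _ => hc J

/-- A Lebesgue number for the cover of `K × [0, 1]` by the preimages of the neighbourhoods
`starNhd`. -/
lemma exists_lebesgue_number {H : Subgroup G} (F : C(unitInterval × ψ.FixedSet H, ψ.FixedSet H))
    (g : G) : ∃ δ > 0, ∀ (x : ψ.fixedPart H g) (t : unitInterval), ∃ y₀ : ψ.FixedSet H,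
      ∀ (x' : ψ.fixedPart H g) (t' : unitInterval), (∀ J, |x'.1 J - x.1 J| < δ) →
        |(t' : ℝ) - t| < δ → ψ.coord y₀ (ψ.nearest (F (t', ψ.fixedPoint x'))) ≠ 0 := by
  have : CompactSpace (ψ.fixedPart H g) := isCompact_iff_compactSpace.mp (ψ.isCompact_fixedPart H g)
  let f : ψ.fixedPart H g × unitInterval → ψ.BasicConstruction := fun a =>
    (F (a.2, ψ.fixedPoint a.1) : ψ.BasicConstruction)
  have hf : Continuous f := continuous_subtype_val.comp
    (F.continuous.comp (continuous_snd.prodMk ((ψ.continuous_fixedPoint H g).comp continuous_fst)))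
  obtain ⟨δ, hδ, h⟩ := lebesgue_number_lemma_of_metric isCompact_univ
    (c := fun y₀ : ψ.FixedSet H => f ⁻¹' ψ.starNhd y₀)
    (fun y₀ => (ψ.isOpen_starNhd y₀).preimage hf)
    (fun a _ => Set.mem_iUnion.mpr ⟨F (a.2, ψ.fixedPoint a.1), ψ.mem_starNhd _⟩)
  refine ⟨δ, hδ, fun x t => ?_⟩
  obtain ⟨y₀, hy₀⟩ := h (x, t) trivial
  refine ⟨y₀, fun x' t' hx ht => ψ.coord_nearest_ne_zero (hy₀ (a := (x', t')) ?_)⟩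
  rw [Metric.mem_ball, Prod.dist_eq, max_lt_iff]
  refine ⟨?_, ht⟩
  rw [Subtype.dist_eq, dist_pi_lt_iff hδ]
  exact hx

/-- The point of `X^H` with given barycentric coordinates, or `b` if there is none. -/
def realize {H : Subgroup G} (b : ψ.FixedSet H) (y : ψ.Vertex → ℝ) : ψ.FixedSet H :=
  if h : ∃ z : ψ.FixedSet H, ψ.coord z = y then h.choose else b

lemma coord_injective : Function.Injective ψ.coord := by
  intro y z h
  obtain ⟨g, x, rfl⟩ := ψ.exists_eq_point y
  obtain ⟨g', x', rfl⟩ := ψ.exists_eq_point z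
  exact ψ.extend_eq_iff.mp h

lemma realize_coord {H : Subgroup G} (b z : ψ.FixedSet H) : ψ.realize b (ψ.coord z) = z := by
  have h : ∃ z' : ψ.FixedSet H, ψ.coord z' = ψ.coord z := ⟨z, rfl⟩
  rw [realize, dif_pos h]
  exact Subtype.ext (ψ.coord_injective h.choose_spec)

lemma realize_extend {H : Subgroup G} (b : ψ.FixedSet H) {g : G} (x : ψ.fixedPart H g) :
    ψ.realize b (ψ.extend g x.1) = ψ.fixedPoint x :=
  ψ.realize_coord b (ψ.fixedPoint x)

/-- The points of the simplex spanned by a list of vertices. -/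
def simplexPoints (g : G) (l : List ψ.Vertex) : Set (ψ.Vertex → ℝ) :=
  ψ.extend g '' {x | x ∈ stdSimplex ℝ Q ∧ ∀ J, x J ≠ 0 → ψ.vertexOf g J ∈ l}

lemma convex_simplexPoints (g : G) (l : List ψ.Vertex) : Convex ℝ (ψ.simplexPoints g l) := by
  refine Convex.linear_image ?_ _
  intro x hx y hy a b ha hb hab
  refine ⟨?_, fun J hJ => ?_⟩
  · exact convex_stdSimplex ℝ Q hx.1 hy.1 ha hb hab
  · by_contra hn
    have h1 : x J = 0 := by_contra fun h => hn (hx.2 J h)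
    have h2 : y J = 0 := by_contra fun h => hn (hy.2 J h)
    exact hJ (by simp [h1, h2])

/-- `g` is a common representative for a list of vertices spanning a simplex of `X^H`. -/
structure IsLift (H : Subgroup G) (g : G) (l : List ψ.Vertex) : Prop where
  eq_vertexOf : ∀ p ∈ l, p = ψ.vertexOf g p.1
  mem_fixedPoints : ∀ p ∈ l, p ∈ MulAction.fixedPoints H ψ.Vertex
  isChain : IsChain (· ≤ ·) (Sigma.fst '' {p | p ∈ l})

variable {ψ} in
lemma IsLift.exists_fixedPart {H : Subgroup G} {g : G} {l : List ψ.Vertex} (h : ψ.IsLift H g l)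
    {y : ψ.Vertex → ℝ} (hy : y ∈ ψ.simplexPoints g l) :
    ∃ x : ψ.fixedPart H g, ψ.extend g x.1 = y ∧ ∀ J, x.1 J ≠ 0 → ψ.vertexOf g J ∈ l := by
  obtain ⟨x, ⟨hx, hl⟩, rfl⟩ := hy
  refine ⟨⟨x, hx, ?_, fun J hJ => h.mem_fixedPoints _ (hl J hJ)⟩, rfl, hl⟩
  refine h.isChain.mono fun J hJ => ?_
  exact ⟨ψ.vertexOf g J, hl J hJ, rfl⟩

variable {ψ} in
lemma IsLift.unitVector_mem {H : Subgroup G} {g : G} {l : List ψ.Vertex} (h : ψ.IsLift H g l)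
    {p : ψ.Vertex} (hp : p ∈ l) : ψ.unitVector p ∈ ψ.simplexPoints g l := by
  refine ⟨(Pi.single p.1 1 : Q → ℝ), ?_, ?_⟩
  · refine ⟨single_mem_stdSimplex ℝ p.1, fun J (hJ : (Pi.single p.1 1 : Q → ℝ) J ≠ 0) => ?_⟩
    have : J = p.1 := by
      by_contra hne
      exact hJ (Pi.single_eq_of_ne hne 1)
    rwa [this, ← h.eq_vertexOf p hp]
  · rw [extend_single, ← h.eq_vertexOf p hp]

/-- The barycentric coordinates, as linear functionals. -/
def coordinates : Set ((ψ.Vertex → ℝ) →ₗ[ℝ] ℝ) := Set.range fun p => LinearMap.proj p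

lemma abs_coordinates_sub_le {g : G} {l : List ψ.Vertex} : ∀ φ ∈ ψ.coordinates,
    ∀ y ∈ ψ.simplexPoints g l, ∀ z ∈ ψ.simplexPoints g l, |φ y - φ z| ≤ 1 := by
  rintro _ ⟨p, rfl⟩ _ ⟨x, hx, rfl⟩ _ ⟨x', hx', rfl⟩
  have h : ∀ x ∈ stdSimplex ℝ Q, 0 ≤ ψ.extend g x p ∧ ψ.extend g x p ≤ 1 := by
    intro x hx
    by_cases h0 : ψ.extend g x p = 0
    · rw [h0]; norm_num
    · rw [(ψ.extend_ne_zero h0).1, extend_vertexOf]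
      exact mem_Icc_of_mem_stdSimplex hx _
  exact abs_sub_le_of_nonneg_of_le (h x hx.1).1 (h x hx.1).2 (h x' hx'.1).1 (h x' hx'.1).2

/-- The chains of the simplicial complex `X^H` are acyclic if the space `X^H` is contractible. -/
theorem exists_bdry_eq {H : Subgroup G} (hX : ContractibleSpace (ψ.FixedSet H))
    {z : ListChain ψ.Vertex} (hz : z ∈ supp (ψ.IsSimplexList H)) (hz0 : bdry z = 0) :
    ∃ w ∈ supp (ψ.IsSimplexList H), bdry w = z := by
  -- Contractibility enters as a homotopy `F` from the identity to the constant map at `b`.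
  obtain ⟨b, ⟨F⟩⟩ := id_nullhomotopic (ψ.FixedSet H)
  have hF0 : ∀ y, F (0, y) = y := F.apply_zero
  have hF1 : ∀ y, F (1, y) = b := F.apply_one
  choose! g hg using fun (l : List ψ.Vertex) (hl : l ∈ z.support) =>
    (show ∃ g, ψ.IsLift H g l by
      obtain ⟨g, h1, h2, h3⟩ := hz hl
      exact ⟨g, h1, h2, h3⟩)
  choose δ hδ hleb using ψ.exists_lebesgue_number (H := H) F.toContinuousMap
  -- The same `M` serves the subdivision and the time steps; it exists because only finitely many
  -- simplices, each with its own Lebesgue number, occur in `z`.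
  obtain ⟨M, hM, hM0⟩ : ∃ M : ℕ, (∀ l ∈ z.support, l.length * (1 / (M : ℝ)) < δ (g l) ∧
      1 / (M : ℝ) < δ (g l)) ∧ M ≠ 0 := by
    have h1 : ∀ c ε : ℝ, 0 < ε → ∀ᶠ M : ℕ in Filter.atTop, c * (1 / (M : ℝ)) < ε := by
      intro c ε hε
      have := tendsto_one_div_atTop_nhds_zero_nat.const_mul c
      rw [mul_zero] at this
      exact this.eventually_lt_const hε
    have h2 := (Filter.eventually_all_finset z.support).mpr fun l _ =>
      (h1 l.length _ (hδ (g l))).and (h1 1 _ (hδ (g l)))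
    obtain ⟨M, h3, h4⟩ := (h2.and (Filter.eventually_ne_atTop 0)).exists
    exact ⟨M, fun l hl => by simpa only [one_mul] using h3 l hl, h4⟩
  -- The contraction followed by rounding to a nearest vertex. Clamping the time and the default
  -- value `b` only serve to make it total; neither intervenes on the supports below.
  let Φ : ℝ → (ψ.Vertex → ℝ) → ψ.Vertex := fun t y =>
    ψ.nearest (F (Set.projIcc 0 1 zero_le_one t, ψ.realize b y))
  have hzs : z ∈ supp fun l => l ∈ z.support := fun l hl => hl
  have hmem : ∀ {f : ListChain ψ.Vertex →ₗ[ℤ] ListChain ψ.Vertex},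
      (∀ l ∈ z.support, f (of l) ∈ supp (ψ.IsSimplexList H)) →
        f z ∈ supp (ψ.IsSimplexList H) := fun h => map_mem h hzs
  have hsimp : ∀ l ∈ z.support, ψ.IsSimplexList H l := fun l hl => hz hl
  have hΦ0 : ∀ l g, ψ.IsLift H g l → ∀ y ∈ ψ.simplexPoints g l, Φ 0 y ∈ l := by
    intro l g hg y hy
    obtain ⟨x, rfl, hx⟩ := hg.exists_fixedPart hy
    have : Φ 0 (ψ.extend g x.1) = ψ.nearest (ψ.fixedPoint x) := by
      simp only [Φ, Set.projIcc_left, realize_extend]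
      exact congrArg (fun y : ψ.FixedSet H => ψ.nearest y) (hF0 _)
    rw [this]
    exact hx _ (StdComplex.top_pos ⟨x.1, x.2.1, x.2.2.1⟩).ne'
  have hΦv : map (Φ 0) (map ψ.unitVector z) = z := by
    rw [map_map]
    refine map_congr_of_mem (g := LinearMap.id) (fun l hl => ?_) hzs
    rw [map_of, LinearMap.id_apply]
    congr 1
    refine (List.map_congr_left fun p hp => ?_).trans (List.map_id l)
    -- Applied to the one-vertex simplex `[p]`, `hΦ0` leaves `p` as the only possible value.
    have hp' : ψ.IsLift H (g l) [p] :=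
      ⟨by simpa using (hg l hl).eq_vertexOf p hp, by simpa using (hg l hl).mem_fixedPoints p hp,
        (hg l hl).isChain.mono (Set.image_mono (by simpa using hp))⟩
    simpa using hΦ0 _ _ hp' _ (hp'.unitVector_mem (List.mem_singleton_self p))
  have hvert : ∀ l ∈ z.support, ∀ y ∈ l.map ψ.unitVector, y ∈ ψ.simplexPoints (g l) l := by
    intro l hl y hy
    obtain ⟨p, hp, rfl⟩ := List.mem_map.mp hy
    exact (hg l hl).unitVector_mem hp
  have hconst : Φ 1 = fun _ => ψ.nearest b := by
    funext y
    simp only [Φ, Set.projIcc_right]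
    exact congrArg (fun y : ψ.FixedSet H => ψ.nearest y) (hF1 _)
  set S := sd M (map ψ.unitVector z) with hS
  have hS0 : bdry S = 0 := by rw [hS, bdry_sd M hM0, bdry_map, hz0, map_zero, map_zero]
  have hu1 : bdry (map (Φ 0) (sdHomotopy M (map ψ.unitVector z))) = map (Φ 0) S - z := by
    rw [bdry_map, bdry_sdHomotopy M hM0, bdry_map, hz0, map_zero, map_zero, sub_zero, map_sub, hΦv]
  have hu2 : bdry (∑ j ∈ Finset.range M, prism (Φ ((j : ℝ) / M)) (Φ (((j + 1 : ℕ) : ℝ) / M)) S) =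
      map (Φ 1) S - map (Φ 0) S := by
    rw [map_sum]
    simp only [bdry_prism, hS0, map_zero, sub_zero]
    rw [Finset.sum_range_sub (fun j : ℕ => map (Φ ((j : ℝ) / M)) S), Nat.cast_zero, zero_div,
      div_self (Nat.cast_ne_zero.mpr hM0)]
  -- The rounded subdivision homotopy joins `z` to `map (Φ 0) S`, the prisms over the time steps
  -- join this to `map (Φ 1) S`, and the latter is a constant cycle bounding a cone.
  refine ⟨cone (ψ.nearest b) (map (Φ 1) S) -
    ∑ j ∈ Finset.range M, prism (Φ ((j : ℝ) / M)) (Φ (((j + 1 : ℕ) : ℝ) / M)) S -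
      map (Φ 0) (sdHomotopy M (map ψ.unitVector z)), sub_mem (sub_mem ?_ ?_) ?_, ?_⟩
  · have hb : ∀ l : List ψ.Vertex, (∀ p ∈ l, p = ψ.nearest b) → ψ.IsSimplexList H l := by
      intro l hl
      refine (ψ.isSimplexSet_support b.2).mono fun p hp => ?_
      rw [hl p hp]
      exact ψ.coord_nearest_ne_zero (ψ.mem_starNhd _)
    rw [hconst]
    refine cone_mem (p := fun l => ∀ p ∈ l, p = ψ.nearest b)
      (fun l hl => hb _ (by simpa using hl)) ?_
    exact map_mem (p := fun _ => True) (fun l _ => by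
      rw [map_of]
      exact of_mem (by simp)) (fun _ _ => trivial)
  · refine Submodule.sum_mem _ fun j hj => ?_
    have hM' : (0 : ℝ) < M := Nat.cast_pos.mpr (Nat.pos_of_ne_zero hM0)
    have ht : ∀ t ∈ ({(j : ℝ) / M, ((j + 1 : ℕ) : ℝ) / M} : Set ℝ), t ∈ Set.Icc (0 : ℝ) 1 ∧
        |t - (j : ℝ) / M| ≤ 1 / M := by
      have h1 : ((j + 1 : ℕ) : ℝ) ≤ M := Nat.cast_le.mpr (Finset.mem_range.mp hj)
      have h2 : (j : ℝ) ≤ M := Nat.cast_le.mpr (Finset.mem_range.mp hj).le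
      rintro t (rfl | rfl)
      · exact ⟨⟨by positivity, (div_le_one hM').mpr h2⟩, by simp⟩
      · refine ⟨⟨by positivity, (div_le_one hM').mpr h1⟩, ?_⟩
        rw [← sub_div, abs_div, abs_of_pos hM']
        simp
    refine hmem (f := prism (Φ ((j : ℝ) / M)) (Φ (((j + 1 : ℕ) : ℝ) / M)) ∘ₗ sd M ∘ₗ
      map ψ.unitVector) fun l hl => ?_
    simp only [LinearMap.comp_apply, map_of]
    refine map_mem (fun l' hl' => ?_) (sd_of_mem (ψ.convex_simplexPoints (g l) l) zero_le_one
      ψ.abs_coordinates_sub_le hM0 (hvert l hl))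
    rcases l' with _ | ⟨y₁, l'⟩
    · rw [prism_nil]
      exact zero_mem _
    obtain ⟨x₁, hx₁, -⟩ := (hg l hl).exists_fixedPart (hl'.1 y₁ List.mem_cons_self)
    have hjM := ht _ (Set.mem_insert _ _)
    -- All points of a list of the subdivision, at both ends of the time step, are within the
    -- Lebesgue number of `x₁` at time `j / M`, so they are rounded to vertices of the simplex
    -- carrying a single `y₀`.
    obtain ⟨y₀, hy₀⟩ := hleb (g l) x₁ ⟨_, hjM.1⟩
    refine supp_mono (fun l'' hl'' => ?_) (prism_of_mem _ _ _)
    refine (ψ.isSimplexSet_support y₀.2).mono fun p hp => ?_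
    obtain ⟨y, hy, t, htj, rfl⟩ : ∃ y ∈ y₁ :: l', ∃ t ∈ ({(j : ℝ) / M, ((j + 1 : ℕ) : ℝ) / M} : Set ℝ),
        p = Φ t y := by
      obtain ⟨y, hy, h | h⟩ := hl'' p hp
      exacts [⟨y, hy, _, Or.inl rfl, h⟩, ⟨y, hy, _, Or.inr rfl, h⟩]
    obtain ⟨x, rfl, -⟩ := (hg l hl).exists_fixedPart (hl'.1 y hy)
    have h := hy₀ x ⟨t, (ht t htj).1⟩ (fun J => ?_) ((ht t htj).2.trans_lt (hM l hl).2)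
    · simp only [Φ, realize_extend, Set.projIcc_of_mem _ (ht t htj).1]
      exact h
    · have h1 := hl'.2 _ ⟨ψ.vertexOf (g l) J, rfl⟩ _ hy y₁ List.mem_cons_self
      simp only [LinearMap.proj_apply, ← hx₁, extend_vertexOf, List.length_map] at h1
      exact h1.trans_lt (hM l hl).1
  · refine hmem (f := map (Φ 0) ∘ₗ sdHomotopy M ∘ₗ map ψ.unitVector) fun l hl => ?_
    simp only [LinearMap.comp_apply, map_of]
    refine map_mem (fun l' hl' => ?_)
      (sdHomotopy_of_mem (ψ.convex_simplexPoints (g l) l) hM0 (hvert l hl))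
    rw [map_of]
    refine of_mem ((hsimp l hl).mono fun p hp => ?_)
    obtain ⟨y, hy, rfl⟩ := List.mem_map.mp hp
    exact hΦ0 l _ (hg l hl) y (hl' y hy)
  · rw [map_sub, map_sub, hu1, hu2, bdry_cone, bdry_map, hS0, map_zero, map_zero]
    abel

end SimpleMorphism

end

noncomputable section

/-! ## Exactness of the cellular chains of a contractible fixed-point set -/

namespace ListChain

lemma bdry_ofFn {V : Type*} {n : ℕ} (f : Fin (n + 1) → V) : bdry (of (List.ofFn f)) =
    ∑ i : Fin (n + 1), (-1 : ℤ) ^ (i : ℕ) • of (List.ofFn (f ∘ i.succAbove)) := by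
  induction n with
  | zero => simp
  | succ n ih =>
    rw [List.ofFn_succ, bdry_cons, ih, map_sum, sub_eq_add_neg, Fin.sum_univ_succ (n := n + 1),
      ← Finset.sum_neg_distrib]
    congr 1
    · simp [Function.comp_def]
    · refine Finset.sum_congr rfl fun i _ => ?_
      rw [map_smul, cone_of, Fin.val_succ, pow_succ, mul_neg_one, neg_smul]
      congr 3
      rw [List.ofFn_succ (f := f ∘ i.succ.succAbove)]
      simp [Function.comp_def]

end ListChain

namespace SimpleMorphism

open ListChain

variable {Q : Type u} [PartialOrder Q] {GQ : SimpleComplexOfGroups.{v, u} Q}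
  {G : Type u} [Group G] (ψ : SimpleMorphism GQ G)

/-- The vertices of `X`, partially ordered through their images in `Q`. -/
abbrev vertexPartialOrder : PartialOrder ψ.Vertex where
  le p q := p = q ∨ p.1 < q.1
  le_refl p := Or.inl rfl
  le_trans := by
    rintro p q r (rfl | h) (rfl | h')
    exacts [Or.inl rfl, Or.inr h', Or.inr h, Or.inr (h.trans h')]
  le_antisymm := by
    rintro p q (rfl | h) (h' | h')
    exacts [rfl, rfl, h'.symm, absurd (h.trans h') (lt_irrefl _)]

/-- A linear order on the vertices of `X` that is compatible with the order on `Q`. -/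
abbrev vertexLinearOrder : LinearOrder ψ.Vertex :=
  letI := ψ.vertexPartialOrder
  inferInstanceAs (LinearOrder (LinearExtension ψ.Vertex))

lemma vertexLinearOrder_lt {p q : ψ.Vertex} (h : p.1 < q.1) : ψ.vertexLinearOrder.lt p q := by
  let _ := ψ.vertexPartialOrder
  have h1 : p ≤ q := Or.inr h
  have h2 : (toLinearExtension p : LinearExtension ψ.Vertex) ≤ toLinearExtension q :=
    toLinearExtension.monotone h1
  exact lt_of_le_of_ne h2 fun e => h.ne (congrArg Sigma.fst (show p = q from e))

/-- The list of vertices of a simplex of `X`. -/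
def vertexList {n : ℕ} (c : ψ.Cell n) : List ψ.Vertex :=
  List.ofFn fun k => (⟨c.1 k, Subgroup.quotientMapOfLE
    (ψ.localSubgroup_mono (c.1.monotone (Fin.zero_le k))) c.2⟩ : ψ.Vertex)

lemma vertexList_mk {n : ℕ} (σ : PosetSimplex Q n) (g : G) :
    ψ.vertexList ⟨σ, (g : G ⧸ ψ.localSubgroup (σ 0))⟩ = List.ofFn fun k => ψ.vertexOf g (σ k) := rfl

lemma exists_eq_mk {n : ℕ} (c : ψ.Cell n) :
    ∃ (σ : PosetSimplex Q n) (g : G), c = ⟨σ, (g : G ⧸ ψ.localSubgroup (σ 0))⟩ := by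
  obtain ⟨σ, c⟩ := c
  obtain ⟨g, rfl⟩ := QuotientGroup.mk_surjective c
  exact ⟨σ, g, rfl⟩

lemma vertexList_injective {n : ℕ} : Function.Injective (ψ.vertexList (n := n)) := by
  intro c c' h
  obtain ⟨σ, g, rfl⟩ := ψ.exists_eq_mk c
  obtain ⟨σ', g', rfl⟩ := ψ.exists_eq_mk c'
  rw [vertexList_mk, vertexList_mk] at h
  have h1 := fun k => congrFun (List.ofFn_injective h) k
  obtain rfl : σ = σ' := by
    ext k
    exact congrArg Sigma.fst (h1 k)
  exact congrArg (Sigma.mk σ) (eq_of_heq (Sigma.mk.inj (h1 0)).2)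

lemma mk_mem_fixedPoints {H : Subgroup G} {n : ℕ} {σ : PosetSimplex Q n} {g : G} :
    (⟨σ, (g : G ⧸ ψ.localSubgroup (σ 0))⟩ : ψ.Cell n) ∈ MulAction.fixedPoints H (ψ.Cell n) ↔
      ψ.vertexOf g (σ 0) ∈ MulAction.fixedPoints H ψ.Vertex := by
  refine forall_congr' fun h => ⟨fun e => ?_, fun e => ?_⟩
  · exact congrArg (Sigma.mk (σ 0)) (eq_of_heq (Sigma.mk.inj e).2)
  · exact congrArg (Sigma.mk σ) (eq_of_heq (Sigma.mk.inj e).2)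

lemma vertexOf_mem_fixedPoints_of_le {H : Subgroup G} {g : G} {J T : Q} (h : J ≤ T)
    (hJ : ψ.vertexOf g J ∈ MulAction.fixedPoints H ψ.Vertex) :
    ψ.vertexOf g T ∈ MulAction.fixedPoints H ψ.Vertex := by
  rw [vertexOf_mem_fixedPoints] at hJ ⊢
  exact fun x hx => ψ.localSubgroup_mono h (hJ x hx)

/-- The lists of vertices of the `n`-simplices of `X^H`. -/
def IsOrderedSimplex (H : Subgroup G) (n : ℕ) (l : List ψ.Vertex) : Prop :=
  ψ.IsSimplexList H l ∧ l.Pairwise ψ.vertexLinearOrder.lt ∧ l.length = n + 1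

/-- With a common representative `g`, distinct vertices of a simplex have distinct comparable images
in `Q`, and the linear order refines that of `Q`. Increasing lists therefore trace out exactly the
chains. -/
lemma isOrderedSimplex_iff {H : Subgroup G} {n : ℕ} {l : List ψ.Vertex} :
    ψ.IsOrderedSimplex H n l ↔
      ∃ c ∈ MulAction.fixedPoints H (ψ.Cell n), ψ.vertexList c = l := by
  constructor
  · rintro ⟨⟨g, hg, hfix, hch⟩, hlt, hlen⟩
    have hmono : ∀ i j : Fin l.length, i < j → l[i].1 < l[j].1 := by
      intro i j hij
      have h1 : ψ.vertexLinearOrder.lt l[i] l[j] := List.pairwise_iff_getElem.mp hlt i j i.2 j.2 hij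
      have hi : l[i] ∈ l := List.getElem_mem _
      have hj : l[j] ∈ l := List.getElem_mem _
      have hne : l[i].1 ≠ l[j].1 := by
        intro e
        have : l[i] = l[j] := by
          rw [hg _ hi, hg _ hj, e]
        rw [this] at h1
        exact @lt_irrefl _ ψ.vertexLinearOrder.toPreorder _ h1
      rcases hch.total (Set.mem_image_of_mem Sigma.fst hi) (Set.mem_image_of_mem Sigma.fst hj)
        with h | h
      · exact lt_of_le_of_ne h hne
      · exact absurd h1 (@lt_asymm _ ψ.vertexLinearOrder.toPreorder _ _
          (ψ.vertexLinearOrder_lt (lt_of_le_of_ne h hne.symm)))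
    let σ : PosetSimplex Q n := OrderEmbedding.ofStrictMono
      (fun k => l[(k.cast hlen.symm : Fin l.length)].1) fun i j hij => hmono _ _ hij
    refine ⟨⟨σ, (g : G ⧸ ψ.localSubgroup (σ 0))⟩, ?_, ?_⟩
    · rw [mk_mem_fixedPoints]
      have h0 := List.getElem_mem (l := l) (n := 0) (by omega)
      have := hfix _ h0
      rwa [hg _ h0] at this
    · rw [vertexList_mk]
      refine List.ext_getElem (by simp [hlen]) fun k hk hk' => ?_
      rw [List.getElem_ofFn]
      exact (hg _ (List.getElem_mem hk')).symm
  · rintro ⟨c, hc, rfl⟩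
    obtain ⟨σ, g, rfl⟩ := ψ.exists_eq_mk c
    rw [mk_mem_fixedPoints] at hc
    rw [vertexList_mk]
    refine ⟨⟨g, ?_, ?_, ?_⟩, ?_, by simp⟩
    · intro p hp
      obtain ⟨k, rfl⟩ := List.mem_ofFn.mp hp
      rfl
    · intro p hp
      obtain ⟨k, rfl⟩ := List.mem_ofFn.mp hp
      exact ψ.vertexOf_mem_fixedPoints_of_le (σ.monotone (Fin.zero_le k)) hc
    · rintro _ ⟨p, hp, rfl⟩ _ ⟨q, hq, rfl⟩ -
      obtain ⟨k, rfl⟩ := List.mem_ofFn.mp hp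
      obtain ⟨m, rfl⟩ := List.mem_ofFn.mp hq
      exact (le_total k m).imp (fun h => σ.monotone h) fun h => σ.monotone h
    · rw [List.pairwise_ofFn]
      exact fun i j hij => ψ.vertexLinearOrder_lt (σ.strictMono hij)

/-- Cellular chains of `X^H` as ordered chains of vertices. -/
def toListChain (H : Subgroup G) (n : ℕ) :
    (MulAction.fixedPoints H (ψ.Cell n) →₀ ℤ) →ₗ[ℤ] ListChain ψ.Vertex :=
  Finsupp.lmapDomain ℤ ℤ fun c => ψ.vertexList c.1

lemma toListChain_single (H : Subgroup G) (n : ℕ) (c : MulAction.fixedPoints H (ψ.Cell n)) :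
    ψ.toListChain H n (Finsupp.single c 1) = of (ψ.vertexList c.1) :=
  Finsupp.mapDomain_single

lemma toListChain_injective (H : Subgroup G) (n : ℕ) : Function.Injective (ψ.toListChain H n) :=
  Finsupp.mapDomain_injective fun _ _ h => Subtype.ext (ψ.vertexList_injective h)

lemma range_toListChain (H : Subgroup G) (n : ℕ) :
    LinearMap.range (ψ.toListChain H n) = supp (ψ.IsOrderedSimplex H n) := by
  apply le_antisymm
  · rintro _ ⟨x, rfl⟩
    induction x using Finsupp.induction_linear with
    | zero => simp
    | add x y hx hy => rw [map_add]; exact add_mem hx hy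
    | single c a =>
      rw [← mul_one a, ← smul_eq_mul, ← Finsupp.smul_single, map_smul, toListChain_single]
      exact Submodule.smul_mem _ _ (of_mem (ψ.isOrderedSimplex_iff.mpr ⟨c.1, c.2, rfl⟩))
  · intro x hx
    refine map_mem (f := LinearMap.id) (fun l hl => ?_) hx
    obtain ⟨c, hc, rfl⟩ := ψ.isOrderedSimplex_iff.mp hl
    exact ⟨Finsupp.single ⟨c, hc⟩ 1, ψ.toListChain_single H n ⟨c, hc⟩⟩

/-- The simplicial boundary of `X^H`. -/
def cellBdry (H : Subgroup G) (n : ℕ) :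
    (MulAction.fixedPoints H (ψ.Cell (n + 1)) →₀ ℤ) →ₗ[ℤ]
      (MulAction.fixedPoints H (ψ.Cell n) →₀ ℤ) :=
  ∑ i : Fin (n + 2), (-1 : ℤ) ^ (i : ℕ) •
    Finsupp.lmapDomain ℤ ℤ (mapFixedPoints (ψ.cellFace i) H)

lemma toListChain_cellBdry (H : Subgroup G) (n : ℕ)
    (x : MulAction.fixedPoints H (ψ.Cell (n + 1)) →₀ ℤ) :
    ψ.toListChain H n (ψ.cellBdry H n x) = bdry (ψ.toListChain H (n + 1) x) := by
  have : ψ.toListChain H n ∘ₗ ψ.cellBdry H n = bdry ∘ₗ ψ.toListChain H (n + 1) := by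
    refine Finsupp.lhom_ext' fun c => LinearMap.ext_ring ?_
    simp only [LinearMap.comp_apply, Finsupp.lsingle_apply, toListChain_single]
    rw [vertexList, bdry_ofFn, cellBdry, LinearMap.sum_apply, map_sum]
    refine Finset.sum_congr rfl fun i _ => ?_
    rw [LinearMap.smul_apply, map_smul, Finsupp.lmapDomain_apply, Finsupp.mapDomain_single,
      toListChain_single]
    congr 2
    obtain ⟨c, hc⟩ := c
    obtain ⟨σ, g, rfl⟩ := ψ.exists_eq_mk c
    rfl
  exact LinearMap.congr_fun this x

/-- The empty list plays the role of the augmentation. -/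
lemma bdry_toListChain_zero (H : Subgroup G) (x : MulAction.fixedPoints H (ψ.Cell 0) →₀ ℤ) :
    bdry (ψ.toListChain H 0 x) = (x.sum fun _ a => a) • of [] := by
  induction x using Finsupp.induction_linear with
  | zero => simp
  | add x y hx hy => rw [map_add, map_add, hx, hy, Finsupp.sum_add_index' (by simp) (by simp), add_smul]
  | single c a =>
    have : (Finsupp.single c a : MulAction.fixedPoints H (ψ.Cell 0) →₀ ℤ) =
      a • Finsupp.single c 1 := by simp
    rw [this, map_smul, map_smul, toListChain_single, vertexList, bdry_ofFn, ← this,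
      Finsupp.sum_single_index rfl]
    simp

variable [Fintype Q]

/-- The filling by ordered chains is sorted and cut down to lists of `n + 2` vertices. Both
operations are compatible with the boundary, and both leave the given cycle, already sorted and
homogeneous, unchanged. -/
lemma exists_toListChain_eq {H : Subgroup G} (hX : ContractibleSpace (ψ.FixedSet H)) {n : ℕ}
    {x : MulAction.fixedPoints H (ψ.Cell n) →₀ ℤ} (hx : bdry (ψ.toListChain H n x) = 0) :
    ∃ w, ψ.cellBdry H n w = x := by
  let _ := ψ.vertexLinearOrder
  have hz : ψ.toListChain H n x ∈ supp (ψ.IsOrderedSimplex H n) :=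
    ψ.range_toListChain H n ▸ ⟨x, rfl⟩
  obtain ⟨w, hw, e⟩ := ψ.exists_bdry_eq hX (supp_mono (fun l hl => hl.1) hz) hx
  have hw' : lengthPart (n + 2) (sort w) ∈ supp (ψ.IsOrderedSimplex H (n + 1)) := by
    refine supp_mono (fun l hl => ⟨hl.1.1, hl.1.2, hl.2⟩)
      (lengthPart_mem (p := fun l => ψ.IsSimplexList H l ∧ l.Pairwise (· < ·)) ?_)
    exact map_mem (fun l hl => supp_mono (fun l' h => ⟨IsSimplexSet.mono hl h.2, h.1⟩)
      (sort_of_mem l)) hw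
  rw [← range_toListChain] at hw'
  obtain ⟨w', hw'⟩ := hw'
  refine ⟨w', ψ.toListChain_injective H n ?_⟩
  rw [toListChain_cellBdry, hw', bdry_lengthPart, bdry_sort, e,
    map_congr_of_mem (f := sort) (g := LinearMap.id) (fun l hl => sort_of_pairwise hl.2.1) hz]
  exact lengthPart_of_mem (supp_mono (fun l hl => hl.2.2) hz)

lemma cellBdry_exact {H : Subgroup G} (hX : ContractibleSpace (ψ.FixedSet H)) {n : ℕ}
    {x : MulAction.fixedPoints H (ψ.Cell (n + 1)) →₀ ℤ} (hx : ψ.cellBdry H n x = 0) :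
    ∃ w, ψ.cellBdry H (n + 1) w = x :=
  ψ.exists_toListChain_eq hX (by rw [← toListChain_cellBdry, hx, map_zero])

lemma cellBdry_exact_zero {H : Subgroup G} (hX : ContractibleSpace (ψ.FixedSet H))
    {x : MulAction.fixedPoints H (ψ.Cell 0) →₀ ℤ} (hx : (x.sum fun _ a => a) = 0) :
    ∃ w, ψ.cellBdry H 0 w = x :=
  ψ.exists_toListChain_eq hX (by rw [bdry_toListChain_zero, hx, zero_smul])

lemma nonempty_fixedPoints_cell_zero {H : Subgroup G} (hX : ContractibleSpace (ψ.FixedSet H)) :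
    Nonempty (MulAction.fixedPoints H (ψ.Cell 0)) := by
  obtain ⟨y, hy⟩ : Nonempty (ψ.FixedSet H) := inferInstance
  obtain ⟨g, x, rfl⟩ := ψ.exists_eq_point y
  let σ : PosetSimplex Q 0 := OrderEmbedding.ofStrictMono (fun _ => x.top)
    fun i j hij => absurd hij (by omega)
  refine ⟨⟨⟨σ, (g : G ⧸ ψ.localSubgroup (σ 0))⟩, ψ.mk_mem_fixedPoints.mpr ?_⟩⟩
  exact ψ.point_mem_fixedPoints.mp hy _ x.top_pos.ne'

end SimpleMorphism

end

noncomputable section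

/-! ## Bredon cochains and the cellular projective resolution -/

section Orbits

variable {G : Type u} [Group G] {F : Set (Subgroup G)}

/-- The projection `G/L → G/S` for `L ≤ S`. -/
def orbitProj {L S : OrbitCat F} (h : L.subgroup ≤ S.subgroup) : L ⟶ S where
  toFun := Subgroup.quotientMapOfLE h
  map_smul' g c := by
    induction c using QuotientGroup.induction_on with
    | H x => rfl

lemma orbit_hom_ext {L S : OrbitCat F} {θ η : L ⟶ S}
    (h : θ.toFun ((1 : G) : G ⧸ L.subgroup) = η.toFun ((1 : G) : G ⧸ L.subgroup)) : θ = η := by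
  refine MulActionHom.ext fun c => ?_
  induction c using QuotientGroup.induction_on with
  | H x =>
    have e : ((x : G) : G ⧸ L.subgroup) = x • ((1 : G) : G ⧸ L.subgroup) := by
      rw [MulAction.Quotient.smul_coe, smul_eq_mul, mul_one]
    rw [e, map_smul, map_smul]
    exact congrArg (x • ·) h

lemma orbitProj_refl (L : OrbitCat F) : orbitProj (le_refl L.subgroup) = 𝟙 L :=
  orbit_hom_ext rfl

lemma orbitProj_comp {L S T : OrbitCat F} (h : L.subgroup ≤ S.subgroup)
    (h' : S.subgroup ≤ T.subgroup) : orbitProj h ≫ orbitProj h' = orbitProj (h.trans h') :=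
  orbit_hom_ext rfl

lemma linearCombination_single_one {R α N : Type*} [Semiring R] [AddCommMonoid N] [Module R N]
    (f : α → N) (a : α) : Finsupp.linearCombination R f (Finsupp.single a 1) = f a := by simp

/-- The sum of the coefficients of a chain. -/
def coeffSum (α : Type*) : (α →₀ ℤ) →ₗ[ℤ] ULift.{u} ℤ :=
  ULift.moduleEquiv.symm.toLinearMap ∘ₗ Finsupp.linearCombination ℤ fun _ => (1 : ℤ)

lemma coeffSum_apply {α : Type*} (x : α →₀ ℤ) : coeffSum.{u} α x = ULift.up (x.sum fun _ a => a) := by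
  simp [coeffSum, Finsupp.linearCombination_apply]

lemma coeffSum_single_one {α : Type*} (c : α) : coeffSum.{u} α (Finsupp.single c 1) = ULift.up 1 := by
  rw [coeffSum_apply, Finsupp.sum_single_index rfl]

end Orbits

namespace SimpleMorphism

variable {Q : Type u} [PartialOrder Q] {GQ : SimpleComplexOfGroups.{v, u} Q}
  {G : Type u} [Group G] (ψ : SimpleMorphism GQ G)

lemma localSubgroup_mem_family (J : Q) : ψ.localSubgroup J ∈ ψ.family :=
  fun _ _ h => h ⟨J, rfl⟩

/-- The orbit `G/P_J`. -/
abbrev orbit (J : Q) : OrbitCat ψ.family := ⟨ψ.localSubgroup J, ψ.localSubgroup_mem_family J⟩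

/-- The simplex `σ` of the fundamental domain, as a simplex of `X^P` with `P` its stabiliser. -/
def baseCell {n : ℕ} (σ : PosetSimplex Q n) :
    MulAction.fixedPoints (ψ.localSubgroup (σ 0)) (ψ.Cell n) :=
  ⟨⟨σ, ((1 : G) : G ⧸ ψ.localSubgroup (σ 0))⟩, ψ.mk_mem_fixedPoints.mpr
    (ψ.vertexOf_mem_fixedPoints.mpr fun h hh => by simpa using inv_mem hh)⟩

/-- The orbit map onto the orbit of a simplex of `X^H`. -/
def cellMap {n : ℕ} {L : OrbitCat ψ.family} (c : MulAction.fixedPoints L.subgroup (ψ.Cell n)) :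
    L ⟶ ψ.orbit (c.1.1 0) :=
  orbitMap (S := G ⧸ ψ.localSubgroup (c.1.1 0))
    ⟨c.1.2, fun h => eq_of_heq (Sigma.mk.inj (c.2 h)).2⟩

lemma cellMap_one {n : ℕ} {L : OrbitCat ψ.family}
    (c : MulAction.fixedPoints L.subgroup (ψ.Cell n)) :
    (ψ.cellMap c).toFun ((1 : G) : G ⧸ L.subgroup) = c.1.2 := one_smul G c.1.2

lemma fixedPointsMap_cellMap {n : ℕ} {L : OrbitCat ψ.family}
    (c : MulAction.fixedPoints L.subgroup (ψ.Cell n)) :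
    fixedPointsMap (ψ.cellMap c) (ψ.baseCell c.1.1) = c := by
  obtain ⟨c, hc⟩ := c
  obtain ⟨σ, g, rfl⟩ := ψ.exists_eq_mk c
  apply Subtype.ext
  change orbitMap _ ((ψ.cellMap _).toFun ((1 : G) : G ⧸ L.subgroup)) = _
  rw [cellMap_one]
  change g • (⟨σ, ((1 : G) : G ⧸ ψ.localSubgroup (σ 0))⟩ : ψ.Cell n) = _
  refine congrArg (Sigma.mk σ) ?_
  change ((g * 1 : G) : G ⧸ ψ.localSubgroup (σ 0)) = _
  rw [mul_one]

lemma coe_fixedPointsMap {n : ℕ} {L S : OrbitCat ψ.family} (θ : L ⟶ S)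
    (c : MulAction.fixedPoints S.subgroup (ψ.Cell n)) :
    (fixedPointsMap θ c).1 =
      (⟨c.1.1, (θ ≫ ψ.cellMap c).toFun ((1 : G) : G ⧸ L.subgroup)⟩ : ψ.Cell n) := by
  obtain ⟨x, hx⟩ := QuotientGroup.mk_surjective (θ.toFun ((1 : G) : G ⧸ L.subgroup))
  change orbitMap _ (θ.toFun ((1 : G) : G ⧸ L.subgroup)) =
    (⟨c.1.1, (ψ.cellMap c).toFun (θ.toFun ((1 : G) : G ⧸ L.subgroup))⟩ : ψ.Cell n)
  rw [← hx]
  rfl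

variable (M : OrbitModule ψ.family)

lemma map_cellMap {n : ℕ} {L : OrbitCat ψ.family}
    (f : ∀ σ : PosetSimplex Q n, M.obj (.op (ψ.orbit (σ 0))))
    (c : MulAction.fixedPoints L.subgroup (ψ.Cell n)) (σ : PosetSimplex Q n)
    (η : L ⟶ ψ.orbit (σ 0)) (h : c.1 = ⟨σ, η.toFun ((1 : G) : G ⧸ L.subgroup)⟩) :
    M.map (ψ.cellMap c).op (f c.1.1) = M.map η.op (f σ) := by
  obtain ⟨⟨σ', γ⟩, hc⟩ := c
  obtain ⟨rfl, h⟩ := Sigma.mk.inj h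
  have : ψ.cellMap ⟨⟨σ', γ⟩, hc⟩ = η := orbit_hom_ext ((ψ.cellMap_one _).trans (eq_of_heq h))
  rw [← this]

/-- The values of a cochain on the simplices of the fundamental domain. -/
def cochainEval (n : ℕ) : (fixedPointsModule ψ.family (ψ.Cell n) ⟶ M) →ₗ[ℤ]
    ∀ σ : PosetSimplex Q n, M.obj (.op (ψ.orbit (σ 0))) where
  toFun φ σ := φ.app (.op (ψ.orbit (σ 0))) (Finsupp.single (ψ.baseCell σ) 1)
  map_add' _ _ := rfl
  map_smul' _ _ := rfl

/-- Yoneda: every simplex of `X^L` is pulled back from the fundamental domain along an orbit map, so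
naturality determines `φ` from its values there. -/
lemma app_single {n : ℕ} (φ : fixedPointsModule ψ.family (ψ.Cell n) ⟶ M) (L : OrbitCat ψ.family)
    (c : MulAction.fixedPoints L.subgroup (ψ.Cell n)) :
    φ.app (.op L) (Finsupp.single c (1 : ℤ)) =
      M.map (ψ.cellMap c).op (ψ.cochainEval M n φ c.1.1) := by
  have h := LinearMap.congr_fun (congrArg ModuleCat.Hom.hom (φ.naturality (ψ.cellMap c).op))
    (Finsupp.single (ψ.baseCell c.1.1) (1 : ℤ))
  refine Eq.trans (congrArg (φ.app (.op L)) ?_) h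
  refine Eq.trans ?_ Finsupp.mapDomain_single.symm
  exact congrArg (Finsupp.single · 1) (ψ.fixedPointsMap_cellMap c).symm

lemma cochainEval_injective (n : ℕ) : Function.Injective (ψ.cochainEval M n) := by
  intro φ φ' h
  ext L : 3
  refine Finsupp.lhom_ext' fun c => LinearMap.ext_ring ?_
  exact (ψ.app_single M φ L.unop c).trans (h ▸ (ψ.app_single M φ' L.unop c).symm)

/-- Prescribed values are transported along `cellMap`; naturality holds because a `G`-map out of
`G/L` is determined by the image of the base coset. -/
lemma cochainEval_surjective (n : ℕ) : Function.Surjective (ψ.cochainEval M n) := by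
  intro f
  let φ : fixedPointsModule ψ.family (ψ.Cell n) ⟶ M :=
    { app := fun L => ModuleCat.ofHom (Finsupp.linearCombination ℤ
        fun c : MulAction.fixedPoints L.unop.subgroup (ψ.Cell n) =>
          M.map (ψ.cellMap c).op (f c.1.1))
      naturality := fun L S θ => by
        ext : 1
        refine Finsupp.lhom_ext' fun c => LinearMap.ext_ring ?_
        change Finsupp.linearCombination ℤ _ (Finsupp.mapDomain _ (Finsupp.single c (1 : ℤ))) =
          M.map θ (Finsupp.linearCombination ℤ _ (Finsupp.single c (1 : ℤ)))
        rw [Finsupp.mapDomain_single]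
        refine (linearCombination_single_one _ _).trans (Eq.trans ?_
          (congrArg (M.map θ) (linearCombination_single_one _ _)).symm)
        have h1 : M.map θ (M.map (ψ.cellMap c).op (f c.1.1)) =
            M.map (θ.unop ≫ ψ.cellMap c).op (f c.1.1) := by
          rw [op_comp, M.map_comp]
          rfl
        rw [h1]
        exact ψ.map_cellMap M f _ _ _ (ψ.coe_fixedPointsMap θ.unop c) }
  refine ⟨φ, funext fun σ => ?_⟩
  refine (linearCombination_single_one _ _).trans ?_
  refine (ψ.map_cellMap M f (L := ψ.orbit (σ 0)) (ψ.baseCell σ) σ (𝟙 _) rfl).trans ?_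
  rw [op_id, M.map_id]
  rfl

/-- The structure map of `M` along the projection `G/P_J → G/P_T`, for `P_J ≤ P_T`. -/
def res {J T : Q} (h : ψ.localSubgroup J ≤ ψ.localSubgroup T) :
    M.obj (.op (ψ.orbit T)) →ₗ[ℤ] M.obj (.op (ψ.orbit J)) :=
  (M.map (orbitProj (L := ψ.orbit J) (S := ψ.orbit T) h).op).hom

lemma res_refl {J : Q} (h : ψ.localSubgroup J ≤ ψ.localSubgroup J) (a) : ψ.res M h a = a := by
  have : M.map (orbitProj (L := ψ.orbit J) (S := ψ.orbit J) h).op = 𝟙 _ := by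
    rw [← M.map_id]
    exact congrArg (fun η => M.map (Quiver.Hom.op η)) (orbitProj_refl _)
  exact LinearMap.congr_fun (congrArg ModuleCat.Hom.hom this) a

lemma res_res {J T U : Q} (h : ψ.localSubgroup J ≤ ψ.localSubgroup T)
    (h' : ψ.localSubgroup T ≤ ψ.localSubgroup U) (a) :
    ψ.res M h (ψ.res M h' a) = ψ.res M (h.trans h') a := by
  have : M.map (orbitProj (L := ψ.orbit T) (S := ψ.orbit U) h').op ≫
      M.map (orbitProj (L := ψ.orbit J) (S := ψ.orbit T) h).op =
        M.map (orbitProj (L := ψ.orbit J) (S := ψ.orbit U) (h.trans h')).op := by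
    rw [← M.map_comp, ← op_comp, orbitProj_comp]
  exact LinearMap.congr_fun (congrArg ModuleCat.Hom.hom this) a

/-- The boundary map of the Bredon chain complex. -/
def chainBdry (n : ℕ) :
    fixedPointsModule ψ.family (ψ.Cell (n + 1)) ⟶ fixedPointsModule ψ.family (ψ.Cell n) :=
  ∑ i : Fin (n + 2), (-1 : ℤ) ^ (i : ℕ) • fixedPointsModuleMap ψ.family (ψ.cellFace i)

lemma chainBdry_app (n : ℕ) (L : OrbitCat ψ.family) :
    ((ψ.chainBdry n).app (.op L)).hom = ψ.cellBdry L.subgroup n := by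
  rw [chainBdry, NatTrans.app_sum, ModuleCat.hom_sum]
  rfl

lemma cellBdry_single (H : Subgroup G) (n : ℕ) (c : MulAction.fixedPoints H (ψ.Cell (n + 1))) :
    ψ.cellBdry H n (Finsupp.single c 1) = ∑ i : Fin (n + 2), (-1 : ℤ) ^ (i : ℕ) •
      Finsupp.single (mapFixedPoints (ψ.cellFace i) H c) 1 := by
  rw [cellBdry, LinearMap.sum_apply]
  refine Finset.sum_congr rfl fun i _ => ?_
  rw [LinearMap.smul_apply, Finsupp.lmapDomain_apply, Finsupp.mapDomain_single]

lemma face_zero_le {n : ℕ} (i : Fin (n + 2)) (τ : PosetSimplex Q (n + 1)) :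
    τ 0 ≤ PosetSimplex.face i τ 0 := τ.monotone (Fin.zero_le (i.succAbove 0))

lemma cochainEval_chainBdry (n : ℕ) (φ : fixedPointsModule ψ.family (ψ.Cell n) ⟶ M)
    (τ : PosetSimplex Q (n + 1)) : ψ.cochainEval M (n + 1) (ψ.chainBdry n ≫ φ) τ =
      ∑ i : Fin (n + 2), (-1 : ℤ) ^ (i : ℕ) • ψ.res M (ψ.localSubgroup_mono (face_zero_le i τ))
        (ψ.cochainEval M n φ (PosetSimplex.face i τ)) := by
  let A : (MulAction.fixedPoints (ψ.localSubgroup (τ 0)) (ψ.Cell n) →₀ ℤ) →+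
      M.obj (.op (ψ.orbit (τ 0))) := (φ.app (.op (ψ.orbit (τ 0)))).hom.toAddMonoidHom
  have h : ψ.cochainEval M (n + 1) (ψ.chainBdry n ≫ φ) τ =
      A (ψ.cellBdry (ψ.localSubgroup (τ 0)) n (Finsupp.single (ψ.baseCell τ) 1)) :=
    congrArg (fun f => A (f (Finsupp.single (ψ.baseCell τ) 1)))
      (ψ.chainBdry_app n (ψ.orbit (τ 0)))
  rw [h, cellBdry_single, map_sum]
  refine Finset.sum_congr rfl fun i _ => ?_
  rw [map_zsmul]
  congr 1
  refine (ψ.app_single M φ (ψ.orbit (τ 0)) _).trans ?_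
  exact ψ.map_cellMap M _ _ _ (orbitProj _) rfl

/-- Maps out of this module are a product of evaluations of the target, and epimorphisms of `O_F
G`-modules are surjective at every orbit. -/
instance (n : ℕ) : Projective (fixedPointsModule ψ.family (ψ.Cell n)) where
  factors {A B} f e he := by
    have hs : ∀ L, Function.Surjective (e.app L) := fun L =>
      (ModuleCat.epi_iff_surjective _).mp ((NatTrans.epi_iff_epi_app e).mp he L)
    choose a ha using fun σ : PosetSimplex Q n => hs (.op (ψ.orbit (σ 0))) (ψ.cochainEval B n f σ)
    obtain ⟨φ, hφ⟩ := ψ.cochainEval_surjective A n a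
    refine ⟨φ, ψ.cochainEval_injective B n (funext fun σ => ?_)⟩
    rw [← ha σ, ← hφ]
    rfl

/-- The augmentation of the Bredon chain complex. -/
def augmentation : fixedPointsModule ψ.family (ψ.Cell 0) ⟶ constantModule ψ.family where
  app L := ModuleCat.ofHom (coeffSum _)
  naturality L S θ := by
    ext : 1
    refine Finsupp.lhom_ext' fun c => LinearMap.ext_ring ?_
    change coeffSum _ (Finsupp.mapDomain _ (Finsupp.single c (1 : ℤ))) =
      coeffSum _ (Finsupp.single c (1 : ℤ))
    rw [Finsupp.mapDomain_single, coeffSum_single_one, coeffSum_single_one]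

lemma bredonChainComplex_d (n : ℕ) :
    (ψ.bredonChainComplex ψ.family).d (n + 1) n = ψ.chainBdry n := by
  exact ChainComplex.of_d (fun n => fixedPointsModule ψ.family (ψ.Cell n)) ψ.chainBdry n

lemma chainBdry_augmentation : ψ.chainBdry 0 ≫ ψ.augmentation = 0 := by
  ext L : 3
  refine Finsupp.lhom_ext' fun c => LinearMap.ext_ring ?_
  have h : ((ψ.chainBdry 0).app L).hom (Finsupp.single c 1) =
      ψ.cellBdry L.unop.subgroup 0 (Finsupp.single c 1) :=
    LinearMap.congr_fun (ψ.chainBdry_app 0 L.unop) _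
  refine (congrArg (coeffSum _) h).trans ?_
  rw [cellBdry_single, Fin.sum_univ_two, map_add, map_smul, map_smul, coeffSum_single_one,
    coeffSum_single_one]
  simp
  rfl

/-- The augmentation as a map of complexes. -/
def resolutionMap : ψ.bredonChainComplex ψ.family ⟶
    (ChainComplex.single₀ (OrbitModule ψ.family)).obj (constantModule ψ.family) :=
  (ChainComplex.toSingle₀Equiv _ _).symm ⟨ψ.augmentation, by
    rw [bredonChainComplex_d]
    exact ψ.chainBdry_augmentation⟩

lemma resolutionMap_f_zero : ψ.resolutionMap.f 0 = ψ.augmentation :=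
  ChainComplex.toSingle₀Equiv_symm_apply_f_zero _ _

variable [Fintype Q]

/-- If the fixed-point sets are contractible, the cellular chain complex is a resolution. -/
lemma quasiIso_resolutionMap (hX : ∀ H ∈ ψ.family, ContractibleSpace (ψ.FixedSet H)) :
    QuasiIso ψ.resolutionMap := by
  rw [quasiIso_iff]
  intro i
  rw [HomologicalComplex.quasiIsoAt_iff_evaluation]
  rintro ⟨L⟩
  have hL := hX L.subgroup L.mem
  -- At the orbit `G/L` the complex is that of `X^L`. Degree `0` needs exactness at the augmentation
  -- and its surjectivity; in higher degrees the target is zero and acyclicity suffices.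
  obtain _ | n := i
  · have hd : ∀ y : MulAction.fixedPoints L.subgroup (ψ.Cell 1) →₀ ℤ,
        ((((evaluation _ _).obj (.op L)).mapHomologicalComplex _).obj
          (ψ.bredonChainComplex ψ.family)).d 1 0 y = ψ.cellBdry L.subgroup 0 y := fun y => by
      have := congrArg (fun f => (f.app (.op L)).hom y) (ψ.bredonChainComplex_d 0)
      exact this.trans (LinearMap.congr_fun (ψ.chainBdry_app 0 L) y)
    have ha : ∀ y : MulAction.fixedPoints L.subgroup (ψ.Cell 0) →₀ ℤ,
        ((((evaluation _ _).obj (.op L)).mapHomologicalComplex _).map ψ.resolutionMap).f 0 y =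
          coeffSum _ y := fun y =>
      congrArg (fun f : fixedPointsModule ψ.family (ψ.Cell 0) ⟶ constantModule ψ.family =>
        (f.app (.op L)).hom y) ψ.resolutionMap_f_zero
    have h0 : ∀ K : ChainComplex (ModuleCat.{u} ℤ) ℕ,
        ((HomologicalComplex.shortComplexFunctor' _ _ 1 0 0).obj K).g = 0 := fun K =>
      K.shape 0 0 (by simp)
    rw [quasiIsoAt_iff' _ 1 0 0 (by simp) (by simp), ShortComplex.quasiIso_iff_of_zeros']
    · refine ⟨?_, ?_⟩
      · rw [ShortComplex.moduleCat_exact_iff]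
        intro x hx
        have hx' : coeffSum _ (show MulAction.fixedPoints L.subgroup (ψ.Cell 0) →₀ ℤ from x) = 0 :=
          (ha _).symm.trans hx
        rw [coeffSum_apply] at hx'
        obtain ⟨w, hw⟩ := ψ.cellBdry_exact_zero hL (congrArg ULift.down hx')
        exact ⟨w, (hd w).trans hw⟩
      · rw [ModuleCat.epi_iff_surjective]
        obtain ⟨c⟩ := ψ.nonempty_fixedPoints_cell_zero hL
        rintro ⟨a⟩
        refine ⟨(Finsupp.single c a : MulAction.fixedPoints L.subgroup (ψ.Cell 0) →₀ ℤ),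
          (ha _).trans ?_⟩
        rw [coeffSum_apply, Finsupp.sum_single_index rfl]
    · exact h0 _
    · exact congrArg (fun f => f.app (.op L))
        (HomologicalComplex.single_obj_d (ComplexShape.down ℕ) 0 (constantModule ψ.family) 1 0)
    · exact h0 _
  · have hd : ∀ m, ∀ y : MulAction.fixedPoints L.subgroup (ψ.Cell (m + 1)) →₀ ℤ,
        ((((evaluation _ _).obj (.op L)).mapHomologicalComplex _).obj
          (ψ.bredonChainComplex ψ.family)).d (m + 1) m y = ψ.cellBdry L.subgroup m y := fun m y => by
      have := congrArg (fun f => (f.app (.op L)).hom y) (ψ.bredonChainComplex_d m)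
      exact this.trans (LinearMap.congr_fun (ψ.chainBdry_app m L) y)
    rw [quasiIsoAt_iff_exactAt']
    · rw [HomologicalComplex.exactAt_iff' _ (n + 2) (n + 1) n (by simp) (by simp),
        ShortComplex.moduleCat_exact_iff]
      intro x hx
      obtain ⟨w, hw⟩ := ψ.cellBdry_exact hL ((hd n _).symm.trans hx)
      exact ⟨w, (hd (n + 1) w).trans hw⟩
    · refine ShortComplex.exact_of_isZero_X₂ _ ?_
      exact ((evaluation (OrbitCat ψ.family)ᵒᵖ (ModuleCat ℤ)).obj (Opposite.op L)).map_isZero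
        (HomologicalComplex.isZero_single_obj_X (ComplexShape.down ℕ) 0 _ _ (by simp))

end SimpleMorphism

end

noncomputable section

/-! ## Homology of a direct sum of complexes -/

section DirectSumHomology

open Classical

/-- A family of linear maps that is finitely supported at each vector, as a map into the direct
sum. -/
def DirectSum.ofFinite {R ι M : Type*} {N : ι → Type*} [Ring R] [AddCommGroup M]
    [∀ i, AddCommGroup (N i)] [Module R M] [∀ i, Module R (N i)] (φ : ∀ i, M →ₗ[R] N i) (h : ∀ x, {i | φ i x ≠ 0}.Finite) :
    M →ₗ[R] ⨁ i, N i :=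
  have key : ∀ x i, DirectSum.mk N (h x).toFinset (fun i => φ i x) i = φ i x := fun x i => by
    by_cases hi : i ∈ (h x).toFinset
    · rw [DirectSum.mk_apply_of_mem hi]
    · rw [DirectSum.mk_apply_of_notMem hi]
      simpa [eq_comm] using hi
  { toFun := fun x => DirectSum.mk N (h x).toFinset fun i => φ i x
    map_add' := fun x y => DFinsupp.ext fun i => by
      rw [DFinsupp.add_apply]
      exact (key _ i).trans ((map_add _ x y).trans (congrArg₂ _ (key x i) (key y i)).symm)
    map_smul' := fun c x => DFinsupp.ext fun i => by
      rw [DirectSum.smul_apply]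
      exact (key _ i).trans ((map_smul _ c x).trans (congrArg _ (key x i)).symm) }

lemma DirectSum.ofFinite_apply {R ι M : Type*} {N : ι → Type*} [Ring R] [AddCommGroup M]
    [∀ i, AddCommGroup (N i)] [Module R M] [∀ i, Module R (N i)] (φ : ∀ i, M →ₗ[R] N i)
    (h : ∀ x, {i | φ i x ≠ 0}.Finite) (x : M) (i : ι) : DirectSum.ofFinite φ h x i = φ i x := by
  change DirectSum.mk N (h x).toFinset (fun i => φ i x) i = φ i x
  by_cases hi : i ∈ (h x).toFinset
  · rw [DirectSum.mk_apply_of_mem hi]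
  · rw [DirectSum.mk_apply_of_notMem hi]
    simpa [eq_comm] using hi

/-- Homology commutes with direct sums: it suffices that a family of morphisms of short complexes
exhibits the terms of `S` as direct sums. -/
lemma homology_equiv_directSum {R : Type*} [Ring R] {ι : Type*} (S : ShortComplex (ModuleCat.{u} R))
    (T : ι → ShortComplex (ModuleCat.{u} R)) (c : ∀ i, S ⟶ T i)
    (h₁ : ∀ y : ∀ i, (T i).X₁, {i | y i ≠ 0}.Finite → ∃ x, ∀ i, (c i).τ₁ x = y i)
    (h₂ : ∀ y : ∀ i, (T i).X₂, {i | y i ≠ 0}.Finite → ∃ x, ∀ i, (c i).τ₂ x = y i)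
    (h₂' : ∀ x, {i | (c i).τ₂ x ≠ 0}.Finite)
    (h₂'' : ∀ x, (∀ i, (c i).τ₂ x = 0) → x = 0)
    (h₃ : ∀ x, (∀ i, (c i).τ₃ x = 0) → x = 0) :
    Nonempty (S.homology ≃+ ⨁ i, (T i).homology) := by
  have c₁₂ : ∀ i x, (c i).τ₂ (S.f x) = (T i).f ((c i).τ₁ x) := fun i x =>
    (LinearMap.congr_fun (congrArg ModuleCat.Hom.hom (c i).comm₁₂) x).symm
  have c₂₃ : ∀ i x, (c i).τ₃ (S.g x) = (T i).g ((c i).τ₂ x) := fun i x =>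
    (LinearMap.congr_fun (congrArg ModuleCat.Hom.hom (c i).comm₂₃) x).symm
  let e : ∀ i, (T i).homology ≃ₗ[R] (LinearMap.ker (T i).g.hom ⧸
      LinearMap.range (T i).moduleCatToCycles) := fun i => (T i).moduleCatHomologyIso.toLinearEquiv
  let κ : ∀ i, LinearMap.ker S.g.hom →ₗ[R] LinearMap.ker (T i).g.hom := fun i =>
    (c i).τ₂.hom.restrict fun x hx => by
      rw [LinearMap.mem_ker] at hx ⊢
      exact (c₂₃ i x).symm.trans ((congrArg _ hx).trans (map_zero _))
  let φ : ∀ i, LinearMap.ker S.g.hom →ₗ[R] (T i).homology := fun i =>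
    (e i).symm.toLinearMap ∘ₗ (LinearMap.range (T i).moduleCatToCycles).mkQ ∘ₗ κ i
  have hφ0 : ∀ i x, φ i x = 0 ↔ ∃ y, (T i).f y = (c i).τ₂ x.1 := by
    intro i x
    simp only [φ, LinearMap.comp_apply, LinearEquiv.coe_coe, LinearEquiv.map_eq_zero_iff,
      Submodule.mkQ_apply, Submodule.Quotient.mk_eq_zero]
    exact ⟨fun ⟨y, hy⟩ => ⟨y, congrArg Subtype.val hy⟩, fun ⟨y, hy⟩ => ⟨y, Subtype.ext hy⟩⟩
  have hfin : ∀ x, {i | φ i x ≠ 0}.Finite := fun x => (h₂' x.1).subset fun i hi h0 =>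
    hi ((hφ0 i x).mpr ⟨0, by rw [map_zero, h0]⟩)
  let Φ := DirectSum.ofFinite φ hfin
  have hker : LinearMap.range S.moduleCatToCycles = LinearMap.ker Φ := by
    ext x
    have hx : x ∈ LinearMap.ker Φ ↔ ∀ i, φ i x = 0 := by
      rw [LinearMap.mem_ker, DFinsupp.ext_iff]
      exact forall_congr' fun i => by
        rw [show Φ x i = φ i x from DirectSum.ofFinite_apply φ hfin x i]
        rfl
    rw [hx]
    constructor
    · rintro ⟨y, rfl⟩ i
      exact (hφ0 i _).mpr ⟨(c i).τ₁ y, (c₁₂ i y).symm⟩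
    · intro h
      choose y hy using fun i => (hφ0 i x).mp (h i)
      -- Preimages are replaced by zero wherever the component of `x` already vanishes, so that the
      -- family becomes finitely supported and `h₁` applies.
      obtain ⟨w, hw⟩ := h₁ (fun i => if (c i).τ₂ x.1 = 0 then 0 else y i)
        ((h₂' x.1).subset fun i hi h0 => hi (if_pos h0))
      refine ⟨w, Subtype.ext ?_⟩
      refine sub_eq_zero.mp (h₂'' _ fun i => ?_)
      rw [map_sub, sub_eq_zero]
      refine (c₁₂ i w).trans ?_
      rw [hw i]
      split_ifs with h0
      · rw [map_zero, h0]
      · exact hy i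
  have hsurj : Function.Surjective Φ := by
    intro t
    choose z hz using fun i => (Submodule.mkQ_surjective (LinearMap.range (T i).moduleCatToCycles)).comp
      Function.surjective_id (e i (t i))
    obtain ⟨w, hw⟩ := h₂ (fun i => if t i = 0 then 0 else (z i).1) ((DFinsupp.finite_support t).subset
      fun i hi h0 => hi (if_pos h0))
    have hw0 : w ∈ LinearMap.ker S.g.hom := h₃ _ fun i => by
      refine (c₂₃ i w).trans ?_
      rw [hw i]
      split_ifs
      · exact map_zero _
      · exact (z i).2
    refine ⟨⟨w, hw0⟩, DFinsupp.ext fun i => (DirectSum.ofFinite_apply φ hfin _ i).trans ?_⟩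
    by_cases h0 : t i = 0
    · rw [h0, hφ0]
      exact ⟨0, by rw [map_zero, hw i, if_pos h0]⟩
    · have : κ i ⟨w, hw0⟩ = z i := Subtype.ext ((hw i).trans (if_neg h0))
      change (e i).symm (Submodule.mkQ _ (κ i ⟨w, hw0⟩)) = t i
      rw [this, LinearEquiv.symm_apply_eq]
      exact hz i
  exact ⟨LinearEquiv.toAddEquiv <| (S.moduleCatHomologyIso.toLinearEquiv.trans (Submodule.quotEquivOfEq _ _ hker)).trans
    (LinearMap.quotKerEquivOfSurjective Φ hsurj)⟩

end DirectSumHomology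

end

noncomputable section

/-! ## Cohomology with coefficients in `B_S` -/

namespace SimpleMorphism

open Classical

variable {Q : Type u} [PartialOrder Q] {GQ : SimpleComplexOfGroups.{v, u} Q}
  {G : Type u} [Group G] (ψ : SimpleMorphism GQ G)

/-! ### Blocks -/

/-- This moves the block relation into `G`. Injectivity of `ψ.hom T` is what recovers surjectivity
of the structure map from equality of images. -/
lemma bijective_map_iff (hψ : ∀ J : Q, Function.Injective (ψ.hom J)) {J T : Q} (h : J ≤ T) :
    Function.Bijective (GQ.map h) ↔ ψ.localSubgroup J = ψ.localSubgroup T := by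
  have hc : ∀ p, ψ.hom T (GQ.map h p) = ψ.hom J p := fun p =>
    DFunLike.congr_fun (ψ.hom_comp_map h) p
  constructor
  · intro hb
    refine le_antisymm (ψ.localSubgroup_mono h) ?_
    rintro _ ⟨p, rfl⟩
    obtain ⟨q, rfl⟩ := hb.2 p
    exact ⟨q, (hc q).symm⟩
  · intro e
    refine ⟨GQ.map_injective h, fun p => ?_⟩
    obtain ⟨q, hq⟩ : ψ.hom T p ∈ ψ.localSubgroup J := e ▸ ⟨p, rfl⟩
    exact ⟨q, hψ T ((hc q).trans hq)⟩

lemma localSubgroup_eq_of_mem_block (hψ : ∀ J : Q, Function.Injective (ψ.hom J)) {C : Set Q}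
    (hC : GQ.IsBlock C) {U V : Q} (hU : U ∈ C) (hV : V ∈ C) :
    ψ.localSubgroup U = ψ.localSubgroup V := by
  have h : GQ.blockSetoid U V := (Setoid.rel_iff_exists_classes _).mpr ⟨C, hC, hU, hV⟩
  have h' : Relation.EqvGen (fun J T => ∃ h : J ≤ T, Function.Bijective (GQ.map h)) U V := h
  clear h hU hV
  induction h' with
  | rel J T h =>
    obtain ⟨h, hb⟩ := h
    exact (ψ.bijective_map_iff hψ h).mp hb
  | refl J => rfl
  | symm J T h ih => exact ih.symm
  | trans J T V h h' ih ih' => exact ih.trans ih'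

/-- Comparability is essential: elements with the same local subgroup may lie in different blocks.
-/
lemma mem_block_of_le (hψ : ∀ J : Q, Function.Injective (ψ.hom J)) {C : Set Q}
    (hC : GQ.IsBlock C) {U V : Q} (hUV : U ≤ V) (e : ψ.localSubgroup U = ψ.localSubgroup V) :
    U ∈ C ↔ V ∈ C := by
  have h : GQ.blockSetoid U V :=
    Relation.EqvGen.rel _ _ ⟨hUV, (ψ.bijective_map_iff hψ hUV).mpr e⟩
  obtain ⟨y, rfl⟩ := hC
  exact ⟨fun hU => GQ.blockSetoid.trans' (GQ.blockSetoid.symm' h) hU,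
    fun hV => GQ.blockSetoid.trans' h hV⟩

lemma block_eq_of_mem {C C' : Set Q} (hC : GQ.IsBlock C) (hC' : GQ.IsBlock C') {U : Q}
    (hU : U ∈ C) (hU' : U ∈ C') : C = C' :=
  Setoid.eq_of_mem_classes hC hU hC' hU'

lemma exists_mem_block (U : Q) : ∃ C, GQ.IsBlock C ∧ U ∈ C :=
  ⟨_, Setoid.mem_classes _ U, GQ.blockSetoid.refl' U⟩

/-- A simplex of `K_C` lies in `K_{>C}` unless its first vertex lies in `C`. -/
lemma forall_mem_strictUpperSet_iff (hψ : ∀ J : Q, Function.Injective (ψ.hom J)) {C : Set Q}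
    (hC : GQ.IsBlock C) {n : ℕ} {σ : PosetSimplex Q n} (hσ : ∀ k, σ k ∈ ψ.upperSet C) :
    (∀ k, σ k ∈ ψ.strictUpperSet C) ↔ σ 0 ∉ C := by
  constructor
  · intro h h0
    obtain ⟨U, hU, -, hlt⟩ := h 0
    exact hlt.ne (ψ.localSubgroup_eq_of_mem_block hψ hC hU h0)
  · intro h0 k
    obtain ⟨U, hU, hle⟩ := hσ 0
    have h0k : σ 0 ≤ σ k := σ.monotone (Fin.zero_le k)
    refine ⟨U, hU, hle.trans h0k, lt_of_lt_of_le ?_ (ψ.localSubgroup_mono h0k)⟩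
    exact lt_of_le_of_ne (ψ.localSubgroup_mono hle)
      fun e => h0 ((ψ.mem_block_of_le hψ hC hle e).mp hU)

lemma mem_upperSet_of_mem {C : Set Q} {n : ℕ} {σ : PosetSimplex Q n} (h : σ 0 ∈ C) (k : Fin (n + 1)) :
    σ k ∈ ψ.upperSet C := ⟨σ 0, h, σ.monotone (Fin.zero_le k)⟩

/-! ### The coefficient module -/

variable {ψ} {J : Q}

lemma mem_conjIndex {g : G} {U : Q} :
    U ∈ ψ.conjIndex J g ↔ conjSubgroup g (ψ.localSubgroup U) = ψ.localSubgroup J := by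
  change ψ.localSubgroup U = _ ↔ _
  constructor
  · intro h
    rw [h, ← conjSubgroup_mul, mul_inv_cancel, conjSubgroup_one]
  · intro h
    rw [← h, ← conjSubgroup_mul, inv_mul_cancel, conjSubgroup_one]

/-- The `G`-map `G/P_U → G/P_J` that sends `P_U` to `g⁻¹ P_J`, if `P_U = g⁻¹ P_J g`. -/
def isomOf {g : G} {U : Q} (h : U ∈ ψ.conjIndex J g) :
    IsomMaps (ψ.localSubgroup U) (ψ.localSubgroup J) :=
  ⟨orbitMap (S := G ⧸ ψ.localSubgroup J) ⟨((g⁻¹ : G) : G ⧸ ψ.localSubgroup J), fun p => by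
      refine QuotientGroup.eq.mpr ?_
      rw [mem_conjIndex] at h
      rw [← h]
      have := (ψ.localSubgroup U).inv_mem p.2
      exact ⟨_, this, by simp [mul_assoc]⟩⟩,
    g⁻¹, one_smul _ _, by rw [inv_inv]; exact mem_conjIndex.mp h⟩

lemma isomOf_one {g : G} {U : Q} (h : U ∈ ψ.conjIndex J g) :
    (isomOf h).1 ((1 : G) : G ⧸ ψ.localSubgroup U) = ((g⁻¹ : G) : G ⧸ ψ.localSubgroup J) :=
  one_smul _ _

lemma mulActionHom_ext {U S : Subgroup G} {θ η : (G ⧸ U) →[G] (G ⧸ S)}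
    (h : θ ((1 : G) : G ⧸ U) = η ((1 : G) : G ⧸ U)) : θ = η := by
  refine MulActionHom.ext fun c => ?_
  induction c using QuotientGroup.induction_on with
  | H x =>
    have e : ((x : G) : G ⧸ U) = x • ((1 : G) : G ⧸ U) := by
      rw [MulAction.Quotient.smul_coe, smul_eq_mul, mul_one]
    rw [e, map_smul, map_smul, h]

lemma isomOf_eq_iff {g g' : G} {U : Q} (h : U ∈ ψ.conjIndex J g) (h' : U ∈ ψ.conjIndex J g') :
    isomOf h = isomOf h' ↔ g * g'⁻¹ ∈ ψ.localSubgroup J := by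
  have h1 : isomOf h = isomOf h' ↔
      ((g⁻¹ : G) : G ⧸ ψ.localSubgroup J) = ((g'⁻¹ : G) : G ⧸ ψ.localSubgroup J) := by
    rw [← isomOf_one h, ← isomOf_one h']
    exact ⟨fun e => by rw [e], fun e => Subtype.ext (mulActionHom_ext e)⟩
  rw [h1, QuotientGroup.eq, inv_inv]

lemma conjSubgroup_of_mem {P : Subgroup G} {p : G} (hp : p ∈ P) : conjSubgroup p P = P := by
  ext x
  rw [← inv_inv p, mem_conjSubgroup_inv, P.mul_mem_cancel_right (by simpa using hp),
    P.mul_mem_cancel_left (by simpa using hp)]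

/-- If the base coset goes to `x P_J`, then `x⁻¹` belongs to the set being represented, and its
representative `p x⁻¹` yields the same coset `x p⁻¹ P_J`. With `eq_of_isomOf_eq`, the basis of
`B_{P_J}(G/P_U)` is indexed by the `g ∈ I` with `U ∈ Ω_J^g`. -/
lemma IsRepresentatives.exists_isomOf {I : Set G} (hI : ψ.IsRepresentatives J I) {U : Q}
    (θ : IsomMaps (ψ.localSubgroup U) (ψ.localSubgroup J)) :
    ∃ g ∈ I, ∃ h : U ∈ ψ.conjIndex J g, isomOf h = θ := by
  obtain ⟨θ, x, hx, e⟩ := θ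
  have hU : U ∈ ψ.conjIndex J x⁻¹ := mem_conjIndex.mpr e
  obtain ⟨r, ⟨hr, p, hp, rfl⟩, -⟩ := hI.existsUnique x⁻¹ ⟨U, hU⟩
  have hU' : U ∈ ψ.conjIndex J (p * x⁻¹) := by
    rw [mem_conjIndex, conjSubgroup_mul, e]
    exact conjSubgroup_of_mem hp
  refine ⟨_, hr, hU', Subtype.ext (mulActionHom_ext ?_)⟩
  rw [isomOf_one, hx, QuotientGroup.eq]
  simpa using hp

lemma IsRepresentatives.eq_of_isomOf_eq {I : Set G} (hI : ψ.IsRepresentatives J I) {U : Q}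
    {g g' : G} (hg : g ∈ I) (hg' : g' ∈ I) (h : U ∈ ψ.conjIndex J g) (h' : U ∈ ψ.conjIndex J g')
    (e : isomOf h = isomOf h') : g = g' := by
  obtain ⟨r, -, hr⟩ := hI.existsUnique g' ⟨U, h'⟩
  rw [hr g ⟨hg, g * g'⁻¹, (isomOf_eq_iff h h').mp e, by group⟩,
    hr g' ⟨hg', 1, one_mem _, (one_mul g').symm⟩]

/-- The projection is not an isomorphism, so `B_{P_J}` kills it by definition. This is why different
blocks do not interact. -/
lemma res_isomModule_of_ne {U T : Q} (h : ψ.localSubgroup U ≤ ψ.localSubgroup T)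
    (hne : ψ.localSubgroup U ≠ ψ.localSubgroup T)
    (m : (isomModule ψ.family (ψ.localSubgroup J)).obj (.op (ψ.orbit T))) :
    ψ.res (isomModule ψ.family (ψ.localSubgroup J)) h m = 0 := by
  have h0 : isomModuleMap (ψ.localSubgroup J)
      (orbitProj (L := ψ.orbit U) (S := ψ.orbit T) h) = 0 := by
    refine Finsupp.lhom_ext' fun φ => LinearMap.ext_ring ?_
    refine isomModuleMap_single_of_not (fun hi => hne ?_) φ
    have := conjSubgroup_eq_of_isIsomMap hi (y := 1) rfl
    rwa [inv_one, conjSubgroup_one] at this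
  exact LinearMap.congr_fun h0 m

/-- The projection fixes the base coset, so it matches the basis elements given by the same coset
`g⁻¹ P_J`. -/
lemma res_isomModule_of_eq {U T : Q} (h : ψ.localSubgroup U ≤ ψ.localSubgroup T)
    (e : ψ.localSubgroup U = ψ.localSubgroup T) {g : G} (hU : U ∈ ψ.conjIndex J g)
    (hT : T ∈ ψ.conjIndex J g)
    (m : (isomModule ψ.family (ψ.localSubgroup J)).obj (.op (ψ.orbit T))) :
    (show IsomMaps (ψ.localSubgroup U) (ψ.localSubgroup J) →₀ ℤ from
      ψ.res (isomModule ψ.family (ψ.localSubgroup J)) h m) (isomOf hU) =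
    (show IsomMaps (ψ.localSubgroup T) (ψ.localSubgroup J) →₀ ℤ from m) (isomOf hT) := by
  have h0 : (Finsupp.lapply (isomOf hU)) ∘ₗ isomModuleMap (ψ.localSubgroup J)
      (orbitProj (L := ψ.orbit U) (S := ψ.orbit T) h) = Finsupp.lapply (R := ℤ) (isomOf hT) := by
    refine Finsupp.lhom_ext' fun φ => LinearMap.ext_ring ?_
    have hi : IsIsomMap (orbitProj (L := ψ.orbit U) (S := ψ.orbit T) h) :=
      ⟨1, rfl, by rw [inv_one, conjSubgroup_one]; exact e⟩
    refine (DFunLike.congr_fun (isomModuleMap_single_of hi φ) (isomOf hU)).trans ?_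
    change Finsupp.single _ (1 : ℤ) _ = Finsupp.single φ (1 : ℤ) (isomOf hT)
    rw [Finsupp.single_apply, Finsupp.single_apply]
    refine if_congr ?_ rfl rfl
    rw [Subtype.ext_iff, Subtype.ext_iff]
    constructor
    · intro he
      refine mulActionHom_ext ?_
      have := DFunLike.congr_fun he ((1 : G) : G ⧸ ψ.localSubgroup U)
      rw [isomOf_one] at this ⊢
      exact this
    · intro he
      refine mulActionHom_ext ?_
      have := DFunLike.congr_fun he ((1 : G) : G ⧸ ψ.localSubgroup T)
      rw [isomOf_one] at this ⊢
      exact this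
  exact LinearMap.congr_fun h0 m

end SimpleMorphism

end

/-! ### Splitting of `B_{P_J}`-valued cochains over blocks. -/

noncomputable section

lemma relCochainComplex_d {Q : Type u} [PartialOrder Q] (A B : Set Q) (n : ℕ) :
    (relCochainComplex A B).d n (n + 1) = ModuleCat.ofHom (relCoboundary A B n) := by
  exact CochainComplex.of_d (fun n => ModuleCat.of ℤ (relCochains A B n))
    (fun n => ModuleCat.ofHom (relCoboundary A B n)) n

lemma nonempty_intLinearEquiv {M N : Type*} [AddCommGroup M] [AddCommGroup N] [Module ℤ M]
    [Module ℤ N] (e : M ≃+ N) : Nonempty (M ≃ₗ[ℤ] N) :=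
  ⟨e.toLinearEquiv fun c x => by
    exact map_intCast_smul e ℤ ℤ c x⟩

namespace SimpleMorphism

open Classical

variable {Q : Type u} [PartialOrder Q] {GQ : SimpleComplexOfGroups.{v, u} Q}
  {G : Type u} [Group G] (ψ : SimpleMorphism GQ G)

/-- If a face started in `C`, the group of `τ 0` would be squeezed between two equal groups of `C`,
which would force `τ 0` into `C`. -/
lemma face_zero_notMem (hψ : ∀ J : Q, Function.Injective (ψ.hom J)) {C : Set Q}
    (hC : GQ.IsBlock C) {n : ℕ} {τ : PosetSimplex Q (n + 1)} (hτ : τ 0 ∈ ψ.upperSet C)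
    (h : τ 0 ∉ C) (i : Fin (n + 2)) : PosetSimplex.face i τ 0 ∉ C := by
  intro hT
  obtain ⟨U, hU, hle⟩ := hτ
  have e1 := ψ.localSubgroup_eq_of_mem_block hψ hC hU hT
  have e : ψ.localSubgroup U = ψ.localSubgroup (τ 0) :=
    le_antisymm (ψ.localSubgroup_mono hle) (e1 ▸ ψ.localSubgroup_mono (face_zero_le i τ))
  exact h ((ψ.mem_block_of_le hψ hC hle e).mp hU)

/-- The component of a `B_{P_J}`-valued cochain at a block `C ⊆ Ω_J^g`. -/
def blockEval {J : Q} {g : G} {C : Set Q} (hψ : ∀ J : Q, Function.Injective (ψ.hom J))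
    (hC : GQ.IsBlock C) (hCJ : C ⊆ ψ.conjIndex J g) (n : ℕ) :
    (fixedPointsModule ψ.family (ψ.Cell n) ⟶ isomModule ψ.family (ψ.localSubgroup J)) →ₗ[ℤ]
      relCochains (ψ.upperSet C) (ψ.strictUpperSet C) n where
  toFun φ := ⟨fun σ => if h : σ.1 0 ∈ C then
      (show IsomMaps (ψ.localSubgroup (σ.1 0)) (ψ.localSubgroup J) →₀ ℤ from
        ψ.cochainEval _ n φ σ.1) (isomOf (hCJ h)) else 0,
    fun σ h => dif_neg ((ψ.forall_mem_strictUpperSet_iff hψ hC σ.2).mp h)⟩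
  map_add' φ φ' := by
    ext σ
    by_cases h : σ.1 0 ∈ C
    · simp only [h, dif_pos, Submodule.coe_add, Pi.add_apply]
      rfl
    · simp [h]
  map_smul' a φ := by
    ext σ
    by_cases h : σ.1 0 ∈ C
    · simp only [h, dif_pos, Submodule.coe_smul, Pi.smul_apply]
      rfl
    · simp [h]

section

variable {J : Q} {g : G} {C : Set Q} (hψ : ∀ J : Q, Function.Injective (ψ.hom J))
    (hC : GQ.IsBlock C) (hCJ : C ⊆ ψ.conjIndex J g)

lemma blockEval_apply_of_mem {n : ℕ}
    (φ : fixedPointsModule ψ.family (ψ.Cell n) ⟶ isomModule ψ.family (ψ.localSubgroup J))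
    (σ : {σ : PosetSimplex Q n // ∀ k, σ k ∈ ψ.upperSet C}) (h : σ.1 0 ∈ C) :
    (ψ.blockEval hψ hC hCJ n φ).1 σ =
      (show IsomMaps (ψ.localSubgroup (σ.1 0)) (ψ.localSubgroup J) →₀ ℤ from
        ψ.cochainEval _ n φ σ.1) (isomOf (hCJ h)) := dif_pos h

lemma blockEval_apply_of_notMem {n : ℕ}
    (φ : fixedPointsModule ψ.family (ψ.Cell n) ⟶ isomModule ψ.family (ψ.localSubgroup J))
    (σ : {σ : PosetSimplex Q n // ∀ k, σ k ∈ ψ.upperSet C}) (h : σ.1 0 ∉ C) :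
    (ψ.blockEval hψ hC hCJ n φ).1 σ = 0 := dif_neg h

lemma blockEval_chainBdry (n : ℕ)
    (φ : fixedPointsModule ψ.family (ψ.Cell n) ⟶ isomModule ψ.family (ψ.localSubgroup J)) :
    ψ.blockEval hψ hC hCJ (n + 1) (ψ.chainBdry n ≫ φ) =
      relCoboundary _ _ n (ψ.blockEval hψ hC hCJ n φ) := by
  ext τ
  by_cases h : τ.1 0 ∈ C
  · refine (ψ.blockEval_apply_of_mem hψ hC hCJ _ τ h).trans ?_
    rw [cochainEval_chainBdry]
    let A : (isomModule ψ.family (ψ.localSubgroup J)).obj (.op (ψ.orbit (τ.1 0))) →+ ℤ :=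
      (Finsupp.applyAddHom (isomOf (hCJ h)) :
        (IsomMaps (ψ.localSubgroup (τ.1 0)) (ψ.localSubgroup J) →₀ ℤ) →+ ℤ)
    refine (map_sum A _ Finset.univ).trans (Finset.sum_congr rfl fun i _ => ?_)
    refine (map_zsmul A _ _).trans (congrArg (fun t : ℤ => (-1 : ℤ) ^ (i : ℕ) * t) ?_)
    have hle := face_zero_le i τ.1
    -- Either the group stays the same, the face remains in the block and the coefficient is
    -- unchanged, or the group grows and both terms vanish.
    by_cases e : ψ.localSubgroup (τ.1 0) = ψ.localSubgroup (PosetSimplex.face i τ.1 0)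
    · have hT := (ψ.mem_block_of_le hψ hC hle e).mp h
      rw [ψ.blockEval_apply_of_mem hψ hC hCJ _ _ hT]
      exact res_isomModule_of_eq _ e (hCJ h) (hCJ hT) _
    · rw [ψ.blockEval_apply_of_notMem, res_isomModule_of_ne _ e, map_zero]
      exact fun hT => e (ψ.localSubgroup_eq_of_mem_block hψ hC h hT)
  · refine (ψ.blockEval_apply_of_notMem hψ hC hCJ _ τ h).trans (Eq.symm ?_)
    change ∑ i : Fin (n + 2), (-1 : ℤ) ^ (i : ℕ) * (ψ.blockEval hψ hC hCJ n φ).1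
      ⟨PosetSimplex.face i τ.1, _⟩ = 0
    refine Finset.sum_eq_zero fun i _ => ?_
    rw [ψ.blockEval_apply_of_notMem, mul_zero]
    exact ψ.face_zero_notMem hψ hC (τ.2 0) h i

/-- The components at a block form a map of cochain complexes. -/
def blockMap : (ψ.bredonChainComplex ψ.family).linearYonedaObj ℤ
      (isomModule ψ.family (ψ.localSubgroup J)) ⟶
    relCochainComplex (ψ.upperSet C) (ψ.strictUpperSet C) where
  f n := ModuleCat.ofHom (ψ.blockEval hψ hC hCJ n)
  comm' n m h := by
    obtain rfl : n + 1 = m := h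
    rw [relCochainComplex_d]
    ext φ : 2
    refine ((ψ.blockEval_chainBdry hψ hC hCJ n φ).symm.trans ?_)
    rw [← bredonChainComplex_d]
    rfl

end

section Decomposition

variable {J : Q} {I : Set G}

/-- The pairs of a representative `g ∈ I` and a block contained in `Ω_J^g`. -/
abbrev BlockIndex (J : Q) (I : Set G) : Type u :=
  Σ g : I, {C : Set Q // GQ.IsBlock C ∧ C ⊆ ψ.conjIndex J g}

/-- With `blockIndex_eq`, the basis of the coefficient group at `σ₀` corresponds to the pairs `(g,
C)` with `σ₀ ∈ C`. -/
lemma exists_blockIndex (hI : ψ.IsRepresentatives J I)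
    (hψ : ∀ J : Q, Function.Injective (ψ.hom J)) (σ₀ : Q) (θ : IsomMaps (ψ.localSubgroup σ₀) (ψ.localSubgroup J)) :
    ∃ (i : ψ.BlockIndex J I) (h : σ₀ ∈ i.2.1), isomOf (i.2.2.2 h) = θ := by
  obtain ⟨g, hg, h, rfl⟩ := hI.exists_isomOf θ
  obtain ⟨C, hC, hσ⟩ := exists_mem_block (GQ := GQ) σ₀
  refine ⟨⟨⟨g, hg⟩, C, hC, fun V hV => ?_⟩, hσ, rfl⟩
  exact (ψ.localSubgroup_eq_of_mem_block hψ hC hV hσ).trans h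

lemma blockIndex_eq (hI : ψ.IsRepresentatives J I) {σ₀ : Q} {i j : ψ.BlockIndex J I} (hi : σ₀ ∈ i.2.1) (hj : σ₀ ∈ j.2.1)
    (e : isomOf (i.2.2.2 hi) = isomOf (j.2.2.2 hj)) : i = j := by
  obtain ⟨⟨g, hg⟩, C, hC, hCg⟩ := i
  obtain ⟨⟨g', hg'⟩, C', hC', hCg'⟩ := j
  obtain rfl := hI.eq_of_isomOf_eq hg hg' _ _ e
  obtain rfl := block_eq_of_mem hC hC' hi hj
  rfl

/-- The coefficient of the value at `σ` on `θ` is read off from the unique component to which `θ`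
belongs. Distinct `θ` use distinct components, so finiteness of `y` makes these values finitely
supported, as `B_{P_J}` requires. -/
lemma exists_blockEval_eq (hI : ψ.IsRepresentatives J I)
    (hψ : ∀ J : Q, Function.Injective (ψ.hom J)) (n : ℕ)
    (y : ∀ i : ψ.BlockIndex J I, relCochains (ψ.upperSet i.2.1) (ψ.strictUpperSet i.2.1) n)
    (hy : {i | y i ≠ 0}.Finite) : ∃ φ, ∀ i, ψ.blockEval hψ i.2.2.1 i.2.2.2 n φ = y i := by
  choose ix hix hθ using fun σ : PosetSimplex Q n => ψ.exists_blockIndex hI hψ (σ 0)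
  let f : ∀ σ : PosetSimplex Q n, IsomMaps (ψ.localSubgroup (σ 0)) (ψ.localSubgroup J) → ℤ :=
    fun σ θ => (y (ix σ θ)).1 ⟨σ, ψ.mem_upperSet_of_mem (hix σ θ)⟩
  have hinj : ∀ σ, Function.Injective (ix σ) := fun σ θ θ' e => by
    have key : ∀ i, i = ix σ θ' → ∀ h : σ 0 ∈ i.2.1, isomOf (i.2.2.2 h) = θ' := by
      rintro _ rfl h
      exact hθ σ θ'
    exact (hθ σ θ).symm.trans (key _ e (hix σ θ))
  have hf : ∀ σ, (Function.support (f σ)).Finite := fun σ =>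
    (hy.preimage (hinj σ).injOn).subset fun θ hθ h0 => hθ (by
      change (y (ix σ θ)).1 _ = 0
      rw [h0]
      rfl)
  obtain ⟨φ, hφ⟩ := ψ.cochainEval_surjective (isomModule ψ.family (ψ.localSubgroup J)) n
    fun σ => Finsupp.ofSupportFinite (f σ) (hf σ)
  refine ⟨φ, fun i => ?_⟩
  ext σ
  by_cases h : σ.1 0 ∈ i.2.1
  · rw [ψ.blockEval_apply_of_mem _ _ _ _ _ h, hφ]
    change (y (ix σ.1 _)).1 _ = _
    have e : ix σ.1 (isomOf (i.2.2.2 h)) = i :=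
      ψ.blockIndex_eq hI (hix _ _) h (hθ _ _)
    have key : ∀ j, j = i → ∀ h : ∀ k, σ.1 k ∈ ψ.upperSet j.2.1, (y j).1 ⟨σ.1, h⟩ = (y i).1 σ := by
      rintro _ rfl h
      rfl
    exact key _ e _
  · rw [ψ.blockEval_apply_of_notMem _ _ _ _ _ h]
    exact ((y i).2 σ ((ψ.forall_mem_strictUpperSet_iff hψ i.2.2.1 σ.2).mpr h)).symm

lemma eq_zero_of_blockEval_eq_zero (hI : ψ.IsRepresentatives J I)
    (hψ : ∀ J : Q, Function.Injective (ψ.hom J)) (n : ℕ)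
    (φ : fixedPointsModule ψ.family (ψ.Cell n) ⟶ isomModule ψ.family (ψ.localSubgroup J))
    (h : ∀ i : ψ.BlockIndex J I, ψ.blockEval hψ i.2.2.1 i.2.2.2 n φ = 0) : φ = 0 := by
  refine ψ.cochainEval_injective _ n (Eq.trans (funext fun σ => ?_) (map_zero _).symm)
  refine Finsupp.ext (α := IsomMaps (ψ.localSubgroup (σ 0)) (ψ.localSubgroup J)) fun θ => ?_
  obtain ⟨i, hi, rfl⟩ := ψ.exists_blockIndex hI hψ (σ 0) θ
  have := congrArg (fun c => c.1 ⟨σ, ψ.mem_upperSet_of_mem hi⟩) (h i)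
  exact (ψ.blockEval_apply_of_mem hψ _ _ φ ⟨σ, ψ.mem_upperSet_of_mem hi⟩ hi).symm.trans this

/-- There are finitely many simplices in each degree, each value has finite support, and each basis
element feeds one component. -/
lemma finite_blockEval_ne_zero [Finite Q] (hI : ψ.IsRepresentatives J I)
    (hψ : ∀ J : Q, Function.Injective (ψ.hom J)) (n : ℕ)
    (φ : fixedPointsModule ψ.family (ψ.Cell n) ⟶ isomModule ψ.family (ψ.localSubgroup J)) :
    {i : ψ.BlockIndex J I | ψ.blockEval hψ i.2.2.1 i.2.2.2 n φ ≠ 0}.Finite := by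
  have hQ : Finite (PosetSimplex Q n) := DFunLike.finite _
  choose ix hix hθ using fun σ : PosetSimplex Q n => ψ.exists_blockIndex hI hψ (σ 0)
  refine (Set.finite_iUnion fun σ : PosetSimplex Q n => Set.Finite.image (ix σ)
    (Finset.finite_toSet (Finsupp.support
      (show IsomMaps (ψ.localSubgroup (σ 0)) (ψ.localSubgroup J) →₀ ℤ from
        ψ.cochainEval _ n φ σ)))).subset fun i hi => ?_
  obtain ⟨σ, hσ⟩ : ∃ σ, (ψ.blockEval hψ i.2.2.1 i.2.2.2 n φ).1 σ ≠ 0 := by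
    by_contra! h
    exact hi (Subtype.ext (funext h))
  by_cases h : σ.1 0 ∈ i.2.1
  · rw [ψ.blockEval_apply_of_mem _ _ _ _ _ h] at hσ
    refine Set.mem_iUnion.mpr ⟨σ.1, isomOf (i.2.2.2 h), Finsupp.mem_support_iff.mpr hσ, ?_⟩
    exact ψ.blockIndex_eq hI (hix _ _) h (hθ _ _)
  · exact absurd (ψ.blockEval_apply_of_notMem _ _ _ _ _ h) hσ

/-- Bredon cohomology with coefficients in `B_{P_J}` is a direct sum over blocks. -/
lemma bredonCohomology_isomModule_equiv [Finite Q] (hI : ψ.IsRepresentatives J I)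
    (hψ : ∀ J : Q, Function.Injective (ψ.hom J)) (n : ℕ) :
    Nonempty (ψ.bredonCohomology ψ.family (isomModule ψ.family (ψ.localSubgroup J)) n ≃ₗ[ℤ]
      ⨁ (g : I) (C : {C : Set Q // GQ.IsBlock C ∧ C ⊆ ψ.conjIndex J g}),
        ψ.panelCohomology C.1 n) := by
  let E := (ψ.bredonChainComplex ψ.family).linearYonedaObj ℤ
    (isomModule ψ.family (ψ.localSubgroup J))
  let D : ψ.BlockIndex J I → CochainComplex (ModuleCat.{u} ℤ) ℕ := fun i =>
    relCochainComplex (ψ.upperSet i.2.1) (ψ.strictUpperSet i.2.1)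
  let c : ∀ i, E.sc n ⟶ (D i).sc n := fun i =>
    (HomologicalComplex.shortComplexFunctor _ _ n).map (ψ.blockMap hψ i.2.2.1 i.2.2.2)
  obtain ⟨e⟩ := homology_equiv_directSum (E.sc n) (fun i => (D i).sc n) c
    (ψ.exists_blockEval_eq hI hψ _) (ψ.exists_blockEval_eq hI hψ n)
    (ψ.finite_blockEval_ne_zero hI hψ n) (ψ.eq_zero_of_blockEval_eq_zero hI hψ n)
    (ψ.eq_zero_of_blockEval_eq_zero hI hψ _)
  exact nonempty_intLinearEquiv (e.trans (DirectSum.sigmaCurryEquiv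
    (δ := fun (g : I) (C : {C : Set Q // GQ.IsBlock C ∧ C ⊆ ψ.conjIndex J g}) =>
      ψ.panelCohomology C.1 n)))

end Decomposition

end SimpleMorphism

end

noncomputable section

/-! ## Vanishing of Bredon cohomology -/

section Extension

open Classical

/-- The extension of an integral matrix to vectors with entries in an abelian group. -/
def LinearMap.piExtend {S T : Type*} [Fintype S] (A : Type*) [AddCommGroup A]
    (L : (S → ℤ) →ₗ[ℤ] (T → ℤ)) : (S → A) →+ (T → A) where
  toFun f t := ∑ s, L (Pi.single s 1) t • f s
  map_zero' := funext fun t => Finset.sum_eq_zero fun s _ => smul_zero _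
  map_add' f g := funext fun t => by
    simp only [Pi.add_apply, smul_add, Finset.sum_add_distrib]

lemma LinearMap.piExtend_comp {S T U A : Type*} [Fintype S] [Fintype T] [AddCommGroup A]
    (L : (S → ℤ) →ₗ[ℤ] (T → ℤ)) (L' : (T → ℤ) →ₗ[ℤ] (U → ℤ)) (f : S → A) :
    (L' ∘ₗ L).piExtend A f = L'.piExtend A (L.piExtend A f) := by
  funext x
  change ∑ s, L' (L (Pi.single s 1)) x • f s = ∑ t, L' (Pi.single t 1) x • ∑ s, L (Pi.single s 1) t • f s
  simp only [Finset.smul_sum, smul_smul]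
  rw [Finset.sum_comm]
  refine Finset.sum_congr rfl fun s _ => ?_
  rw [← Finset.sum_smul, L'.pi_apply_eq_sum_univ (L (Pi.single s 1)), Finset.sum_apply]
  congr 1
  refine Finset.sum_congr rfl fun t _ => ?_
  rw [Pi.smul_apply, smul_eq_mul, mul_comm]
  refine congrArg (fun v => L' v x * L (Pi.single s 1) t) (funext fun j => ?_)
  rw [Pi.single_apply]
  exact if_congr eq_comm rfl rfl

lemma LinearMap.piExtend_add {S T A : Type*} [Fintype S] [AddCommGroup A]
    (L L' : (S → ℤ) →ₗ[ℤ] (T → ℤ)) (f : S → A) :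
    (L + L').piExtend A f = L.piExtend A f + L'.piExtend A f := by
  funext x
  change ∑ s, (L _ x + L' _ x) • f s = ∑ s, L _ x • f s + ∑ s, L' _ x • f s
  simp only [add_smul, Finset.sum_add_distrib]

lemma LinearMap.piExtend_id {S A : Type*} [Fintype S] [AddCommGroup A] (f : S → A) :
    (LinearMap.id : (S → ℤ) →ₗ[ℤ] (S → ℤ)).piExtend A f = f := by
  funext x
  change ∑ s, (Pi.single s (1 : ℤ) : S → ℤ) x • f s = f x
  rw [Finset.sum_eq_single x (fun s _ hs => by rw [Pi.single_eq_of_ne hs.symm, zero_smul])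
    (fun h => absurd (Finset.mem_univ x) h), Pi.single_eq_same, one_smul]

/-- The image is a subgroup of a free abelian group of finite rank, hence projective. -/
lemma exists_section {S T : Type*} [Finite T] (δ : (S → ℤ) →ₗ[ℤ] (T → ℤ)) :
    ∃ s : LinearMap.range δ →ₗ[ℤ] (S → ℤ), ∀ x, δ (s x) = x.1 := by
  obtain ⟨s, hs⟩ := Module.projective_lifting_property δ.rangeRestrict LinearMap.id
    δ.surjective_rangeRestrict
  exact ⟨s, fun x => congrArg Subtype.val (LinearMap.congr_fun hs x)⟩

/-- Exactness of integral matrices in two consecutive places gives a contraction in the first. -/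
lemma exists_contraction {S₀ S₁ S₂ S₃ : Type*} [Finite S₁] [Finite S₂] [Finite S₃]
    (δ₀ : (S₀ → ℤ) →ₗ[ℤ] (S₁ → ℤ)) (δ₁ : (S₁ → ℤ) →ₗ[ℤ] (S₂ → ℤ))
    (δ₂ : (S₂ → ℤ) →ₗ[ℤ] (S₃ → ℤ)) (h₀ : ∀ x, δ₁ x = 0 → ∃ y, δ₀ y = x)
    (h₁ : ∀ x, δ₂ x = 0 → ∃ y, δ₁ y = x) (h : ∀ x, δ₂ (δ₁ x) = 0) :
    ∃ (a : (S₂ → ℤ) →ₗ[ℤ] (S₁ → ℤ)) (b : (S₁ → ℤ) →ₗ[ℤ] (S₀ → ℤ)),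
      LinearMap.id = a ∘ₗ δ₁ + δ₀ ∘ₗ b := by
  obtain ⟨s₀, hs₀⟩ := exists_section δ₀
  obtain ⟨s₁, hs₁⟩ := exists_section δ₁
  obtain ⟨s₂, hs₂⟩ := exists_section δ₂
  -- Subtracting `s₂ (δ₂ x)` from `x` leaves a cocycle, which is a coboundary by `h₁`; this retracts
  -- onto the image of `δ₁`.
  let r : (S₂ → ℤ) →ₗ[ℤ] LinearMap.range δ₁ :=
    (LinearMap.id - s₂ ∘ₗ δ₂.rangeRestrict).codRestrict _ fun x => h₁ _ (by
      rw [LinearMap.sub_apply, map_sub]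
      exact sub_eq_zero.mpr (hs₂ (δ₂.rangeRestrict x)).symm)
  have hr : ∀ x, (r (δ₁ x)).1 = δ₁ x := fun x => by
    have : δ₂.rangeRestrict (δ₁ x) = 0 := Subtype.ext (h x)
    change δ₁ x - s₂ (δ₂.rangeRestrict (δ₁ x)) = δ₁ x
    rw [this, map_zero, sub_zero]
  -- Likewise `x - s₁ (r (δ₁ x))` is killed by `δ₁`, so it lies in the image of `δ₀` by `h₀`.
  let q : (S₁ → ℤ) →ₗ[ℤ] LinearMap.range δ₀ :=
    (LinearMap.id - s₁ ∘ₗ r ∘ₗ δ₁).codRestrict _ fun x => h₀ _ (by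
      rw [LinearMap.sub_apply, map_sub]
      exact sub_eq_zero.mpr ((hs₁ _).trans (hr x)).symm)
  refine ⟨s₁ ∘ₗ r, s₀ ∘ₗ q, LinearMap.ext fun x => ?_⟩
  change x = s₁ (r (δ₁ x)) + δ₀ (s₀ (q x))
  rw [hs₀]
  change x = s₁ (r (δ₁ x)) + (x - s₁ (r (δ₁ x)))
  rw [add_sub_cancel]

end Extension

section Relative

variable {Q : Type u} [PartialOrder Q]

lemma exists_relCoboundary_eq {A B : Set Q} {n : ℕ} (h : Subsingleton (relCohomology A B (n + 1)))
    {f : relCochains A B (n + 1)} (hf : relCoboundary A B (n + 1) f = 0) :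
    ∃ g, relCoboundary A B n g = f := by
  have he : (relCochainComplex A B).ExactAt (n + 1) := by
    rw [HomologicalComplex.exactAt_iff_isZero_homology]
    exact @ModuleCat.isZero_of_subsingleton _ _ _ h
  rw [HomologicalComplex.exactAt_iff' _ n (n + 1) (n + 2) (by simp) (by simp),
    ShortComplex.moduleCat_exact_iff] at he
  obtain ⟨g, hg⟩ := he f (by
    refine Eq.trans ?_ hf
    exact congrArg (fun d => d.hom f) (relCochainComplex_d A B (n + 1)))
  refine ⟨g, Eq.trans ?_ hg⟩
  exact congrArg (fun d => d.hom g) (relCochainComplex_d A B n).symm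

open Classical in
/-- The coboundary on functions on the simplices with first vertex in `C`. -/
def blockCoboundary (C : Set Q) (A : Type*) [AddCommGroup A] (n : ℕ) :
    ({σ : PosetSimplex Q n // σ 0 ∈ C} → A) →ₗ[ℤ] ({τ : PosetSimplex Q (n + 1) // τ 0 ∈ C} → A) where
  toFun f τ := ∑ i : Fin (n + 2), (-1 : ℤ) ^ (i : ℕ) •
    if h : PosetSimplex.face i τ.1 0 ∈ C then f ⟨PosetSimplex.face i τ.1, h⟩ else 0
  map_add' f g := by
    funext τ
    rw [Pi.add_apply, ← Finset.sum_add_distrib]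
    refine Finset.sum_congr rfl fun i _ => ?_
    rw [← smul_add]
    split_ifs <;> simp
  map_smul' c f := by
    funext τ
    rw [Pi.smul_apply, Finset.smul_sum]
    refine Finset.sum_congr rfl fun i _ => ?_
    rw [RingHom.id_apply, smul_comm c]
    split_ifs <;> simp

open Classical in
lemma blockCoboundary_piExtend (C : Set Q) (A : Type*) [AddCommGroup A] (n : ℕ)
    [Fintype {σ : PosetSimplex Q n // σ 0 ∈ C}]
    (f : {σ : PosetSimplex Q n // σ 0 ∈ C} → A) :
    (blockCoboundary C ℤ n).piExtend A f = blockCoboundary C A n f := by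
  funext τ
  change ∑ s, (∑ i : Fin (n + 2), (-1 : ℤ) ^ (i : ℕ) •
      dite (PosetSimplex.face i τ.1 0 ∈ C) (fun h => _) fun _ => 0) • f s =
    ∑ i : Fin (n + 2), (-1 : ℤ) ^ (i : ℕ) •
      if h : PosetSimplex.face i τ.1 0 ∈ C then f ⟨PosetSimplex.face i τ.1, h⟩ else 0
  simp only [Finset.sum_smul]
  rw [Finset.sum_comm]
  refine Finset.sum_congr rfl fun i _ => ?_
  simp only [smul_assoc]
  rw [← Finset.smul_sum]
  congr 1
  split_ifs with h
  · exact congrFun (LinearMap.piExtend_id f) ⟨_, h⟩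
  · simp

end Relative

namespace SimpleMorphism

open Classical

variable {Q : Type u} [PartialOrder Q] {GQ : SimpleComplexOfGroups.{v, u} Q}
  {G : Type u} [Group G] (ψ : SimpleMorphism GQ G)

/-- Extension by zero of a function on the simplices with first vertex in a block. -/
def relExtend (hψ : ∀ J : Q, Function.Injective (ψ.hom J)) {C : Set Q} (hC : GQ.IsBlock C) {n : ℕ}
    (f : {σ : PosetSimplex Q n // σ 0 ∈ C} → ℤ) :
    relCochains (ψ.upperSet C) (ψ.strictUpperSet C) n :=
  ⟨fun σ => if h : σ.1 0 ∈ C then f ⟨σ.1, h⟩ else 0,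
    fun σ h => dif_neg ((ψ.forall_mem_strictUpperSet_iff hψ hC σ.2).mp h)⟩

variable {ψ} in
/-- Restriction of a relative cochain to the simplices with first vertex in a block. -/
def relRestrict {C : Set Q} {n : ℕ} (f : relCochains (ψ.upperSet C) (ψ.strictUpperSet C) n) :
    {σ : PosetSimplex Q n // σ 0 ∈ C} → ℤ :=
  fun σ => f.1 ⟨σ.1, ψ.mem_upperSet_of_mem σ.2⟩

/-- Relative cochains vanish on simplices not starting in `C`, so they are arbitrary functions on
those that do. This is the form in which coefficients can be changed. -/
lemma relExtend_relRestrict (hψ : ∀ J : Q, Function.Injective (ψ.hom J)) {C : Set Q}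
    (hC : GQ.IsBlock C) {n : ℕ} (f : relCochains (ψ.upperSet C) (ψ.strictUpperSet C) n) :
    ψ.relExtend hψ hC (relRestrict f) = f := by
  ext σ
  by_cases h : σ.1 0 ∈ C
  · exact dif_pos h
  · exact (dif_neg h).trans (f.2 σ ((ψ.forall_mem_strictUpperSet_iff hψ hC σ.2).mpr h)).symm

lemma relRestrict_relExtend (hψ : ∀ J : Q, Function.Injective (ψ.hom J)) {C : Set Q}
    (hC : GQ.IsBlock C) {n : ℕ} (f : {σ : PosetSimplex Q n // σ 0 ∈ C} → ℤ) :
    relRestrict (ψ.relExtend hψ hC f) = f :=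
  funext fun σ => dif_pos σ.2

lemma relCoboundary_relExtend (hψ : ∀ J : Q, Function.Injective (ψ.hom J)) {C : Set Q}
    (hC : GQ.IsBlock C) {n : ℕ} (f : {σ : PosetSimplex Q n // σ 0 ∈ C} → ℤ) :
    relCoboundary _ _ n (ψ.relExtend hψ hC f) = ψ.relExtend hψ hC (blockCoboundary C ℤ n f) := by
  ext τ
  change ∑ i : Fin (n + 2), (-1 : ℤ) ^ (i : ℕ) * dite (PosetSimplex.face i τ.1 0 ∈ C) _ _ =
    dite (τ.1 0 ∈ C) _ _
  split_ifs with h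
  · rfl
  · refine Finset.sum_eq_zero fun i _ => ?_
    rw [dif_neg (ψ.face_zero_notMem hψ hC (τ.2 0) h i), mul_zero]

lemma exists_blockCoboundary_int_eq (hψ : ∀ J : Q, Function.Injective (ψ.hom J)) {C : Set Q}
    (hC : GQ.IsBlock C) {n : ℕ} (h : Subsingleton (ψ.panelCohomology C (n + 1)))
    {f : {σ : PosetSimplex Q (n + 1) // σ 0 ∈ C} → ℤ} (hf : blockCoboundary C ℤ (n + 1) f = 0) :
    ∃ g, blockCoboundary C ℤ n g = f := by
  have h0 : ψ.relExtend hψ hC (0 : {σ : PosetSimplex Q (n + 2) // σ 0 ∈ C} → ℤ) = 0 := by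
    ext σ
    exact dite_eq_right_iff.mpr fun _ => rfl
  obtain ⟨g, hg⟩ := exists_relCoboundary_eq h (f := ψ.relExtend hψ hC f) (by
    rw [relCoboundary_relExtend, hf, h0])
  refine ⟨relRestrict g, ?_⟩
  rw [← ψ.relExtend_relRestrict hψ hC g, relCoboundary_relExtend] at hg
  rw [← ψ.relRestrict_relExtend hψ hC (blockCoboundary C ℤ n (relRestrict g)), hg,
    relRestrict_relExtend]

lemma blockCoboundary_blockCoboundary (hψ : ∀ J : Q, Function.Injective (ψ.hom J)) {C : Set Q}
    (hC : GQ.IsBlock C) {n : ℕ} (f : {σ : PosetSimplex Q n // σ 0 ∈ C} → ℤ) :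
    blockCoboundary C ℤ (n + 1) (blockCoboundary C ℤ n f) = 0 := by
  rw [← ψ.relRestrict_relExtend hψ hC (blockCoboundary C ℤ (n + 1) (blockCoboundary C ℤ n f)),
    ← relCoboundary_relExtend, ← relCoboundary_relExtend]
  have := LinearMap.congr_fun (relCoboundary_comp (ψ.upperSet C) (ψ.strictUpperSet C) n)
    (ψ.relExtend hψ hC f)
  rw [LinearMap.comp_apply] at this
  rw [this]
  rfl

/-- Vanishing of the integral cohomology of a block in two consecutive degrees implies vanishing
in the first of them with arbitrary coefficients. -/
lemma exists_blockCoboundary_eq [Finite Q] (hψ : ∀ J : Q, Function.Injective (ψ.hom J)) {C : Set Q}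
    (hC : GQ.IsBlock C) {n : ℕ} (h : Subsingleton (ψ.panelCohomology C (n + 1)))
    (h' : Subsingleton (ψ.panelCohomology C (n + 2))) {A : Type*} [AddCommGroup A]
    {f : {σ : PosetSimplex Q (n + 1) // σ 0 ∈ C} → A} (hf : blockCoboundary C A (n + 1) f = 0) :
    ∃ g, blockCoboundary C A n g = f := by
  have hQ : ∀ m, Finite (PosetSimplex Q m) := fun m => DFunLike.finite _
  have hS : ∀ m, Fintype {σ : PosetSimplex Q m // σ 0 ∈ C} := fun m => Fintype.ofFinite _
  obtain ⟨a, b, hab⟩ := exists_contraction (blockCoboundary C ℤ n) (blockCoboundary C ℤ (n + 1))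
    (blockCoboundary C ℤ (n + 2)) (fun _ => ψ.exists_blockCoboundary_int_eq hψ hC h)
    (fun _ => ψ.exists_blockCoboundary_int_eq hψ hC h') (ψ.blockCoboundary_blockCoboundary hψ hC)
  refine ⟨b.piExtend A f, ?_⟩
  have := LinearMap.piExtend_id f
  rw [hab, LinearMap.piExtend_add, LinearMap.piExtend_comp, LinearMap.piExtend_comp,
    blockCoboundary_piExtend, blockCoboundary_piExtend, hf, map_zero, zero_add] at this
  exact this

end SimpleMorphism

end

/-! ### Killing cocycles with arbitrary coefficients, one block at a time. -/

noncomputable section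

namespace SimpleMorphism

open Classical

variable {Q : Type u} [PartialOrder Q] {GQ : SimpleComplexOfGroups.{v, u} Q}
  {G : Type u} [Group G] (ψ : SimpleMorphism GQ G) (M : OrbitModule ψ.family)

/-- The coboundary of cochains on the fundamental domain. -/
def evalCoboundary (n : ℕ) : (∀ σ : PosetSimplex Q n, M.obj (.op (ψ.orbit (σ 0)))) →+
    ∀ τ : PosetSimplex Q (n + 1), M.obj (.op (ψ.orbit (τ 0))) where
  toFun c τ := ∑ i : Fin (n + 2), (-1 : ℤ) ^ (i : ℕ) •
    ψ.res M (ψ.localSubgroup_mono (face_zero_le i τ)) (c (PosetSimplex.face i τ))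
  map_zero' := funext fun τ => Finset.sum_eq_zero fun i _ =>
    (congrArg (_ • ·) (map_zero _)).trans (zsmul_zero _)
  map_add' c c' := funext fun τ => by
    rw [Pi.add_apply, ← Finset.sum_add_distrib]
    refine Finset.sum_congr rfl fun i _ => ?_
    exact (congrArg (_ • ·) (map_add _ _ _)).trans (zsmul_add _ _ _)

lemma evalCoboundary_apply (n : ℕ) (c : ∀ σ : PosetSimplex Q n, M.obj (.op (ψ.orbit (σ 0))))
    (τ : PosetSimplex Q (n + 1)) : ψ.evalCoboundary M n c τ = ∑ i : Fin (n + 2),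
      (-1 : ℤ) ^ (i : ℕ) • ψ.res M (ψ.localSubgroup_mono (face_zero_le i τ))
        (c (PosetSimplex.face i τ)) := rfl

lemma map_evalCoboundary {n : ℕ} {A : Type*} [AddCommGroup A]
    (c : ∀ σ : PosetSimplex Q n, M.obj (.op (ψ.orbit (σ 0)))) (τ : PosetSimplex Q (n + 1))
    (L : M.obj (.op (ψ.orbit (τ 0))) →+ A) :
    L (ψ.evalCoboundary M n c τ) = ∑ i : Fin (n + 2), (-1 : ℤ) ^ (i : ℕ) •
      L (ψ.res M (ψ.localSubgroup_mono (face_zero_le i τ)) (c (PosetSimplex.face i τ))) := by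
  rw [evalCoboundary_apply]
  refine (map_sum L _ Finset.univ).trans (Finset.sum_congr rfl fun i _ => ?_)
  exact map_zsmul L _ _

lemma cochainEval_comp (n : ℕ) (φ : fixedPointsModule ψ.family (ψ.Cell n) ⟶ M) :
    ψ.cochainEval M (n + 1) (ψ.chainBdry n ≫ φ) = ψ.evalCoboundary M n (ψ.cochainEval M n φ) :=
  funext fun τ => ψ.cochainEval_chainBdry M n φ τ

lemma chainBdry_chainBdry (n : ℕ) : ψ.chainBdry (n + 1) ≫ ψ.chainBdry n = 0 := by
  rw [← bredonChainComplex_d, ← bredonChainComplex_d]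
  exact HomologicalComplex.d_comp_d _ _ _ _

lemma evalCoboundary_evalCoboundary (n : ℕ) (c) :
    ψ.evalCoboundary M (n + 1) (ψ.evalCoboundary M n c) = 0 := by
  obtain ⟨φ, rfl⟩ := ψ.cochainEval_surjective M n c
  rw [← cochainEval_comp, ← cochainEval_comp, ← Category.assoc, chainBdry_chainBdry,
    Limits.zero_comp, map_zero]

lemma blockCoboundary_apply {C : Set Q} {A : Type*} [AddCommGroup A]
    {n : ℕ} (f : {σ : PosetSimplex Q n // σ 0 ∈ C} → A) (τ : {τ : PosetSimplex Q (n + 1) // τ 0 ∈ C}) :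
    blockCoboundary C A n f τ = ∑ i : Fin (n + 2), (-1 : ℤ) ^ (i : ℕ) •
      (if h : PosetSimplex.face i τ.1 0 ∈ C then f ⟨PosetSimplex.face i τ.1, h⟩ else 0) := rfl

lemma map_blockCoboundary {C : Set Q} {A B : Type*} [AddCommGroup A] [AddCommGroup B] (L : A →+ B)
    {n : ℕ} (f : {σ : PosetSimplex Q n // σ 0 ∈ C} → A) (τ : {τ : PosetSimplex Q (n + 1) // τ 0 ∈ C}) :
    L (blockCoboundary C A n f τ) = ∑ i : Fin (n + 2), (-1 : ℤ) ^ (i : ℕ) •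
      L (if h : PosetSimplex.face i τ.1 0 ∈ C then f ⟨PosetSimplex.face i τ.1, h⟩ else 0) := by
  refine (map_sum L (fun i : Fin (n + 2) => (-1 : ℤ) ^ (i : ℕ) •
    if h : PosetSimplex.face i τ.1 0 ∈ C then f ⟨PosetSimplex.face i τ.1, h⟩ else 0)
      Finset.univ).trans (Finset.sum_congr rfl fun i _ => ?_)
  exact map_zsmul L _ _

/-- A cocycle may be modified by a coboundary so that it vanishes on the simplices over a block. -/
lemma exists_evalCoboundary_eq_on_block [Finite Q] (hψ : ∀ J : Q, Function.Injective (ψ.hom J))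
    {C : Set Q} (hC : GQ.IsBlock C) {V : Q} (hV : V ∈ C) {n : ℕ}
    (h : Subsingleton (ψ.panelCohomology C (n + 1)))
    (h' : Subsingleton (ψ.panelCohomology C (n + 2)))
    (c : ∀ σ : PosetSimplex Q (n + 1), M.obj (.op (ψ.orbit (σ 0))))
    (hc : ψ.evalCoboundary M (n + 1) c = 0)
    (hmax : ∀ σ, ψ.localSubgroup V < ψ.localSubgroup (σ 0) → c σ = 0) :
    ∃ b, (∀ σ, σ 0 ∉ C → b σ = 0) ∧ ∀ σ, σ 0 ∈ C → ψ.evalCoboundary M n b σ = c σ := by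
  have hP : ∀ {U}, U ∈ C → ψ.localSubgroup V = ψ.localSubgroup U := fun hU =>
    ψ.localSubgroup_eq_of_mem_block hψ hC hV hU
  -- All local groups along `C` equal `P_V`, so the values are compared in the single coefficient
  -- group `M(G/P_V)`.
  let f : {σ : PosetSimplex Q (n + 1) // σ 0 ∈ C} → M.obj (.op (ψ.orbit V)) := fun σ =>
    ψ.res M (hP σ.2).le (c σ.1)
  have hf : blockCoboundary C (M.obj (.op (ψ.orbit V))) (n + 1) f = 0 := by
    funext τ
    have h0 := congrArg (ψ.res M (hP τ.2).le) (congrFun hc τ.1)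
    refine Eq.trans ?_ (h0.trans (map_zero _))
    refine Eq.trans ?_ (ψ.map_evalCoboundary M c τ.1 (ψ.res M (hP τ.2).le).toAddMonoidHom).symm
    refine (blockCoboundary_apply _ _).trans (Finset.sum_congr rfl fun i _ => ?_)
    refine congrArg (fun x : M.obj (.op (ψ.orbit V)) => (-1 : ℤ) ^ (i : ℕ) • x) ?_
    refine Eq.trans ?_ (ψ.res_res M _ _ _).symm
    split_ifs with hT
    · rfl
    -- A face leaving the block has a strictly larger group, where `c` vanishes by assumption.
    · rw [hmax, map_zero]
      refine lt_of_le_of_ne ((hP τ.2).le.trans (ψ.localSubgroup_mono (face_zero_le i τ.1)))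
        fun e => hT ((ψ.mem_block_of_le hψ hC (face_zero_le i τ.1) ?_).mp τ.2)
      exact (hP τ.2).symm.trans e
  obtain ⟨g, hg⟩ := ψ.exists_blockCoboundary_eq hψ hC h h' hf
  refine ⟨fun σ => if hσ : σ 0 ∈ C then ψ.res M (hP hσ).ge (g ⟨σ, hσ⟩) else 0,
    fun σ hσ => dif_neg hσ, fun τ hτ => ?_⟩
  have h0 := congrArg (ψ.res M (hP hτ).ge) (congrFun hg ⟨τ, hτ⟩)
  refine Eq.trans ?_ (h0.trans ((ψ.res_res M _ _ _).trans (ψ.res_refl M _ _)))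
  refine Eq.trans ?_ (map_blockCoboundary (ψ.res M (hP hτ).ge).toAddMonoidHom g ⟨τ, hτ⟩).symm
  rw [evalCoboundary_apply]
  refine Finset.sum_congr rfl fun i _ => congrArg ((-1 : ℤ) ^ (i : ℕ) • ·) ?_
  split_ifs with hT
  · exact ψ.res_res M _ _ _
  · exact (map_zero _).trans (map_zero _).symm

/-- Blocks are removed from the support in an order where maximal local groups go first: over such a
block no other block contributes to the cocycle condition, so the cocycle can be corrected to zero
there. -/
lemma exists_evalCoboundary_eq [Finite Q] (hψ : ∀ J : Q, Function.Injective (ψ.hom J)) {n : ℕ}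
    (h : ∀ C, GQ.IsBlock C → Subsingleton (ψ.panelCohomology C (n + 1)))
    (h' : ∀ C, GQ.IsBlock C → Subsingleton (ψ.panelCohomology C (n + 2)))
    (c : ∀ σ : PosetSimplex Q (n + 1), M.obj (.op (ψ.orbit (σ 0))))
    (hc : ψ.evalCoboundary M (n + 1) c = 0) : ∃ b, ψ.evalCoboundary M n b = c := by
  have hQ : Fintype Q := Fintype.ofFinite Q
  -- The cocycle is supported on simplices starting in `U`, a lower set that is a union of blocks.
  suffices ∀ (U : Finset Q), (∀ S T, S ≤ T → T ∈ U → S ∈ U) →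
      (∀ C, GQ.IsBlock C → ∀ V ∈ C, V ∈ U → C ⊆ U) →
      ∀ c, ψ.evalCoboundary M (n + 1) c = 0 → (∀ σ, σ 0 ∉ U → c σ = 0) →
        ∃ b, ψ.evalCoboundary M n b = c from
    this Finset.univ (fun S _ _ _ => Finset.mem_univ S) (fun _ _ _ _ _ S _ => Finset.mem_univ S) c hc
      fun σ hσ => absurd (Finset.mem_univ _) hσ
  intro U
  induction U using Finset.strongInduction with
  | H U ih =>
    intro hlow hsat c hc hcU
    obtain rfl | hne := U.eq_empty_or_nonempty
    · refine ⟨0, ?_⟩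
      rw [map_zero]
      exact funext fun σ => (hcU σ (Finset.notMem_empty _)).symm
    obtain ⟨V, hVU, hVmax⟩ := Finset.exists_maximalFor ψ.localSubgroup U hne
    obtain ⟨C, hC, hVC⟩ := exists_mem_block (GQ := GQ) V
    obtain ⟨b, hb0, hb⟩ := ψ.exists_evalCoboundary_eq_on_block M hψ hC hVC (h C hC) (h' C hC) c hc
      fun σ hσ => hcU σ fun hU => hσ.not_ge (hVmax hU hσ.le)
    obtain ⟨b', hb'⟩ := ih (U.filter (· ∉ C))
      (Finset.filter_ssubset.mpr ⟨V, hVU, not_not.mpr hVC⟩) (fun S T hle hT => by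
        -- Removing `C` keeps a lower set: if `S ∈ C` were below `T`, maximality would give both the
        -- same group and put `T` in `C`.
        rw [Finset.mem_filter] at hT ⊢
        refine ⟨hlow S T hle hT.1, fun hS => hT.2 ?_⟩
        have e := ψ.localSubgroup_eq_of_mem_block hψ hC hVC hS
        refine (ψ.mem_block_of_le hψ hC hle (le_antisymm (ψ.localSubgroup_mono hle) ?_)).mp hS
        rw [← e]
        exact hVmax hT.1 (e.le.trans (ψ.localSubgroup_mono hle)))
      (fun D hD W hWD hW X hX => by
        have hW' := Finset.mem_filter.mp hW
        refine Finset.mem_coe.mpr (Finset.mem_filter.mpr ⟨hsat D hD W hWD hW'.1 hX, fun hXC => ?_⟩)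
        exact hW'.2 (block_eq_of_mem hD hC hX hXC ▸ hWD))
      (c - ψ.evalCoboundary M n b) (by rw [map_sub, hc, evalCoboundary_evalCoboundary, sub_zero])
      (fun σ hσ => by
        rw [Pi.sub_apply]
        by_cases hσC : σ 0 ∈ C
        · rw [hb σ hσC, sub_self]
        · have hσU : σ 0 ∉ U := fun hU => hσ (Finset.mem_filter.mpr ⟨hU, hσC⟩)
          rw [hcU σ hσU, zero_sub, neg_eq_zero]
          -- The correction `b` lives over `C ⊆ U`, and `U` is a lower set, so a simplex starting
          -- outside `U` has no face starting in `C`.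
          rw [evalCoboundary_apply]
          refine Finset.sum_eq_zero fun i _ => ?_
          rw [hb0]
          · exact (congrArg (_ • ·) (map_zero _)).trans (zsmul_zero _)
          exact fun hT => hσU (hlow _ _ (face_zero_le i σ) (hsat C hC V hVC hVU hT)))
    exact ⟨b' + b, by rw [map_add, hb', sub_add_cancel]⟩

/-- If the cohomology of all blocks vanishes in degrees `n + 1` and `n + 2`, then every Bredon
cocycle of degree `n + 1` is a coboundary. -/
lemma exists_chainBdry_comp_eq [Finite Q] (hψ : ∀ J : Q, Function.Injective (ψ.hom J)) {n : ℕ}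
    (h : ∀ C, GQ.IsBlock C → Subsingleton (ψ.panelCohomology C (n + 1)))
    (h' : ∀ C, GQ.IsBlock C → Subsingleton (ψ.panelCohomology C (n + 2)))
    (φ : fixedPointsModule ψ.family (ψ.Cell (n + 1)) ⟶ M) (hφ : ψ.chainBdry (n + 1) ≫ φ = 0) :
    ∃ η, ψ.chainBdry n ≫ η = φ := by
  obtain ⟨b, hb⟩ := ψ.exists_evalCoboundary_eq M hψ h h' (ψ.cochainEval M (n + 1) φ) (by
    rw [← cochainEval_comp, hφ, map_zero])
  obtain ⟨η, rfl⟩ := ψ.cochainEval_surjective M n b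
  exact ⟨η, ψ.cochainEval_injective M (n + 1) (by rw [cochainEval_comp, hb])⟩

end SimpleMorphism

end

noncomputable section

/-! ## Bredon cohomological dimension -/

section Degrees

variable {Q : Type u} [PartialOrder Q] {A B : Set Q}

lemma subsingleton_relCohomology [Fintype Q] {n : ℕ} (hn : Fintype.card Q ≤ n) :
    Subsingleton (relCohomology A B n) := by
  have he : IsEmpty (PosetSimplex Q n) := ⟨fun σ => by
    have := Fintype.card_le_of_injective σ σ.injective
    rw [Fintype.card_fin] at this
    omega⟩
  have hs : Subsingleton (relCochains A B n) :=
    ⟨fun f g => Subtype.ext (funext fun σ => he.elim σ.1)⟩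
  have hz : Limits.IsZero ((relCochainComplex A B).X n) :=
    @ModuleCat.isZero_of_subsingleton _ _ (ModuleCat.of ℤ (relCochains A B n)) hs
  have hE : (relCochainComplex A B).ExactAt n := ShortComplex.exact_of_isZero_X₂ _ hz
  exact ModuleCat.subsingleton_of_isZero hE.isZero_homology

lemma nontrivial_relCohomology_zero {f : relCochains A B 0} (hf : relCoboundary A B 0 f = 0)
    (hf0 : f ≠ 0) : Nontrivial (relCohomology A B 0) := by
  by_contra h
  have h' : Subsingleton (relCohomology A B 0) := not_nontrivial_iff_subsingleton.mp h
  have he : (relCochainComplex A B).ExactAt 0 := by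
    rw [HomologicalComplex.exactAt_iff_isZero_homology]
    exact @ModuleCat.isZero_of_subsingleton _ _ _ h'
  rw [HomologicalComplex.exactAt_iff' _ 0 0 1 (by simp) (by simp),
    ShortComplex.moduleCat_exact_iff] at he
  obtain ⟨g, hg⟩ := he f (by
    refine Eq.trans ?_ hf
    exact congrArg (fun d => d.hom f) (relCochainComplex_d A B 0))
  refine hf0 (hg.symm.trans ?_)
  exact congrArg (fun d => d.hom g) ((relCochainComplex A B).shape 0 0 (by simp))

end Degrees

namespace SimpleMorphism

open Classical

variable {Q : Type u} [PartialOrder Q] {GQ : SimpleComplexOfGroups.{v, u} Q}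
  {G : Type u} [Group G] (ψ : SimpleMorphism GQ G)

/-- For a block with maximal local group `K_{>C}` is empty, so the constant function `1` is a
nonzero class. The maximum is thus over a nonempty set. -/
lemma exists_nontrivial_panelCohomology_zero [Finite Q] [Nonempty Q]
    (hψ : ∀ J : Q, Function.Injective (ψ.hom J)) :
    ∃ C, GQ.IsBlock C ∧ Nontrivial (ψ.panelCohomology C 0) := by
  have hQ : Fintype Q := Fintype.ofFinite Q
  obtain ⟨V, -, hmax⟩ := Finset.exists_maximalFor ψ.localSubgroup Finset.univ
    (Finset.univ_nonempty (α := Q))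
  obtain ⟨C, hC, hVC⟩ := exists_mem_block (GQ := GQ) V
  have hempty : ∀ T, T ∉ ψ.strictUpperSet C := by
    rintro T ⟨U, hU, -, hlt⟩
    rw [← ψ.localSubgroup_eq_of_mem_block hψ hC hVC hU] at hlt
    exact hlt.not_ge (hmax (Finset.mem_univ T) hlt.le)
  let f : relCochains (ψ.upperSet C) (ψ.strictUpperSet C) 0 :=
    ⟨fun _ => 1, fun σ h => absurd (h 0) (hempty _)⟩
  refine ⟨C, hC, nontrivial_relCohomology_zero (f := f) ?_ ?_⟩
  · ext τ
    change ∑ i : Fin 2, (-1 : ℤ) ^ (i : ℕ) * 1 = 0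
    simp
  · intro h
    let σ : PosetSimplex Q 0 := OrderEmbedding.ofMapLEIff (fun _ => V) fun i j => by
      have : i = j := Subsingleton.elim (α := Fin 1) i j
      simp [this]
    have := congrArg (fun f => f.1 ⟨σ, ψ.mem_upperSet_of_mem (C := C) (σ := σ) hVC⟩) h
    exact one_ne_zero this

lemma exists_isRepresentatives (J : Q) : ∃ I, ψ.IsRepresentatives J I := by
  let R := QuotientGroup.rightRel (ψ.localSubgroup J)
  have hout : ∀ g : G, ∃ p ∈ ψ.localSubgroup J, (Quotient.mk R g).out = p * g := fun g => by
    have h : R (Quotient.mk R g).out g := Quotient.mk_out g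
    rw [QuotientGroup.rightRel_apply] at h
    exact ⟨_, inv_mem h, by group⟩
  refine ⟨{g | (Quotient.mk R g).out = g ∧ (ψ.conjIndex J g).Nonempty}, fun g hg => hg.2,
    fun g hg => ?_⟩
  have hmk : ∀ p ∈ ψ.localSubgroup J, Quotient.mk R (p * g) = Quotient.mk R g := fun p hp => by
    refine Quotient.sound ?_
    change R _ _
    rw [QuotientGroup.rightRel_apply]
    simpa using hp
  obtain ⟨p, hp, e⟩ := hout g
  refine ⟨p * g, ⟨⟨?_, ?_⟩, p, hp, rfl⟩, ?_⟩
  · rw [hmk p hp, e]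
  · obtain ⟨U, hU⟩ := hg
    refine ⟨U, mem_conjIndex.mpr ?_⟩
    rw [conjSubgroup_mul, mem_conjIndex.mp hU, conjSubgroup_of_mem hp]
  · rintro _ ⟨⟨h, -⟩, q, hq, rfl⟩
    rw [← h, hmk q hq, e]

lemma nontrivial_bredonCohomology_isomModule [Finite Q]
    (hψ : ∀ J : Q, Function.Injective (ψ.hom J)) {C : Set Q} (hC : GQ.IsBlock C) {J : Q}
    (hJ : J ∈ C) {n : ℕ} (h : Nontrivial (ψ.panelCohomology C n)) :
    Nontrivial (ψ.bredonCohomology ψ.family (isomModule ψ.family (ψ.localSubgroup J)) n) := by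
  obtain ⟨I, hI⟩ := ψ.exists_isRepresentatives J
  have h1 : ∀ U ∈ C, U ∈ ψ.conjIndex J 1 := fun U hU => by
    rw [mem_conjIndex, conjSubgroup_one]
    exact ψ.localSubgroup_eq_of_mem_block hψ hC hU hJ
  -- The relevant summand belongs to the class of `1`, whose representative may differ from `1` by
  -- an element of `P_J`.
  obtain ⟨r, ⟨hr, p, hp, rfl⟩, -⟩ := hI.existsUnique 1 ⟨J, h1 J hJ⟩
  obtain ⟨e⟩ := ψ.bredonCohomology_isomModule_equiv hI hψ n
  let i : {C : Set Q // GQ.IsBlock C ∧ C ⊆ ψ.conjIndex J (p * 1)} := ⟨C, hC, fun U hU => by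
    rw [mem_conjIndex, conjSubgroup_mul, mem_conjIndex.mp (h1 U hU), conjSubgroup_of_mem hp]⟩
  refine Function.Injective.nontrivial (α := ψ.panelCohomology C n)
    (f := fun x => e.symm (DirectSum.of _ (⟨p * 1, hr⟩ : I) (DirectSum.of _ i x))) ?_
  exact e.symm.injective.comp ((DirectSum.of_injective _).comp
    (DirectSum.of_injective (β := fun i : {C : Set Q // GQ.IsBlock C ∧ C ⊆ ψ.conjIndex J (p * 1)} =>
      ψ.panelCohomology i.1 n) i))

lemma subsingleton_bredonCohomology {M : OrbitModule ψ.family} {n : ℕ}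
    (h : ∀ φ : fixedPointsModule ψ.family (ψ.Cell (n + 1)) ⟶ M, ψ.chainBdry (n + 1) ≫ φ = 0 →
      ∃ η, ψ.chainBdry n ≫ η = φ) : Subsingleton (ψ.bredonCohomology ψ.family M (n + 1)) := by
  have he : ((ψ.bredonChainComplex ψ.family).linearYonedaObj ℤ M).ExactAt (n + 1) := by
    rw [HomologicalComplex.exactAt_iff' _ n (n + 1) (n + 2) (by simp) (by simp),
      ShortComplex.moduleCat_exact_iff]
    intro φ hφ
    obtain ⟨η, hη⟩ := h φ (by
      refine Eq.trans ?_ hφ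
      rw [← bredonChainComplex_d]
      rfl)
    refine ⟨η, Eq.trans ?_ hη⟩
    rw [← bredonChainComplex_d]
    rfl
  exact ModuleCat.subsingleton_of_isZero he.isZero_homology

lemma nontrivial_bredonGroupCohomology_zero [Nonempty Q] :
    Nontrivial (bredonGroupCohomology ψ.family (constantModule ψ.family) 0) := by
  let _ : HasExt.{u + 1} (OrbitModule ψ.family) := HasExt.standard _
  change Nontrivial (Abelian.Ext (constantModule ψ.family) (constantModule ψ.family) 0)
  have : Nontrivial (constantModule ψ.family ⟶ constantModule ψ.family) := by
    refine ⟨𝟙 _, 0, fun h => ?_⟩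
    have h1 := congrArg (fun η : constantModule ψ.family ⟶ constantModule ψ.family =>
      (η.app (.op (ψ.orbit (Classical.arbitrary Q)))).hom (ULift.up 1)) h
    exact one_ne_zero (congrArg ULift.down h1)
  exact Abelian.Ext.homEquiv₀.symm.injective.nontrivial

section Ext

variable [Fintype Q]

/-- The cellular projective resolution of the constant module. -/
def cellularResolution (hX : ∀ H ∈ ψ.family, ContractibleSpace (ψ.FixedSet H)) :
    ProjectiveResolution (constantModule ψ.family) where
  complex := ψ.bredonChainComplex ψ.family
  projective n := inferInstanceAs (Projective (fixedPointsModule ψ.family (ψ.Cell n)))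
  π := ψ.resolutionMap
  quasiIso := ψ.quasiIso_resolutionMap hX

lemma subsingleton_bredonGroupCohomology_iff
    (hX : ∀ H ∈ ψ.family, ContractibleSpace (ψ.FixedSet H)) (M : OrbitModule ψ.family) (n : ℕ) :
    Subsingleton (bredonGroupCohomology ψ.family M (n + 1)) ↔
      ∀ φ : fixedPointsModule ψ.family (ψ.Cell (n + 1)) ⟶ M, ψ.chainBdry (n + 1) ≫ φ = 0 →
        ∃ η, ψ.chainBdry n ≫ η = φ := by
  let _ : HasExt.{u + 1} (OrbitModule ψ.family) := HasExt.standard _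
  let R := ψ.cellularResolution hX
  have hd : ∀ n, R.complex.d (n + 1) n = ψ.chainBdry n := ψ.bredonChainComplex_d
  change Subsingleton (Abelian.Ext (constantModule ψ.family) M (n + 1)) ↔ _
  constructor
  · intro h φ hφ
    have hφ' : R.complex.d (n + 2) (n + 1) ≫ φ = 0 := by
      rw [hd]
      exact hφ
    obtain ⟨η, hη⟩ := (R.extMk_eq_zero_iff φ (n + 2) rfl hφ' n rfl).mp (Subsingleton.elim _ _)
    rw [hd] at hη
    exact ⟨η, hη⟩
  · intro h
    refine subsingleton_of_forall_eq 0 fun x => ?_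
    obtain ⟨φ, hφ, rfl⟩ := R.extMk_surjective x (n + 2) rfl
    rw [R.extMk_eq_zero_iff φ (n + 2) rfl hφ n rfl]
    have hφ' := hφ
    rw [hd] at hφ'
    obtain ⟨η, hη⟩ := h φ hφ'
    refine ⟨η, ?_⟩
    rw [hd]
    exact hη

lemma exists_bredonCohDim_eq [Nonempty Q] (hψ : ∀ J : Q, Function.Injective (ψ.hom J))
    (hX : ∀ H ∈ ψ.family, ContractibleSpace (ψ.FixedSet H)) :
    ∃ d : ℕ, bredonCohDim ψ.family = d ∧
      IsGreatest {n : ℕ | ∃ C : Set Q, GQ.IsBlock C ∧ Nontrivial (ψ.panelCohomology C n)} d := by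
  let S := {n : ℕ | ∃ C : Set Q, GQ.IsBlock C ∧ Nontrivial (ψ.panelCohomology C n)}
  have hne : S.Nonempty := by
    obtain ⟨C, hC, h⟩ := ψ.exists_nontrivial_panelCohomology_zero hψ
    exact ⟨0, C, hC, h⟩
  have hb : BddAbove S := ⟨Fintype.card Q, by
    rintro n ⟨C, -, h⟩
    by_contra! hn
    exact not_nontrivial_iff_subsingleton.mpr (subsingleton_relCohomology hn.le) h⟩
  have hd := Nat.sSup_mem hne hb
  have hle : ∀ n ∈ S, n ≤ sSup S := fun n hn => le_csSup hb hn
  refine ⟨sSup S, le_antisymm (sSup_le ?_) (le_sSup ⟨sSup S, rfl, ?_⟩), hd, hle⟩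
  · rintro _ ⟨n, rfl, M, hM⟩
    by_contra! hn
    obtain _ | n := n
    · exact absurd hn (by simp)
    have hn' : sSup S < n + 1 := by exact_mod_cast hn
    -- Beyond the supremum all block cohomology vanishes, in particular in the two consecutive
    -- degrees required below.
    have hs : ∀ m, sSup S < m → ∀ C, GQ.IsBlock C → Subsingleton (ψ.panelCohomology C m) :=
      fun m hm C hC => not_nontrivial_iff_subsingleton.mp fun h => hm.not_ge (hle m ⟨C, hC, h⟩)
    exact not_nontrivial_iff_subsingleton.mpr
      ((ψ.subsingleton_bredonGroupCohomology_iff hX M n).mpr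
        (ψ.exists_chainBdry_comp_eq M hψ (hs _ hn') (hs _ (hn'.trans (Nat.lt_succ_self _))))) hM
  · obtain ⟨C, hC, h⟩ := hd
    -- The cochain criterion for Ext concerns positive degrees only; in degree `0` the identity of
    -- the constant module is a nonzero class.
    obtain hz | ⟨n, hn⟩ := Nat.eq_zero_or_eq_succ_pred (sSup S) |>.imp_right
      fun h => (⟨_, h⟩ : ∃ n, sSup S = n + 1)
    · rw [hz]
      exact ⟨_, ψ.nontrivial_bredonGroupCohomology_zero⟩
    · rw [hn] at h ⊢
      obtain ⟨J, hJ⟩ := Setoid.nonempty_of_mem_partition (Setoid.isPartition_classes _) hC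
      refine ⟨isomModule ψ.family (ψ.localSubgroup J), ?_⟩
      have hB := ψ.nontrivial_bredonCohomology_isomModule hψ hC hJ h
      by_contra hE
      rw [not_nontrivial_iff_subsingleton, ψ.subsingleton_bredonGroupCohomology_iff hX] at hE
      exact not_nontrivial_iff_subsingleton.mpr (ψ.subsingleton_bredonCohomology hE) hB

end Ext

end SimpleMorphism

end

theorem theorem1p1 {Q : Type u} [PartialOrder Q] [Fintype Q] [Nonempty Q]
    (GQ : SimpleComplexOfGroups.{v, u} Q) {G : Type u} [Group G] (ψ : SimpleMorphism GQ G)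
    (hψ : ∀ J : Q, Function.Injective (ψ.hom J)) :
    (∀ (J : Q) (I : Set G), ψ.IsRepresentatives J I → ∀ n : ℕ,
      Nonempty (ψ.bredonCohomology ψ.family (isomModule ψ.family (ψ.localSubgroup J)) n ≃ₗ[ℤ]
        ⨁ (g : I) (C : {C : Set Q // GQ.IsBlock C ∧ C ⊆ ψ.conjIndex J g}),
          ψ.panelCohomology C.1 n)) ∧
    (IsRigid (Set.range ψ.localSubgroup) → IsModelE ψ.family ψ.BasicConstruction →
      ∃ d : ℕ, bredonCohDim ψ.family = d ∧
        IsGreatest {n : ℕ | ∃ C : Set Q, GQ.IsBlock C ∧ Nontrivial (ψ.panelCohomology C n)} d) := by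

  exact ⟨fun J I hI n => ψ.bredonCohomology_isomModule_equiv hI hψ n,
    fun _ hX => ψ.exists_bredonCohDim_eq hψ hX.contractible_fixedPoints⟩
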